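/- **Model.** Let $V_1,\dots,V_n$ be the locations in $\mathbb R^d$ of $n$ nodes, one of which is the root $r$. Node $i$ has a measurement $Y_i$ in a finite set $\mathcal Y$, and the root must learn a sum function $\Psi(Y)=\sum_{i=1}^n\psi_i(Y_i)$, where no $\psi_i:\mathcal Y\to\mathbb R$ is constant. A policy is a finite schedule of transmissions, each taking one time slot and delivering one value that the sender computes from its own measurement and from what it has received so far; in each slot every node takes part in at most one transmission, as sender or as receiver. The policy is valid if at some time $\Psi(Y)$ is a function of what the root knows; the first such time is its latency $L$. Its energy is $\mathcal E=\sum_{(i,j)}\|V_i-V_j\|^\nu$, summed over the set of directed links $(i,j)$ it uses. Let $L^*$ be the minimum latency of a valid policy and, for $\delta\ge 0$, let $\mathcal E^*(\mathbf V_n;\delta)$ be the minimum energy of a valid policy with $L\le L^*+\delta$. **The policy $\pi^{\mathrm{AGG}}$.** Given integer weights $w_k\ge0$, start with the region $Q_n=[0,n^{1/d}]^d$ containing all nodes, in charge of the root. In iteration $k=0,1,\dots,\lceil\log_2 n\rceil-1$, bisect every region $R$ (in charge of node $i$) that has at least two nodes along a coordinate of largest extent of its box, so that the lower half has $\lfloor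 m/2\rfloor$ of its $m$ nodes; the box of each half extends, in that coordinate, up to the nearest node of the other half. Node $i$ keeps the half containing it. If the other half has a node that is on none of the paths chosen so far, any such node $j$ is chosen, is put in charge of that half, and is joined to $i$ by a least-energy path through nodes of $R$ with at most $w_k$ intermediate nodes; otherwise that half is discarded. Then, in the order $k=\lceil\log_2n\rceil-1,\dots,0$, partial sums are forwarded along the paths of iteration $k$ from $j$ to $i$, one link per slot, in a block of $1+w_k$ slots; a transmitting node hands over the whole partial sum it holds. The weights are $w_k=\lfloor\zeta\,\delta\,2^{k(1/\nu-1/d)}\rfloor$ if $\nu\ge d$ and $w_k=0$ if $\nu<d$, where $\zeta=1-2^{1/\nu-1/d}$ if $\nu>d$ and $\zeta=\lceil\log_2 n\rceil^{-1}$ if $\nu=d$. **Theorem (Energy-latency tradeoff).** Fix $d\ge1$ and $\nu>1$, and let $V_1,\dots,V_n$ be independent and uniform in $[0,n^{1/d}]^d$. As $n\to\infty$, $$\mathbb E\,\mathcal E^*(\mathbf V_n;\delta)=\begin{cases}\Theta(n), & \nu<d,\\ O\big(\max\{n,\;n\log n\,(1+\tfrac{\delta}{\log n})^{1-\nu}\}\big),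 & \nu=d,\\ \Theta\big(\max\{n,\;n^{\nu/d}(1+\delta)^{1-\nu}\}\big), & \nu>d,\end{cases}$$ where the threshold for $n$ and the implied constants depend only on $d$ and $\nu$ (not on $\delta=\delta(n)\ge0$, the root, $\mathcal Y$ or the $\psi_i$). Moreover, for all locations of the nodes the policy $\pi^{\mathrm{AGG}}$ with the above weights can be run, is valid and has latency at most $L^*+\delta$, and these upper bounds hold for its expected energy, however the choices that its description leaves open are made (the maximum of its energy over these choices is almost surely at most a random variable whose expectation satisfies the bound). -/

import Mathlib

open MeasureTheory

noncomputable section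

namespace EnergyLatency

/-! ### The communication model -/

/-- What a node has received in slots `0, …, t - 1`, most recent slot first (so the length of the
list is the number of elapsed slots).  Each entry gives the value received from each node, if any. -/
abbrev History (n : ℕ) := List (Fin n → Option ℝ)

/-- A policy: a finite transmission schedule, where `(t, i, j) ∈ tx` means that node `i` transmits
to node `j` between time `t` and time `t + 1`, and a rule giving the value that a node sends, as an
arbitrary function of its own measurement and of what it has received so far. -/
structure Policy (n : ℕ) (Y : Type) where
  tx : Finset (ℕ × Fin n × Fin n)
  msg : Fin n → Y → History n → ℝ

namespace Policy

variable {n : ℕ} {Y : Type}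

/-- In every slot each node takes part in at most one transmission, as sender or as receiver. -/
def ConflictFree (p : Policy n Y) : Prop :=
  (∀ t i j, (t, i, j) ∈ p.tx → i ≠ j) ∧
  ∀ t i j i' j', (t, i, j) ∈ p.tx → (t, i', j') ∈ p.tx → (i, j) ≠ (i', j') →
    i ≠ i' ∧ i ≠ j' ∧ j ≠ i' ∧ j ≠ j'

/-- What node `j` has received up to time `t` when the measurements are `y`. -/
def view (p : Policy n Y) (y : Fin n → Y) : ℕ → Fin n → History n
  | 0, _ => []
  | t + 1, j =>
      (fun i => if (t, i, j) ∈ p.tx then some (p.msg i (y i) (p.view y t i)) else none) ::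
        p.view y t j

/-- The function `Ψ` of the measurements is computable at `r` at time `t`. -/
def ComputableAt (p : Policy n Y) (r : Fin n) (Ψ : (Fin n → Y) → ℝ) (t : ℕ) : Prop :=
  ∃ dec : Y → History n → ℝ, ∀ y, dec (y r) (p.view y t r) = Ψ y

/-- Valid policies: the medium-access constraints hold and `Ψ` is eventually computable at `r`. -/
def Valid (p : Policy n Y) (r : Fin n) (Ψ : (Fin n → Y) → ℝ) : Prop :=
  p.ConflictFree ∧ ∃ t, p.ComputableAt r Ψ t

/-- The first time at which `Ψ` is computable at `r`. -/
def latency (p : Policy n Y) (r : Fin n) (Ψ : (Fin n → Y) → ℝ) : ℕ :=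
  sInf {t | p.ComputableAt r Ψ t}

/-- The set of links used by the policy. -/
def links (p : Policy n Y) : Finset (Fin n × Fin n) := p.tx.image Prod.snd

/-- Total energy: a link of Euclidean length `R` costs `R ^ ν`. -/
def energy {d : ℕ} (ν : ℝ) (V : Fin n → EuclideanSpace ℝ (Fin d)) (p : Policy n Y) : ℝ :=
  ∑ e ∈ p.links, dist (V e.1) (V e.2) ^ ν

end Policy

/-- Sum functions. -/
def sumFunction {n : ℕ} {Y : Type} (ψ : Fin n → Y → ℝ) (y : Fin n → Y) : ℝ := ∑ i, ψ i (y i)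

/-- The minimum latency over valid policies. -/
def minLatency {n : ℕ} {Y : Type} (r : Fin n) (Ψ : (Fin n → Y) → ℝ) : ℕ :=
  sInf {l | ∃ p : Policy n Y, p.Valid r Ψ ∧ p.latency r Ψ = l}

/-- The minimum energy over valid policies whose latency exceeds the minimum by at most `δ`. -/
def minEnergy {d n : ℕ} {Y : Type} (ν δ : ℝ) (r : Fin n) (Ψ : (Fin n → Y) → ℝ)
    (V : Fin n → EuclideanSpace ℝ (Fin d)) : ℝ :=
  sInf {E | ∃ p : Policy n Y, p.Valid r Ψ ∧ (p.latency r Ψ : ℝ) ≤ minLatency r Ψ + δ ∧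
    p.energy ν V = E}

/-! ### Random node locations -/

/-- The side length `n ^ (1 / d)` of the cube of volume `n`. -/
def side (d n : ℕ) : ℝ := (n : ℝ) ^ (1 / (d : ℝ))

/-- The cube `[0, n ^ (1 / d)] ^ d`. -/
def cube (d n : ℕ) : Set (EuclideanSpace ℝ (Fin d)) := {x | ∀ c, x c ∈ Set.Icc 0 (side d n)}

/-- The law of `n` independent uniformly distributed points of the cube. -/
def locationLaw (d n : ℕ) : Measure (Fin n → EuclideanSpace ℝ (Fin d)) :=
  Measure.pi fun _ => ProbabilityTheory.cond volume (cube d n)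

/-! ### The aggregation policy by successive bisection -/

/-- A rectangular box `∏ [lo c, hi c]` together with the set of the nodes assigned to it. -/
structure Region (d n : ℕ) where
  lo : Fin d → ℝ
  hi : Fin d → ℝ
  nodes : Finset (Fin n)

/-- The whole cube with all nodes. -/
def Region.whole (d n : ℕ) : Region d n := ⟨fun _ => 0, fun _ => side d n, Finset.univ⟩

/-- `L` and `U` are the lower and upper halves of `R`, bisected along a coordinate `c` of largest
extent, with equally many nodes up to rounding.  The box of the lower half reaches up to the first
node of the upper half and vice versa; the overlap of the boxes has no node in its interior. -/
def Bisects {d n : ℕ} (V : Fin n → EuclideanSpace ℝ (Fin d)) (R L U : Region d n) : Prop :=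
  ∃ (c : Fin d) (a b : ℝ),
    (∀ c', R.hi c' - R.lo c' ≤ R.hi c - R.lo c) ∧
    L.nodes ⊆ R.nodes ∧ U.nodes = R.nodes \ L.nodes ∧ L.nodes.card = R.nodes.card / 2 ∧
    (∀ x ∈ L.nodes, ∀ y ∈ U.nodes, V x c ≤ V y c) ∧
    IsGreatest ((fun x => V x c) '' (L.nodes : Set (Fin n))) a ∧
    IsLeast ((fun x => V x c) '' (U.nodes : Set (Fin n))) b ∧
    L.lo = R.lo ∧ L.hi = Function.update R.hi c b ∧
    U.lo = Function.update R.lo c a ∧ U.hi = R.hi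

/-- The consecutive links of a path. -/
def pathLinks {n : ℕ} (P : List (Fin n)) : List (Fin n × Fin n) := P.zip P.tail

/-- The energy of a path. -/
def pathEnergy {d n : ℕ} (ν : ℝ) (V : Fin n → EuclideanSpace ℝ (Fin d)) (P : List (Fin n)) : ℝ :=
  ((pathLinks P).map fun e => dist (V e.1) (V e.2) ^ ν).sum

/-- `P` is a path from `j` to `i` through nodes of `S` with at most `l` intermediate nodes. -/
def IsPath {n : ℕ} (S : Finset (Fin n)) (l : ℕ) (j i : Fin n) (P : List (Fin n)) : Prop :=
  P.Nodup ∧ P.head? = some j ∧ P.getLast? = some i ∧ (∀ x ∈ P, x ∈ S) ∧ P.length ≤ l + 2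

/-- `P` is a least-energy path from `j` to `i` in `S` with at most `l` intermediate nodes. -/
def IsLeastEnergyPath {d n : ℕ} (ν : ℝ) (V : Fin n → EuclideanSpace ℝ (Fin d))
    (S : Finset (Fin n)) (l : ℕ) (j i : Fin n) (P : List (Fin n)) : Prop :=
  IsPath S l j i P ∧ ∀ P', IsPath S l j i P' → pathEnergy ν V P ≤ pathEnergy ν V P'

/-- `BisectionRun ν V w k R i A out`: starting at iteration `k` with the region `R` in charge of the
node `i`, when the nodes in `A` lie on paths chosen before, the bisection algorithm with weights `w`
can produce the list `out` of paths, each recorded with the iteration that created it.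
All choices the algorithm leaves open (ties, the new node `j`) are arbitrary.

Iteration `k` bisects `R` into the half `R₁` of `i` and the other half `R₂`.  If `R₂` has a node `j`
not in `A`, then `j` is joined to `i` by a least-energy path inside `R` with at most `w k`
intermediate nodes, and takes charge of `R₂`; otherwise nothing is left to do in `R₂`.
Since regions in the same iteration have disjoint sets of nodes and paths stay inside them, the
order in which the regions of an iteration are treated does not matter. -/
inductive BisectionRun {d n : ℕ} (ν : ℝ) (V : Fin n → EuclideanSpace ℝ (Fin d)) (w : ℕ → ℕ) :
    ℕ → Region d n → Fin n → Finset (Fin n) → List (ℕ × List (Fin n)) → Prop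
  | halt (k : ℕ) (R : Region d n) (i : Fin n) (A : Finset (Fin n)) :
      R.nodes.card ≤ 1 → BisectionRun ν V w k R i A []
  | join (k : ℕ) (R R₁ R₂ : Region d n) (i j : Fin n) (A : Finset (Fin n)) (P : List (Fin n))
      (out₁ out₂ : List (ℕ × List (Fin n))) :
      2 ≤ R.nodes.card → (Bisects V R R₁ R₂ ∨ Bisects V R R₂ R₁) → i ∈ R₁.nodes →
      j ∈ R₂.nodes → j ∉ A → IsLeastEnergyPath ν V R.nodes (w k) j i P →
      BisectionRun ν V w (k + 1) R₁ i (A ∪ P.toFinset) out₁ →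
      BisectionRun ν V w (k + 1) R₂ j (A ∪ P.toFinset) out₂ →
      BisectionRun ν V w k R i A ((k, P) :: (out₁ ++ out₂))
  | skip (k : ℕ) (R R₁ R₂ : Region d n) (i : Fin n) (A : Finset (Fin n))
      (out : List (ℕ × List (Fin n))) :
      2 ≤ R.nodes.card → (Bisects V R R₁ R₂ ∨ Bisects V R R₂ R₁) → i ∈ R₁.nodes →
      R₂.nodes ⊆ A → BisectionRun ν V w (k + 1) R₁ i A out → BisectionRun ν V w k R i A out

/-- The possible outputs of the bisection algorithm on all nodes with root `r`. -/
def IsBisectionOutput {d n : ℕ} (ν : ℝ) (V : Fin n → EuclideanSpace ℝ (Fin d)) (w : ℕ → ℕ)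
    (r : Fin n) (out : List (ℕ × List (Fin n))) : Prop :=
  BisectionRun ν V w 0 (Region.whole d n) r {r} out

/-- The paths of iteration `k` are used in a block of `1 + w k` consecutive slots; the blocks of
iterations `⌈log₂ n⌉ - 1, …, 1, 0` follow one another.  This is the first slot of block `k`. -/
def blockStart (n : ℕ) (w : ℕ → ℕ) (k : ℕ) : ℕ := ∑ l ∈ Finset.Ico (k + 1) (Nat.clog 2 n), (1 + w l)

/-- The transmission schedule: along every path data moves one link per slot, in its block. -/
def aggSchedule {n : ℕ} (w : ℕ → ℕ) (out : List (ℕ × List (Fin n))) :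
    Finset (ℕ × Fin n × Fin n) :=
  (out.flatMap fun q =>
    (pathLinks q.2).zipIdx.map fun e => (blockStart n w q.1 + e.2, e.1.1, e.1.2)).toFinset

/-- The partial sum held by node `i`: initially its own term `ψ i (y i)`; it adds all values it
receives and hands over the whole sum when it transmits. -/
def held {n : ℕ} {Y : Type} (ψ : Fin n → Y → ℝ) (tx : Finset (ℕ × Fin n × Fin n)) (i : Fin n)
    (yi : Y) : History n → ℝ
  | [] => ψ i yi
  | m :: h => (if ∃ j, (h.length, i, j) ∈ tx then 0 else held ψ tx i yi h) + ∑ j, (m j).getD 0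

/-- The policy that aggregates partial sums along the paths in `out`. -/
def aggPolicy {n : ℕ} {Y : Type} (ψ : Fin n → Y → ℝ) (w : ℕ → ℕ)
    (out : List (ℕ × List (Fin n))) : Policy n Y where
  tx := aggSchedule w out
  msg := held ψ (aggSchedule w out)

/-- The normalizing constant of the weights. -/
def zeta (d : ℕ) (ν : ℝ) (n : ℕ) : ℝ :=
  if ν = d then ((Nat.clog 2 n : ℕ) : ℝ)⁻¹ else 1 - (2 : ℝ) ^ (1 / ν - 1 / (d : ℝ))

/-- The weights `w k`. -/
def weight (d : ℕ) (ν : ℝ) (n : ℕ) (δ : ℝ) (k : ℕ) : ℕ :=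
  if ν < d then 0 else ⌊zeta d ν n * δ * (2 : ℝ) ^ ((k : ℝ) * (1 / ν - 1 / (d : ℝ)))⌋₊

/-- The order of growth of the energy. -/
def rate (d : ℕ) (ν : ℝ) (n : ℕ) (δ : ℝ) : ℝ :=
  if ν < d then n
  else if ν = d then max (n : ℝ) (n * Real.log n * (1 + δ / Real.log n) ^ (1 - ν))
  else max (n : ℝ) ((n : ℝ) ^ (ν / d) * (1 + δ) ^ (1 - ν))

end EnergyLatency

end

/-!
*Latency.* The nodes whose state `s` slots before the root knows `Ψ` can still influence the root at
most double in number with each further slot, because a node takes part in one transmission per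
slot. All `n` nodes have to be among them in the end, so no policy is faster than `⌈log₂ n⌉`. The
policy `π^AGG` attains this with `w = 0` (`minLatency_eq`) and in general takes `∑ (1 + w k)` slots,
where `∑ w k ≤ δ` (`sum_weight_le`). It is valid because the paths of one iteration are
node-disjoint and each node other than the root is an intermediate or initial node of the first
path that visits it, so that it passes on all it holds when that path is served, as the last one
(`GoodPaths.valid`, `GoodPaths.latency_le`).

*Lower bounds.* Every node other than the root sends at least once, and a positive fraction of the
nodes has no neighbour within a constant distance, which gives a term linear in `n`
(`linear_le_integral_minEnergy`). For `ν > d` let at least half of the nodes be at distance more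
than `D`, of order `n ^ (1 / d)`, from the root. Either one of the nodes at distance more than
`D / 2` can influence the root within the last `⌈δ⌉ + 1` slots; then a path of at most `⌈δ⌉ + 1`
links has length at least `D / 2`, and by convexity of `x ^ ν` its energy is at least of order
`D ^ ν * (1 + δ) ^ (1 - ν)`. Or fewer than `⌈log₂ n⌉` slots remain, and the number of far
informants has to reach `n / 2` by doubling from `0`; this is possible only if energy of order
`D ^ ν` is spent on links that cross one of a sequence of annuli of geometrically decreasing
widths (`far_le_energy`).

*Upper bound for `d ≥ 2`.* Conditionally on the boundary between two halves, the nodes of a half are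
independent and uniform in its box, and the relative extent of that box has a beta distribution
with mean close to `1 / 2`. Bisecting along a longest coordinate therefore multiplies, on average,
the `ν`-th power of the extent of a box by `2 ^ (-ν / d)`, up to factors `1 + O(m ^ (-1 / 2))` for
boxes with `m` nodes, whose product over the levels converges (`lmarginal_levelSum_le`). The open
choices of the algorithm are covered by summing over all coordinates that are tied for the largest
extent. In a box of extent `t` cut into `u ^ d` cells all of which contain nodes, `u` links of length
`O(t / u)` along a segment join any two nodes, so a least-energy path costs `O(t ^ ν * u ^ (1 - ν))`;
otherwise the direct link is used (`IsLeastEnergyPath.ofReal_pathEnergy_le`). With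
`u = min (w + 1) ⌊m ^ a⌋`, where `a < 1 / d` makes an empty cell exponentially unlikely and `a` is so
close to `1 / d` that the truncation of `u` contributes `O(n)` in total, the sum over the iterations
(`sum_weight_energy_le`) has the stated order (`hasEnergyBound_of_two_le`).

*Upper bound for `d = 1`.* No such `a` exists, as paths through all nodes of a region
matter. Let `Γ` be the sum of the `ν`-th powers of the gaps between adjacent nodes. A path restricted
by `w` costs at most what taking every `s`-th node costs, which is bounded by `Γ` for the region times
`s ^ (ν - 1)` (`IsLeastEnergyPath.pathEnergy_le_gapSum`); a path that may visit all nodes of its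
region uses only links between adjacent nodes (`IsLeastEnergyPath.adjacent`), and the energy counts
each link once. Since the expectation of `Γ` is `O(n)` (`lintegral_gapSum_le`), the claim follows
(`hasEnergyBound_one`).
-/

namespace EnergyLatency

open Finset
open scoped ENNReal

/-! ### Lower bounds for fixed locations -/

section Communication

variable {n : ℕ} {Y : Type}

/-- The nodes whose state at time `L - s` can influence what the root `r` knows at time `L`. -/
def informants (p : Policy n Y) (r : Fin n) (L : ℕ) : ℕ → Finset (Fin n)
  | 0 => {r}
  | s + 1 => informants p r L s ∪
      univ.filter fun i => ∃ j ∈ informants p r L s, (L - (s + 1), i, j) ∈ p.tx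

lemma informants_subset_succ (p : Policy n Y) (r : Fin n) (L s : ℕ) :
    informants p r L s ⊆ informants p r L (s + 1) := subset_union_left

lemma informants_mono (p : Policy n Y) (r : Fin n) (L : ℕ) : Monotone (informants p r L) :=
  monotone_nat_of_le_succ (informants_subset_succ p r L)

lemma root_mem_informants (p : Policy n Y) (r : Fin n) (L s : ℕ) : r ∈ informants p r L s :=
  informants_mono p r L (Nat.zero_le s) (by simp [informants])

/-- Measurements of nodes outside `informants p r L L` do not affect the view of the root. -/
lemma view_congr (p : Policy n Y) (r : Fin n) (L : ℕ) {y y' : Fin n → Y}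
    (h : ∀ v ∈ informants p r L L, y v = y' v) :
    ∀ t ≤ L, ∀ j ∈ informants p r L (L - t), p.view y t j = p.view y' t j := by
  intro t
  induction t with
  | zero => intro _ j _; rfl
  | succ t ih =>
    intro ht j hj
    have e1 : L - t = (L - (t + 1)) + 1 := by omega
    have e2 : L - (L - (t + 1) + 1) = t := by omega
    have hj' : j ∈ informants p r L (L - t) := by
      rw [e1]; exact informants_subset_succ _ _ _ _ hj
    simp only [Policy.view]
    rw [ih (by omega) j hj']
    congr 1
    funext i
    split_ifs with hi
    · have hi' : i ∈ informants p r L (L - t) := by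
        rw [e1, informants]
        refine mem_union_right _ ?_
        rw [mem_filter, e2]
        exact ⟨mem_univ _, j, hj, hi⟩
      rw [ih (by omega) i hi', h i (informants_mono p r L (by omega) hi')]
    · rfl

/-- Distinct receivers have distinct senders in a slot, so a set of receivers has at most as many
senders. -/
lemma card_senders_le {p : Policy n Y} (hp : p.ConflictFree) (t : ℕ) (A J : Finset (Fin n))
    (hA : ∀ i ∈ A, ∃ j ∈ J, (t, i, j) ∈ p.tx) : #A ≤ #J := by
  choose! f hf using hA
  refine card_le_card_of_injOn f (fun i hi => (hf i hi).1) ?_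
  intro i hi i' hi' e
  by_contra hne
  have := hp.2 t i (f i) i' (f i') (hf i hi).2 (hf i' hi').2 (by simp [hne])
  exact this.2.2.2 e

lemma card_informants_le {p : Policy n Y} (hp : p.ConflictFree) (r : Fin n) (L s : ℕ) :
    #(informants p r L s) ≤ 2 ^ s := by
  induction s with
  | zero => simp [informants]
  | succ s ih =>
    have h := card_senders_le hp (L - (s + 1))
      (univ.filter fun i => ∃ j ∈ informants p r L s, (L - (s + 1), i, j) ∈ p.tx)
      (informants p r L s) (fun i hi => (mem_filter.1 hi).2)
    have := card_union_le (informants p r L s)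
      (univ.filter fun i => ∃ j ∈ informants p r L s, (L - (s + 1), i, j) ∈ p.tx)
    rw [informants, pow_succ]
    omega

/-- Since the sum depends on every measurement, every node informs the root. -/
lemma mem_informants {p : Policy n Y} {r : Fin n} {ψ : Fin n → Y → ℝ}
    (hψ : ∀ i, ∃ a b, ψ i a ≠ ψ i b) {L : ℕ} (h : p.ComputableAt r (sumFunction ψ) L)
    (v : Fin n) : v ∈ informants p r L L := by
  by_contra hv
  obtain ⟨dec, hdec⟩ := h
  choose a b hab using hψ
  set y' : Fin n → Y := Function.update a v (b v) with hy'
  have hag : ∀ w ∈ informants p r L L, a w = y' w := by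
    intro w hw
    have : w ≠ v := fun e => hv (e ▸ hw)
    simp [hy', this]
  have h1 : p.view a L r = p.view y' L r :=
    view_congr p r L hag L le_rfl r (root_mem_informants _ _ _ _)
  have h2 := hdec a
  rw [h1, hag r (root_mem_informants _ _ _ _), hdec y'] at h2
  have h3 : ∑ i ∈ univ.erase v, ψ i (y' i) = ∑ i ∈ univ.erase v, ψ i (a i) :=
    sum_congr rfl fun i hi => by simp [hy', (mem_erase.1 hi).1]
  simp only [sumFunction] at h2
  rw [← add_sum_erase _ _ (mem_univ v), ← add_sum_erase _ _ (mem_univ v), h3] at h2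
  have h4 : ψ v (y' v) = ψ v (a v) := add_right_cancel h2
  exact hab v (by rw [← h4]; simp [hy'])

lemma Policy.Valid.computableAt_latency {p : Policy n Y} {r : Fin n} {Ψ : (Fin n → Y) → ℝ}
    (h : p.Valid r Ψ) : p.ComputableAt r Ψ (p.latency r Ψ) := Nat.sInf_mem h.2

lemma clog_le_latency {p : Policy n Y} {r : Fin n} {ψ : Fin n → Y → ℝ}
    (hψ : ∀ i, ∃ a b, ψ i a ≠ ψ i b) (h : p.Valid r (sumFunction ψ)) :
    Nat.clog 2 n ≤ p.latency r (sumFunction ψ) := by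
  refine Nat.clog_le_of_le_pow ?_
  have h1 := card_informants_le h.1 r (p.latency r (sumFunction ψ)) (p.latency r (sumFunction ψ))
  rwa [eq_univ_of_forall (mem_informants hψ h.computableAt_latency), card_univ,
    Fintype.card_fin] at h1

/-- A node informing the root within `s` slots is joined to the root by at most `s` links. -/
lemma exists_links_of_mem_informants {d : ℕ} (p : Policy n Y) (r : Fin n) (L : ℕ)
    (V : Fin n → EuclideanSpace ℝ (Fin d)) (s : ℕ) :
    ∀ v ∈ informants p r L s, ∃ F ⊆ p.links, #F ≤ s ∧
      dist (V v) (V r) ≤ ∑ e ∈ F, dist (V e.1) (V e.2) ∧ ∀ e ∈ F, e.1 ∈ informants p r L s := by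
  induction s with
  | zero =>
    intro v hv
    refine ⟨∅, by simp, by simp, ?_, by simp⟩
    simp only [informants, mem_singleton] at hv
    simp [hv]
  | succ s ih =>
    intro v hv
    by_cases hvs : v ∈ informants p r L s
    · obtain ⟨F, h1, h2, h3, h4⟩ := ih v hvs
      exact ⟨F, h1, by omega, h3, fun e he => informants_subset_succ _ _ _ _ (h4 e he)⟩
    · have hv' := hv
      rw [informants, mem_union] at hv'
      obtain ⟨-, j, hj, hvj⟩ := mem_filter.1 (hv'.resolve_left hvs)
      obtain ⟨F, h1, h2, h3, h4⟩ := ih j hj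
      have hnot : (v, j) ∉ F := fun h => hvs (h4 _ h)
      refine ⟨insert (v, j) F, ?_, ?_, ?_, ?_⟩
      · refine insert_subset ?_ h1
        exact mem_image.2 ⟨_, hvj, rfl⟩
      · rw [card_insert_of_notMem hnot]; omega
      · rw [sum_insert hnot]
        exact (dist_triangle _ (V j) _).trans (by simpa using h3)
      · intro e he
        rcases mem_insert.1 he with rfl | he
        · exact hv
        · exact informants_subset_succ _ _ _ _ (h4 e he)

lemma sum_le_energy {d : ℕ} (ν : ℝ) (V : Fin n → EuclideanSpace ℝ (Fin d)) (p : Policy n Y)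
    {F : Finset (Fin n × Fin n)} (hF : F ⊆ p.links) :
    ∑ e ∈ F, dist (V e.1) (V e.2) ^ ν ≤ p.energy ν V :=
  sum_le_sum_of_subset_of_nonneg hF fun _ _ _ => by positivity

lemma energy_nonneg {d : ℕ} (ν : ℝ) (V : Fin n → EuclideanSpace ℝ (Fin d)) (p : Policy n Y) :
    0 ≤ p.energy ν V := sum_nonneg fun _ _ => by positivity

lemma dist_rpow_le_of_mem_informants {d : ℕ} {ν : ℝ} (hν : 1 < ν) (p : Policy n Y) (r : Fin n)
    (L : ℕ) (V : Fin n → EuclideanSpace ℝ (Fin d)) {s : ℕ} {v : Fin n}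
    (hv : v ∈ informants p r L s) : dist (V v) (V r) ^ ν ≤ (s : ℝ) ^ (ν - 1) * p.energy ν V := by
  obtain ⟨F, h1, h2, h3, -⟩ := exists_links_of_mem_informants p r L V s v hv
  calc dist (V v) (V r) ^ ν ≤ (∑ e ∈ F, dist (V e.1) (V e.2)) ^ ν :=
        Real.rpow_le_rpow dist_nonneg h3 (by linarith)
    _ ≤ (#F : ℝ) ^ (ν - 1) * ∑ e ∈ F, dist (V e.1) (V e.2) ^ ν := by
        have := Real.rpow_sum_le_const_mul_sum_rpow F (fun e => dist (V e.1) (V e.2)) hν.le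
        simpa [abs_of_nonneg, dist_nonneg] using this
    _ ≤ _ := by
        refine mul_le_mul ?_ (sum_le_energy ν V p h1) (sum_nonneg fun _ _ => by positivity)
          (by positivity)
        exact Real.rpow_le_rpow (by positivity) (by exact_mod_cast h2) (by linarith)

/-- Every node other than the root has to transmit. -/
lemma exists_link_of_ne {p : Policy n Y} {r : Fin n} {ψ : Fin n → Y → ℝ}
    (hψ : ∀ i, ∃ a b, ψ i a ≠ ψ i b) (h : p.Valid r (sumFunction ψ)) {v : Fin n} (hv : v ≠ r) :
    ∃ j, j ≠ v ∧ (v, j) ∈ p.links := by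
  have key : ∀ L s, v ∈ informants p r L s → ∃ j, j ≠ v ∧ (v, j) ∈ p.links := by
    intro L s
    induction s with
    | zero => intro h; simp [informants, hv] at h
    | succ s ih =>
      intro h
      rw [informants, mem_union] at h
      rcases h with h | h
      · exact ih h
      · obtain ⟨-, j, -, hvj⟩ := mem_filter.1 h
        exact ⟨j, (‹p.Valid r (sumFunction ψ)›.1.1 _ _ _ hvj).symm, mem_image.2 ⟨_, hvj, rfl⟩⟩
  exact key _ _ (mem_informants hψ h.computableAt_latency v)

/-- The energy is at least `ρ ^ ν` for each non-root node without other nodes within `ρ`. -/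
lemma isolated_le_energy {d : ℕ} {ν ρ : ℝ} (hν : 0 ≤ ν) (hρ : 0 ≤ ρ)
    (V : Fin n → EuclideanSpace ℝ (Fin d)) {p : Policy n Y} {r : Fin n} {ψ : Fin n → Y → ℝ}
    (hψ : ∀ i, ∃ a b, ψ i a ≠ ψ i b) (h : p.Valid r (sumFunction ψ)) (A : Finset (Fin n))
    (hA : ∀ v ∈ A, v ≠ r ∧ ∀ j, j ≠ v → ρ ≤ dist (V v) (V j)) :
    #A * ρ ^ ν ≤ p.energy ν V := by
  have : ∀ v ∈ A, ∃ j, j ≠ v ∧ (v, j) ∈ p.links := fun v hv => exists_link_of_ne hψ h (hA v hv).1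
  choose! f hf using this
  refine le_trans ?_ (sum_le_energy ν V p (F := A.image fun v => (v, f v)) ?_)
  · rw [sum_image (by intro x _ y _ e; exact (Prod.ext_iff.1 e).1), ← nsmul_eq_mul]
    refine card_nsmul_le_sum _ _ _ fun v hv => ?_
    exact Real.rpow_le_rpow hρ ((hA v hv).2 _ (hf v hv).1) hν
  · intro e he
    obtain ⟨v, hv, rfl⟩ := mem_image.1 he
    exact (hf v hv).2

/-- If a slot brings `x` informants from beyond distance `b'` of the root into contact with
informants within distance `b`, these cost `x * (b' - b) ^ ν`.  Other informants beyond `b'` were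
beyond `b` or are in contact with one beyond `b`. -/
lemma card_far_informants_succ_le {d : ℕ} {ν : ℝ} (hν : 0 ≤ ν)
    (V : Fin n → EuclideanSpace ℝ (Fin d)) {p : Policy n Y} (hp : p.ConflictFree) (r : Fin n)
    (L s : ℕ) {b b' : ℝ} (hb : b ≤ b') :
    (#({v ∈ informants p r L (s + 1) | b' < dist (V v) (V r)}) : ℝ) * (b' - b) ^ ν ≤
      2 * #({v ∈ informants p r L s | b < dist (V v) (V r)}) * (b' - b) ^ ν + p.energy ν V := by
  set J := {v ∈ informants p r L s | b < dist (V v) (V r)} with hJ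
  set A₁ := univ.filter fun i => ∃ j ∈ J, (L - (s + 1), i, j) ∈ p.tx with hA₁
  set A₂ := {v ∈ informants p r L (s + 1) | b' < dist (V v) (V r)} \ (J ∪ A₁) with hA₂
  have h1 : #A₁ ≤ #J := card_senders_le hp _ _ _ fun i hi => (mem_filter.1 hi).2
  have h2 : #({v ∈ informants p r L (s + 1) | b' < dist (V v) (V r)}) ≤ 2 * #J + #A₂ := by
    have : #({v ∈ informants p r L (s + 1) | b' < dist (V v) (V r)}) - #(J ∪ A₁) ≤ #A₂ :=
      le_card_sdiff _ _
    have h3 := card_union_le J A₁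
    omega
  have h3 : ∀ v ∈ A₂, ∃ j, (v, j) ∈ p.links ∧ b' - b ≤ dist (V v) (V j) := by
    intro v hv
    simp only [hA₂, mem_sdiff, mem_filter, mem_union, not_or, hJ, hA₁, informants] at hv
    obtain ⟨⟨hv1 | hv1, hv2⟩, hv3, hv4⟩ := hv
    · exact absurd ⟨hv1, hb.trans_lt hv2⟩ hv3
    · obtain ⟨-, j, hj, hvj⟩ := hv1
      refine ⟨j, mem_image.2 ⟨_, hvj, rfl⟩, ?_⟩
      have : ¬ b < dist (V j) (V r) := fun h => hv4 ⟨mem_univ _, j, ⟨hj, h⟩, hvj⟩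
      have := dist_triangle (V v) (V j) (V r)
      linarith
  have h4 : (#A₂ : ℝ) * (b' - b) ^ ν ≤ p.energy ν V := by
    choose! f hf using h3
    refine le_trans ?_ (sum_le_energy ν V p (F := A₂.image fun v => (v, f v)) ?_)
    · rw [sum_image (by intro x _ y _ e; exact (Prod.ext_iff.1 e).1), ← nsmul_eq_mul]
      exact card_nsmul_le_sum _ _ _ fun v hv =>
        Real.rpow_le_rpow (by linarith) (hf v hv).2 hν
    · intro e he
      obtain ⟨v, hv, rfl⟩ := mem_image.1 he
      exact (hf v hv).1
  have h5 : (#({v ∈ informants p r L (s + 1) | b' < dist (V v) (V r)}) : ℝ) ≤ 2 * #J + #A₂ := by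
    exact_mod_cast h2
  have h6 : 0 ≤ (b' - b) ^ ν := Real.rpow_nonneg (by linarith) _
  nlinarith

/-- If half of the nodes are farther than `D` from the root, the energy of a policy with latency
within `δ` of `⌈log₂ n⌉` is at least of order `D ^ ν * (1 + δ) ^ (1 - ν)`: either a far node is
reached within `O(1 + δ)` slots, or the far nodes are reached so late that many long links are
needed.  For the second case the distance `D` is approached by barriers `D * (1 - ρ ^ i / 2)`. -/
lemma far_le_energy {ν : ℝ} (hν : 1 < ν) : ∃ c : ℝ, 0 < c ∧ ∀ {d n : ℕ} {Y : Type} {δ D : ℝ}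
    (V : Fin n → EuclideanSpace ℝ (Fin d)) {p : Policy n Y} {r : Fin n} {ψ : Fin n → Y → ℝ},
    (∀ i, ∃ a b, ψ i a ≠ ψ i b) → p.Valid r (sumFunction ψ) → 2 ≤ n → 0 ≤ δ → 0 < D →
    (p.latency r (sumFunction ψ) : ℝ) ≤ Nat.clog 2 n + δ →
    n ≤ 2 * #(univ.filter fun v => D < dist (V v) (V r)) →
    c * (D ^ ν * (1 + δ) ^ (1 - ν)) ≤ p.energy ν V := by
  set ρ : ℝ := (2 : ℝ) ^ (-(1 / (2 * ν))) with hρ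
  have hρ0 : 0 < ρ := by positivity
  have hρ1 : ρ < 1 := Real.rpow_lt_one_of_one_lt_of_neg (by norm_num) (by
    have : 0 < 1 / (2 * ν) := by positivity
    linarith)
  have hρν : (ρ ^ ν) * √2 = 1 := by
    rw [hρ, ← Real.rpow_mul (by norm_num), Real.sqrt_eq_rpow, ← Real.rpow_add (by norm_num)]
    have : -(1 / (2 * ν)) * ν + 1 / 2 = 0 := by field_simp; ring
    rw [this, Real.rpow_zero]
  set c₁ : ℝ := (1 / 2) ^ ν * 2 ^ (1 - ν) with hc₁
  set c₂ : ℝ := ((1 - ρ) / 2) ^ ν / 4 with hc₂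
  have hρ2 : 0 < (1 - ρ) / 2 := by linarith
  refine ⟨min c₁ c₂, lt_min (by positivity) (by positivity), ?_⟩
  intro d n Y δ D V p r ψ hψ hp hn hδ hD hL hfar
  set L := p.latency r (sumFunction ψ) with hLdef
  have hall : ∀ v, v ∈ informants p r L L := mem_informants hψ hp.computableAt_latency
  have hE := energy_nonneg ν V p
  have hX : 0 ≤ D ^ ν * (1 + δ) ^ (1 - ν) := by positivity
  set T := min (⌈δ⌉₊ + 1) L with hT
  -- a node at distance `D / 2` within `T` slots settles the claim
  have case1 : ∀ v ∈ informants p r L T, D / 2 < dist (V v) (V r) →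
      min c₁ c₂ * (D ^ ν * (1 + δ) ^ (1 - ν)) ≤ p.energy ν V := by
    intro v hv hd
    have h1 := dist_rpow_le_of_mem_informants hν p r L V hv
    have h2 : (D / 2) ^ ν ≤ dist (V v) (V r) ^ ν :=
      Real.rpow_le_rpow (by positivity) hd.le (by linarith)
    have h3 : (T : ℝ) ≤ 2 * (1 + δ) := by
      have : (T : ℝ) ≤ ⌈δ⌉₊ + 1 := by exact_mod_cast min_le_left _ _
      have := Nat.ceil_lt_add_one hδ
      linarith
    have h4 : (D / 2) ^ ν ≤ (2 * (1 + δ)) ^ (ν - 1) * p.energy ν V :=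
      h2.trans (h1.trans (mul_le_mul_of_nonneg_right
        (Real.rpow_le_rpow (by positivity) h3 (by linarith)) hE))
    have h5 : c₁ * (D ^ ν * (1 + δ) ^ (1 - ν)) ≤ p.energy ν V := by
      have e1 : (2 * (1 + δ)) ^ (1 - ν) * (2 * (1 + δ)) ^ (ν - 1) = 1 := by
        rw [← Real.rpow_add (by positivity)]; simp
      have e2 : c₁ * (D ^ ν * (1 + δ) ^ (1 - ν)) = (2 * (1 + δ)) ^ (1 - ν) * (D / 2) ^ ν := by
        rw [hc₁, Real.mul_rpow (by norm_num) (by linarith : 0 ≤ 1 + δ),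
          show D / 2 = (1 / 2) * D by ring, Real.mul_rpow (by norm_num) hD.le]
        ring
      rw [e2]
      calc _ ≤ (2 * (1 + δ)) ^ (1 - ν) * ((2 * (1 + δ)) ^ (ν - 1) * p.energy ν V) := by gcongr
        _ = p.energy ν V := by rw [← mul_assoc, e1, one_mul]
    exact (mul_le_mul_of_nonneg_right (min_le_left _ _) hX).trans h5
  by_cases hex : ∃ v ∈ informants p r L T, D / 2 < dist (V v) (V r)
  · obtain ⟨v, hv, hd⟩ := hex
    exact case1 v hv hd
  push Not at hex
  have hcardpos : 0 < #(univ.filter fun v => D < dist (V v) (V r)) := by omega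
  have hTL : T < L := by
    by_contra h
    have hTL : T = L := le_antisymm (min_le_right _ _) (not_lt.1 h)
    obtain ⟨v, hv⟩ := card_pos.1 hcardpos
    have := hex v (hTL ▸ hall v)
    have := (mem_filter.1 hv).2
    linarith
  have hTeq : T = ⌈δ⌉₊ + 1 := by
    rcases min_choice (⌈δ⌉₊ + 1) L with h | h
    · exact h
    · exact absurd (hT.trans h) hTL.ne
  set B : ℝ := (D * ((1 - ρ) / 2)) ^ ν with hB
  have hBpos : 0 < B := by positivity
  set M : ℝ := p.energy ν V / B with hM
  have hM0 : 0 ≤ M := by positivity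
  have hs2 : √2 * √2 = 2 := Real.mul_self_sqrt (by norm_num)
  have hs2' : √2 < 3 / 2 := by
    nlinarith [Real.sqrt_nonneg 2]
  have hs0 : 0 < √2 := by positivity
  -- with `a i` the number of informants at `T + i` beyond the `i`-th radius, `a 0 = 0` and
  -- `a (i + 1) ≤ 2 * a i + M * √2 ^ i`, because reaching them from within the previous radius takes
  -- links of total energy at most `p.energy`
  have hrec : ∀ i : ℕ, (2 - √2) * #({v ∈ informants p r L (T + i) |
      D * (1 - ρ ^ i / 2) < dist (V v) (V r)}) ≤ M * (2 ^ i - √2 ^ i) := by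
    intro i
    induction i with
    | zero =>
      have : ({v ∈ informants p r L (T + 0) | D * (1 - ρ ^ 0 / 2) < dist (V v) (V r)}) = ∅ := by
        refine filter_eq_empty_iff.2 fun v hv => ?_
        have := hex v (by simpa using hv)
        rw [not_lt]; norm_num; linarith
      rw [this]; simp
    | succ i ih =>
      have hρi : ρ ^ (i + 1) ≤ ρ ^ i := pow_le_pow_of_le_one hρ0.le hρ1.le (by omega)
      have h1 := card_far_informants_succ_le (ν := ν) (by linarith) V hp.1 r L (T + i)
        (b := D * (1 - ρ ^ i / 2)) (b' := D * (1 - ρ ^ (i + 1) / 2)) (by gcongr)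
      have e1 : (D * (1 - ρ ^ (i + 1) / 2) - D * (1 - ρ ^ i / 2)) ^ ν = B * (ρ ^ ν) ^ i := by
        rw [hB, ← Real.rpow_natCast (ρ ^ ν), ← Real.rpow_mul hρ0.le, mul_comm ν, Real.rpow_mul hρ0.le,
          ← Real.mul_rpow (by positivity) (by positivity), Real.rpow_natCast]
        congr 1; ring
      rw [e1] at h1
      have e2 : p.energy ν V = M * B := by rw [hM]; field_simp
      have e3 : (ρ ^ ν) ^ i * √2 ^ i = 1 := by rw [← mul_pow, hρν, one_pow]
      set a := (#({v ∈ informants p r L (T + i) | D * (1 - ρ ^ i / 2) < dist (V v) (V r)}) : ℝ)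
      set a' := (#({v ∈ informants p r L (T + i + 1) |
        D * (1 - ρ ^ (i + 1) / 2) < dist (V v) (V r)}) : ℝ)
      have h2 : a' ≤ 2 * a + M * √2 ^ i := by
        have hpos : 0 < B * (ρ ^ ν) ^ i := by positivity
        refine le_of_mul_le_mul_right ?_ hpos
        calc a' * (B * (ρ ^ ν) ^ i) ≤ 2 * a * (B * (ρ ^ ν) ^ i) + p.energy ν V := h1
          _ = 2 * a * (B * (ρ ^ ν) ^ i) + M * B * ((ρ ^ ν) ^ i * √2 ^ i) := by rw [e3, e2, mul_one]
          _ = _ := by ring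
      have h3 : (2 - √2) * a' ≤ (2 - √2) * (2 * a + M * √2 ^ i) :=
        mul_le_mul_of_nonneg_left h2 (by linarith)
      have e4 : (2 : ℝ) ^ (i + 1) - √2 ^ (i + 1) = 2 * (2 ^ i - √2 ^ i) + (2 - √2) * √2 ^ i := by
        rw [pow_succ, pow_succ]; ring
      calc (2 - √2) * a' ≤ 2 * ((2 - √2) * a) + (2 - √2) * (M * √2 ^ i) := by linarith
        _ ≤ 2 * (M * (2 ^ i - √2 ^ i)) + (2 - √2) * (M * √2 ^ i) := by linarith
        _ = _ := by rw [e4]; ring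
  have hend := hrec (L - T)
  rw [Nat.add_sub_cancel' hTL.le] at hend
  have hsub : #(univ.filter fun v => D < dist (V v) (V r)) ≤
      #({v ∈ informants p r L L | D * (1 - ρ ^ (L - T) / 2) < dist (V v) (V r)}) := by
    refine card_le_card fun v hv => mem_filter.2 ⟨hall v, ?_⟩
    have h1 := (mem_filter.1 hv).2
    have : 0 < ρ ^ (L - T) := by positivity
    nlinarith
  have hpow : (2 : ℝ) ^ (L - T) < n := by
    have h1 : L ≤ Nat.clog 2 n + ⌈δ⌉₊ := by
      have : (L : ℝ) ≤ (Nat.clog 2 n + ⌈δ⌉₊ : ℕ) := by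
        push_cast; linarith [Nat.le_ceil δ]
      exact_mod_cast this
    have h2 : L - T ≤ (Nat.clog 2 n).pred := by
      have : 0 < Nat.clog 2 n := Nat.clog_pos (by norm_num) (by omega)
      rw [Nat.pred_eq_sub_one]; omega
    have h3 := Nat.pow_pred_clog_lt_self (b := 2) (by norm_num) (show 1 < n by omega)
    have : 2 ^ (L - T) < n := (Nat.pow_le_pow_right (by norm_num) h2).trans_lt h3
    exact_mod_cast this
  have hcard : (n : ℝ) ≤
      2 * #({v ∈ informants p r L L | D * (1 - ρ ^ (L - T) / 2) < dist (V v) (V r)}) := by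
    have : n ≤ 2 * #({v ∈ informants p r L L | D * (1 - ρ ^ (L - T) / 2) < dist (V v) (V r)}) := by
      omega
    exact_mod_cast this
  have hn0 : (0 : ℝ) < n := by exact_mod_cast (by omega : 0 < n)
  have hM4 : 1 / 4 ≤ M := by
    have h1 : M * (2 ^ (L - T) - √2 ^ (L - T)) ≤ M * n := by
      have : 0 < √2 ^ (L - T) := by positivity
      exact mul_le_mul_of_nonneg_left (by linarith) hM0
    have h2 : (2 - √2) * n ≤ 2 * (M * n) := by nlinarith
    by_contra hlt
    push Not at hlt
    nlinarith
  have hfin : c₂ * D ^ ν ≤ p.energy ν V := by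
    have e : p.energy ν V = M * B := by rw [hM]; field_simp
    rw [e, hB, Real.mul_rpow hD.le hρ2.le, hc₂]
    have : 0 ≤ D ^ ν * ((1 - ρ) / 2) ^ ν := by positivity
    nlinarith
  have hle1 : (1 + δ) ^ (1 - ν) ≤ 1 :=
    Real.rpow_le_one_of_one_le_of_nonpos (by linarith) (by linarith)
  calc min c₁ c₂ * (D ^ ν * (1 + δ) ^ (1 - ν)) ≤ c₂ * (D ^ ν * 1) := by
        refine mul_le_mul (min_le_right _ _) ?_ hX (by positivity)
        gcongr
    _ ≤ _ := by rw [mul_one]; exact hfin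

end Communication

/-! ### Least-energy paths and bisections -/

section Paths

variable {d n : ℕ} (ν : ℝ) (V : Fin n → EuclideanSpace ℝ (Fin d))

lemma pathEnergy_cons_cons (a b : Fin n) (l : List (Fin n)) :
    pathEnergy ν V (a :: b :: l) = dist (V a) (V b) ^ ν + pathEnergy ν V (b :: l) := by
  simp [pathEnergy, pathLinks]

@[simp] lemma pathEnergy_nil : pathEnergy ν V [] = 0 := by simp [pathEnergy, pathLinks]

@[simp] lemma pathEnergy_singleton (a : Fin n) : pathEnergy ν V [a] = 0 := by
  simp [pathEnergy, pathLinks]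

lemma pathEnergy_nonneg (P : List (Fin n)) : 0 ≤ pathEnergy ν V P :=
  List.sum_nonneg fun x hx => by
    obtain ⟨e, -, rfl⟩ := List.mem_map.1 hx
    positivity

lemma pathEnergy_append_right_le (s t : List (Fin n)) :
    pathEnergy ν V t ≤ pathEnergy ν V (s ++ t) := by
  induction s with
  | nil => simp
  | cons a s ih =>
    refine ih.trans ?_
    rcases h : s ++ t with _ | ⟨b, l⟩
    · simp [h]
    · rw [List.cons_append, h, pathEnergy_cons_cons]
      have : 0 ≤ dist (V a) (V b) ^ ν := by positivity
      linarith

/-- Erasing loops turns a walk into a path of at most the same energy. -/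
lemma exists_isPath_of_walk {S : Finset (Fin n)} {l : ℕ} {i : Fin n} :
    ∀ (Q : List (Fin n)) (j : Fin n), Q.head? = some j → Q.getLast? = some i → (∀ x ∈ Q, x ∈ S) →
      Q.length ≤ l + 2 → ∃ P, IsPath S l j i P ∧ pathEnergy ν V P ≤ pathEnergy ν V Q := by
  suffices h : ∀ (Q : List (Fin n)) (j : Fin n), Q.head? = some j → Q.getLast? = some i →
      (∀ x ∈ Q, x ∈ S) → ∃ P : List (Fin n), P.Nodup ∧ P.head? = some j ∧ P.getLast? = some i ∧
        (∀ x ∈ P, x ∈ S) ∧ P.length ≤ Q.length ∧ pathEnergy ν V P ≤ pathEnergy ν V Q by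
    intro Q j h1 h2 h3 h4
    obtain ⟨P, p1, p2, p3, p4, p5, p6⟩ := h Q j h1 h2 h3
    exact ⟨P, ⟨p1, p2, p3, p4, p5.trans h4⟩, p6⟩
  intro Q
  induction Q with
  | nil => intro j h; simp at h
  | cons a Q ih =>
    intro j h1 h2 h3
    obtain rfl : a = j := by simpa using h1
    rcases Q with _ | ⟨b, Q⟩
    · exact ⟨[a], by simp, rfl, h2, h3, le_rfl, le_rfl⟩
    · obtain ⟨P, p1, p2, p3, p4, p5, p6⟩ := ih b rfl (by simpa using h2)
        (fun x hx => h3 x (List.mem_cons_of_mem _ hx))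
      rw [pathEnergy_cons_cons]
      have hd : 0 ≤ dist (V a) (V b) ^ ν := by positivity
      by_cases ha : a ∈ P
      · obtain ⟨s, t, rfl⟩ := List.append_of_mem ha
        refine ⟨a :: t, (List.nodup_append.1 p1).2.1, rfl, ?_, fun x hx => p4 x (by simp at hx ⊢; tauto),
          ?_, ?_⟩
        · rw [List.getLast?_append] at p3
          rcases h : (a :: t).getLast? with _ | z
          · simp at h
          · rw [h] at p3; simpa using p3
        · simp only [List.length_append, List.length_cons] at p5 ⊢; omega
        · have := pathEnergy_append_right_le ν V s (a :: t)
          linarith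
      · rcases P with _ | ⟨b', P⟩
        · simp at p2
        obtain rfl : b' = b := by simpa using p2
        refine ⟨a :: b' :: P, List.nodup_cons.2 ⟨ha, p1⟩, rfl, by simpa using p3, ?_, ?_, ?_⟩
        · intro x hx
          rcases List.mem_cons.1 hx with rfl | hx
          · exact h3 _ (by simp)
          · exact p4 x hx
        · simp only [List.length_cons] at p5 ⊢; omega
        · rw [pathEnergy_cons_cons]; linarith

lemma IsLeastEnergyPath.le_walk {S : Finset (Fin n)} {l : ℕ} {j i : Fin n} {P : List (Fin n)}
    (h : IsLeastEnergyPath ν V S l j i P) {Q : List (Fin n)} (h1 : Q.head? = some j)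
    (h2 : Q.getLast? = some i) (h3 : ∀ x ∈ Q, x ∈ S) (h4 : Q.length ≤ l + 2) :
    pathEnergy ν V P ≤ pathEnergy ν V Q := by
  obtain ⟨P', hP', hle⟩ := exists_isPath_of_walk ν V Q j h1 h2 h3 h4
  exact (h.2 P' hP').trans hle

lemma exists_isLeastEnergyPath {S : Finset (Fin n)} (l : ℕ) {j i : Fin n} (hj : j ∈ S)
    (hi : i ∈ S) : ∃ P, IsLeastEnergyPath ν V S l j i P := by
  have hfin : {P | IsPath S l j i P}.Finite :=
    (List.finite_length_le (Fin n) (l + 2)).subset fun P hP => hP.2.2.2.2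
  have hne : {P | IsPath S l j i P}.Nonempty := by
    obtain ⟨P, hP, -⟩ := exists_isPath_of_walk ν V (S := S) (l := l) [j, i] j rfl rfl
      (by simp [hi, hj]) (by simp)
    exact ⟨P, hP⟩
  obtain ⟨P, hP, hmin⟩ := Set.exists_min_image _ (pathEnergy ν V) hfin hne
  exact ⟨P, hP, hmin⟩

lemma exists_lower_subset {α : Type*} [DecidableEq α] (f : α → ℝ) (S : Finset α) :
    ∀ k ≤ #S, ∃ L ⊆ S, #L = k ∧ ∀ x ∈ L, ∀ y ∈ S \ L, f x ≤ f y := by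
  intro k
  induction k with
  | zero => intro _; exact ⟨∅, by simp, by simp, by simp⟩
  | succ k ih =>
    intro hk
    obtain ⟨L, hL, hc, hle⟩ := ih (by omega)
    have hne : (S \ L).Nonempty := by
      rw [← card_pos, card_sdiff_of_subset hL]; omega
    obtain ⟨z, hz, hmin⟩ := exists_min_image (S \ L) f hne
    have hz' := mem_sdiff.1 hz
    refine ⟨insert z L, insert_subset hz'.1 hL, by rw [card_insert_of_notMem hz'.2, hc], ?_⟩
    intro x hx y hy
    have hy' : y ∈ S \ L := by
      simp only [mem_sdiff, mem_insert, not_or] at hy ⊢; tauto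
    rcases mem_insert.1 hx with rfl | hx
    · exact hmin y hy'
    · exact hle x hx y hy'

lemma exists_bisects (hd : 1 ≤ d) (R : Region d n) (hR : 2 ≤ #R.nodes) :
    ∃ L U, Bisects V R L U := by
  have : Nonempty (Fin d) := ⟨⟨0, hd⟩⟩
  obtain ⟨c, hc⟩ := Finite.exists_max fun c => R.hi c - R.lo c
  obtain ⟨L, hL, hcard, hle⟩ := exists_lower_subset (fun x => V x c) R.nodes (#R.nodes / 2) (by omega)
  have hLne : L.Nonempty := by rw [← card_pos]; omega
  have hUne : (R.nodes \ L).Nonempty := by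
    rw [← card_pos, card_sdiff_of_subset hL]; omega
  obtain ⟨x, hx, hxmax⟩ := exists_max_image L (fun x => V x c) hLne
  obtain ⟨y, hy, hymin⟩ := exists_min_image (R.nodes \ L) (fun x => V x c) hUne
  exact ⟨⟨R.lo, Function.update R.hi c (V y c), L⟩, ⟨Function.update R.lo c (V x c), R.hi, R.nodes \ L⟩,
    c, V x c, V y c, hc, hL, rfl, hcard, hle, ⟨⟨x, hx, rfl⟩, by rintro _ ⟨z, hz, rfl⟩; exact hxmax z hz⟩,
    ⟨⟨y, hy, rfl⟩, by rintro _ ⟨z, hz, rfl⟩; exact hymin z hz⟩, rfl, rfl, rfl, rfl⟩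

end Paths

/-! ### Runs of the bisection algorithm -/

section Runs

variable {d n : ℕ} {ν : ℝ} {V : Fin n → EuclideanSpace ℝ (Fin d)} {w : ℕ → ℕ}

/-- The facts about the node sets of the two halves that do not depend on which half is which. -/
lemma Bisects.halves {R R₁ R₂ : Region d n} (h : Bisects V R R₁ R₂ ∨ Bisects V R R₂ R₁) :
    R₁.nodes ⊆ R.nodes ∧ R₂.nodes = R.nodes \ R₁.nodes ∧
      #R.nodes / 2 ≤ #R₁.nodes ∧ 2 * #R₁.nodes ≤ #R.nodes + 1 ∧
      #R.nodes / 2 ≤ #R₂.nodes ∧ 2 * #R₂.nodes ≤ #R.nodes + 1 := by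
  rcases h with ⟨c, a, b, -, h1, h2, h3, -⟩ | ⟨c, a, b, -, h1, h2, h3, -⟩
  · have := card_sdiff_of_subset h1
    have := card_le_card h1
    rw [h2]
    exact ⟨h1, rfl, by omega, by omega, by omega, by omega⟩
  · have := card_sdiff_of_subset h1
    have := card_le_card h1
    rw [h2]
    refine ⟨sdiff_subset, ?_, by omega, by omega, by omega, by omega⟩
    rw [Finset.sdiff_sdiff_eq_self h1]

lemma exists_bisectionRun (hd : 1 ≤ d) (ν : ℝ) (V : Fin n → EuclideanSpace ℝ (Fin d)) (w : ℕ → ℕ)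
    (m : ℕ) : ∀ (k : ℕ) (R : Region d n) (i : Fin n) (A : Finset (Fin n)), #R.nodes ≤ m →
      i ∈ R.nodes → ∃ out, BisectionRun ν V w k R i A out := by
  induction m with
  | zero =>
    intro k R i A hm hi
    exact ⟨[], .halt k R i A (by omega)⟩
  | succ m ih =>
    intro k R i A hm hi
    by_cases hR : #R.nodes ≤ 1
    · exact ⟨[], .halt k R i A hR⟩
    push Not at hR
    obtain ⟨R₁, R₂, hb, hi₁⟩ : ∃ R₁ R₂, (Bisects V R R₁ R₂ ∨ Bisects V R R₂ R₁) ∧ i ∈ R₁.nodes := by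
      obtain ⟨L, U, h⟩ := exists_bisects V hd R hR
      by_cases hiL : i ∈ L.nodes
      · exact ⟨L, U, .inl h, hiL⟩
      · refine ⟨U, L, .inr h, ?_⟩
        rw [(Bisects.halves (.inl h)).2.1]
        exact mem_sdiff.2 ⟨hi, hiL⟩
    obtain ⟨h1, h2, h3, h4, h5, h6⟩ := Bisects.halves hb
    by_cases hj : R₂.nodes ⊆ A
    · obtain ⟨out, ho⟩ := ih (k + 1) R₁ i A (by omega) hi₁
      exact ⟨out, .skip k R R₁ R₂ i A out hR hb hi₁ hj ho⟩
    · obtain ⟨j, hj, hjA⟩ := not_subset.1 hj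
      have hjR : j ∈ R.nodes := by rw [h2] at hj; exact (mem_sdiff.1 hj).1
      obtain ⟨P, hP⟩ := exists_isLeastEnergyPath ν V (w k) hjR hi
      obtain ⟨o₁, ho₁⟩ := ih (k + 1) R₁ i (A ∪ P.toFinset) (by omega) hi₁
      obtain ⟨o₂, ho₂⟩ := ih (k + 1) R₂ j (A ∪ P.toFinset) (by omega) hj
      exact ⟨_, .join k R R₁ R₂ i j A P o₁ o₂ hR hb hi₁ hj hjA hP ho₁ ho₂⟩

lemma BisectionRun.path_props {k : ℕ} {R : Region d n} {i : Fin n} {A : Finset (Fin n)}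
    {out : List (ℕ × List (Fin n))} (h : BisectionRun ν V w k R i A out) :
    ∀ q ∈ out, k ≤ q.1 ∧ q.2.Nodup ∧ q.2.length ≤ w q.1 + 2 ∧ ∀ x ∈ q.2, x ∈ R.nodes := by
  induction h with
  | halt => simp
  | join k R R₁ R₂ i j A P o₁ o₂ hR hb hi hj hjA hP _ _ ih₁ ih₂ =>
    obtain ⟨h1, h2, -⟩ := Bisects.halves hb
    intro q hq
    rcases List.mem_cons.1 hq with rfl | hq
    · exact ⟨le_rfl, hP.1.1, hP.1.2.2.2.2, hP.1.2.2.2.1⟩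
    rcases List.mem_append.1 hq with hq | hq
    · obtain ⟨a, b, c, e⟩ := ih₁ q hq
      exact ⟨by omega, b, c, fun x hx => h1 (e x hx)⟩
    · obtain ⟨a, b, c, e⟩ := ih₂ q hq
      refine ⟨by omega, b, c, fun x hx => ?_⟩
      have := e x hx
      rw [h2] at this
      exact (mem_sdiff.1 this).1
  | skip k R R₁ R₂ i A o hR hb hi hj _ ih =>
    obtain ⟨h1, h2, -⟩ := Bisects.halves hb
    intro q hq
    obtain ⟨a, b, c, e⟩ := ih q hq
    exact ⟨by omega, b, c, fun x hx => h1 (e x hx)⟩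

/-- Paths of the same iteration are node-disjoint. -/
lemma BisectionRun.eq_of_mem {k : ℕ} {R : Region d n} {i : Fin n} {A : Finset (Fin n)}
    {out : List (ℕ × List (Fin n))} (h : BisectionRun ν V w k R i A out) :
    ∀ q ∈ out, ∀ q' ∈ out, ∀ x ∈ q.2, x ∈ q'.2 → q.1 = q'.1 → q = q' := by
  induction h with
  | halt => simp
  | join k R R₁ R₂ i j A P o₁ o₂ hR hb hi hj hjA hP hr₁ hr₂ ih₁ ih₂ =>
    obtain ⟨h1, h2, -⟩ := Bisects.halves hb
    have p₁ := hr₁.path_props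
    have p₂ := hr₂.path_props
    have hdis : ∀ q ∈ o₁, ∀ q' ∈ o₂, ∀ x ∈ q.2, x ∈ q'.2 → False := by
      intro q hq q' hq' x hx hx'
      have a := (p₁ q hq).2.2.2 x hx
      have b := (p₂ q' hq').2.2.2 x hx'
      rw [h2] at b
      exact (mem_sdiff.1 b).2 a
    intro q hq q' hq' x hx hx' hk
    simp only [List.mem_cons, List.mem_append] at hq hq'
    rcases hq with rfl | hq | hq <;> rcases hq' with rfl | hq' | hq'
    · rfl
    · have := (p₁ q' hq').1; simp only at hk; omega
    · have := (p₂ q' hq').1; simp only at hk; omega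
    · have := (p₁ q hq).1; simp only at hk; omega
    · exact ih₁ q hq q' hq' x hx hx' hk
    · exact (hdis q hq q' hq' x hx hx').elim
    · have := (p₂ q hq).1; simp only at hk; omega
    · exact (hdis q' hq' q hq x hx' hx).elim
    · exact ih₂ q hq q' hq' x hx hx' hk
  | skip k R R₁ R₂ i A o hR hb hi hj _ ih => exact ih

lemma BisectionRun.two_pow_lt {k : ℕ} {R : Region d n} {i : Fin n} {A : Finset (Fin n)}
    {out : List (ℕ × List (Fin n))} (h : BisectionRun ν V w k R i A out) {N : ℕ}
    (hN : (#R.nodes - 1) * 2 ^ k < N) : ∀ q ∈ out, 2 ^ q.1 < N := by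
  have half : ∀ {m l k : ℕ}, 2 * l ≤ m + 1 → (m - 1) * 2 ^ k < N → (l - 1) * 2 ^ (k + 1) < N := by
    intro m l k h1 h2
    refine lt_of_le_of_lt ?_ h2
    rw [pow_succ, mul_comm (2 ^ k), ← mul_assoc]
    exact Nat.mul_le_mul_right _ (by omega)
  induction h with
  | halt => simp
  | join k R R₁ R₂ i j A P o₁ o₂ hR hb hi hj hjA hP hr₁ hr₂ ih₁ ih₂ =>
    obtain ⟨-, -, -, h4, -, h6⟩ := Bisects.halves hb
    intro q hq
    simp only [List.mem_cons, List.mem_append] at hq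
    rcases hq with rfl | hq | hq
    · exact lt_of_le_of_lt (Nat.le_mul_of_pos_left _ (by omega)) hN
    · exact ih₁ (half h4 hN) q hq
    · exact ih₂ (half h6 hN) q hq
  | skip k R R₁ R₂ i A o hR hb hi hj _ ih =>
    obtain ⟨-, -, -, h4, -, h6⟩ := Bisects.halves hb
    exact ih (half h4 hN)

/-- Every node of the region that was on no path before gets onto a path, and on the first one
it is not the terminal node. -/
lemma BisectionRun.exists_first {k : ℕ} {R : Region d n} {i : Fin n} {A : Finset (Fin n)}
    {out : List (ℕ × List (Fin n))} (h : BisectionRun ν V w k R i A out) (hi : i ∈ R.nodes)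
    (hiA : i ∈ A) : ∀ v ∈ R.nodes, v ∉ A → ∃ q ∈ out, v ∈ q.2 ∧ q.2.getLast? ≠ some v ∧
      ∀ q' ∈ out, v ∈ q'.2 → q.1 ≤ q'.1 := by
  induction h with
  | halt k R i A hR =>
    intro v hv hvA
    exact absurd ((card_le_one.1 hR v hv i hi) ▸ hiA) hvA
  | join k R R₁ R₂ i j A P o₁ o₂ hR hb hi₁ hj hjA hP hr₁ hr₂ ih₁ ih₂ =>
    obtain ⟨h1, h2, -⟩ := Bisects.halves hb
    have p₁ := hr₁.path_props
    have p₂ := hr₂.path_props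
    intro v hv hvA
    have hjP : j ∈ P := List.mem_of_mem_head? hP.1.2.1
    by_cases hvP : v ∈ P
    · refine ⟨(k, P), by simp, hvP, ?_, ?_⟩
      · intro e
        rw [hP.1.2.2.1] at e
        exact hvA ((Option.some.inj e) ▸ hiA)
      · intro q' hq' _
        simp only [List.mem_cons, List.mem_append] at hq'
        rcases hq' with rfl | hq' | hq'
        · exact le_rfl
        · have := (p₁ q' hq').1; simp only; omega
        · have := (p₂ q' hq').1; simp only; omega
    · have hvA' : v ∉ A ∪ P.toFinset := by simp [hvA, hvP]
      by_cases hv₁ : v ∈ R₁.nodes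
      · obtain ⟨q, hq, a, b, c⟩ := ih₁ hi₁ (mem_union_left _ hiA) v hv₁ hvA'
        refine ⟨q, by simp [hq], a, b, ?_⟩
        intro q' hq' hx
        simp only [List.mem_cons, List.mem_append] at hq'
        rcases hq' with rfl | hq' | hq'
        · exact absurd hx hvP
        · exact c q' hq' hx
        · have := (p₂ q' hq').2.2.2 v hx
          rw [h2] at this
          exact absurd hv₁ (mem_sdiff.1 this).2
      · have hv₂ : v ∈ R₂.nodes := by rw [h2]; exact mem_sdiff.2 ⟨hv, hv₁⟩
        obtain ⟨q, hq, a, b, c⟩ := ih₂ hj (mem_union_right _ (by simpa using hjP)) v hv₂ hvA'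
        refine ⟨q, by simp [hq], a, b, ?_⟩
        intro q' hq' hx
        simp only [List.mem_cons, List.mem_append] at hq'
        rcases hq' with rfl | hq' | hq'
        · exact absurd hx hvP
        · exact absurd ((p₁ q' hq').2.2.2 v hx) hv₁
        · exact c q' hq' hx
  | skip k R R₁ R₂ i A o hR hb hi₁ hj _ ih =>
    obtain ⟨h1, h2, -⟩ := Bisects.halves hb
    intro v hv hvA
    refine ih hi₁ hiA v ?_ hvA
    by_contra hv₁
    exact hvA (hj (by rw [h2]; exact mem_sdiff.2 ⟨hv, hv₁⟩))

end Runs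

/-! ### Validity and latency of the aggregation policy -/

section Schedule

variable {n : ℕ} {w : ℕ → ℕ} {out : List (ℕ × List (Fin n))}

lemma mem_pathLinks {P : List (Fin n)} {e : ℕ} {a b : Fin n} :
    (pathLinks P)[e]? = some (a, b) ↔ P[e]? = some a ∧ P[e + 1]? = some b := by
  rw [pathLinks, List.getElem?_zip_eq_some, List.getElem?_tail]

lemma mem_aggSchedule {t : ℕ} {i j : Fin n} :
    (t, i, j) ∈ aggSchedule w out ↔ ∃ q ∈ out, ∃ e, t = blockStart n w q.1 + e ∧
      q.2[e]? = some i ∧ q.2[e + 1]? = some j := by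
  simp only [aggSchedule, List.mem_toFinset, List.mem_flatMap, List.mem_map]
  refine exists_congr fun q => and_congr_right fun _ => ?_
  constructor
  · rintro ⟨⟨⟨a, b⟩, e⟩, he, heq⟩
    rw [List.mem_zipIdx_iff_getElem?, mem_pathLinks] at he
    simp only [Prod.mk.injEq] at heq
    obtain ⟨h1, rfl, rfl⟩ := heq
    exact ⟨e, h1.symm, he⟩
  · rintro ⟨e, rfl, he⟩
    refine ⟨((i, j), e), ?_, rfl⟩
    rw [List.mem_zipIdx_iff_getElem?, mem_pathLinks]
    exact he

lemma blockStart_add_le {k k' : ℕ} (h : k < k') (h' : k' < Nat.clog 2 n) :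
    blockStart n w k' + (1 + w k') ≤ blockStart n w k := by
  rw [blockStart, blockStart, ← sum_Ico_consecutive _ (show k + 1 ≤ k' + 1 by omega)
    (show k' + 1 ≤ Nat.clog 2 n by omega), sum_Ico_succ_top (by omega)]
  omega

lemma blockStart_add_le_sum {k : ℕ} (h' : k < Nat.clog 2 n) :
    blockStart n w k + (1 + w k) ≤ ∑ l ∈ range (Nat.clog 2 n), (1 + w l) := by
  rw [range_eq_Ico, ← sum_Ico_consecutive _ (show 0 ≤ k + 1 by omega)
    (show k + 1 ≤ Nat.clog 2 n by omega), sum_Ico_succ_top (by omega), blockStart]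
  omega

/-- What the validity proof uses about the paths: the paths of one iteration are node-disjoint,
and every non-root node is on a first path, where it is not the terminal node. -/
structure GoodPaths (w : ℕ → ℕ) (r : Fin n) (out : List (ℕ × List (Fin n))) : Prop where
  lt_clog : ∀ q ∈ out, q.1 < Nat.clog 2 n
  nodup : ∀ q ∈ out, q.2.Nodup
  length_le : ∀ q ∈ out, q.2.length ≤ w q.1 + 2
  eq_of_mem : ∀ q ∈ out, ∀ q' ∈ out, ∀ x ∈ q.2, x ∈ q'.2 → q.1 = q'.1 → q = q'
  exists_first : ∀ v, v ≠ r → ∃ q ∈ out, v ∈ q.2 ∧ q.2.getLast? ≠ some v ∧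
    ∀ q' ∈ out, v ∈ q'.2 → q.1 ≤ q'.1

lemma IsBisectionOutput.goodPaths {d : ℕ} {ν : ℝ} {V : Fin n → EuclideanSpace ℝ (Fin d)} {r : Fin n}
    (h : IsBisectionOutput ν V w r out) : GoodPaths w r out where
  lt_clog q hq := by
    have hn : 0 < n := r.pos
    have h1 := BisectionRun.two_pow_lt h (N := n) (by simp [Region.whole]; omega) q hq
    by_contra hlt
    have := (Nat.clog_le_iff_le_pow (b := 2) (by norm_num)).1 (not_lt.1 hlt)
    omega
  nodup q hq := (BisectionRun.path_props h q hq).2.1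
  length_le q hq := (BisectionRun.path_props h q hq).2.2.1
  eq_of_mem := BisectionRun.eq_of_mem h
  exists_first v hv := BisectionRun.exists_first h (by simp [Region.whole]) (by simp) v
    (by simp [Region.whole]) (by simpa using hv)

/-- The slot determines the iteration. -/
lemma GoodPaths.iteration_le {r : Fin n} (h : GoodPaths w r out) {q q' : ℕ × List (Fin n)}
    (hq' : q' ∈ out) {e e' : ℕ} (he' : e' + 1 < q'.2.length)
    (hle : blockStart n w q.1 + e ≤ blockStart n w q'.1 + e') : q'.1 ≤ q.1 := by
  by_contra hlt
  have h1 := blockStart_add_le (w := w) (not_le.1 hlt) (h.lt_clog q' hq')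
  have := h.length_le q' hq'
  omega

/-- A slot belongs to one iteration and to one position on the paths of that iteration, which are
disjoint. -/
lemma GoodPaths.conflictFree {Y : Type} {r : Fin n} (h : GoodPaths w r out)
    (ψ : Fin n → Y → ℝ) : (aggPolicy ψ w out).ConflictFree := by
  have key : ∀ {q : ℕ × List (Fin n)}, q ∈ out → ∀ {e e' : ℕ} {x : Fin n}, q.2[e]? = some x →
      q.2[e']? = some x → e = e' := by
    intro q hq e e' x hx hx'
    have he := (List.getElem?_eq_some_iff.1 hx).1
    exact (List.getElem?_inj he (h.nodup q hq)).1 (hx.trans hx'.symm)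
  refine ⟨?_, ?_⟩
  · intro t i j hij
    obtain ⟨q, hq, e, -, hi, hj⟩ := mem_aggSchedule.1 hij
    rintro rfl
    have := key hq hi hj
    omega
  · intro t i j i' j' hij hij' hne
    obtain ⟨q, hq, e, rfl, hi, hj⟩ := mem_aggSchedule.1 hij
    obtain ⟨q', hq', e', ht, hi', hj'⟩ := mem_aggSchedule.1 hij'
    have le := (List.getElem?_eq_some_iff.1 hj).1
    have le' := (List.getElem?_eq_some_iff.1 hj').1
    have hk : q.1 = q'.1 := le_antisymm
      (h.iteration_le hq le ht.symm.le) (h.iteration_le hq' le' ht.le)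
    have main : ∀ x ∈ q.2, x ∈ q'.2 → False := by
      intro x hx hx'
      obtain rfl := h.eq_of_mem q hq q' hq' x hx hx' hk
      obtain rfl : e = e' := by omega
      rw [hi] at hi'; rw [hj] at hj'
      exact hne (by rw [Option.some.inj hi', Option.some.inj hj'])
    refine ⟨?_, ?_, ?_, ?_⟩ <;> rintro rfl
    · exact main _ (List.mem_of_getElem? hi) (List.mem_of_getElem? hi')
    · exact main _ (List.mem_of_getElem? hi) (List.mem_of_getElem? hj')
    · exact main _ (List.mem_of_getElem? hj) (List.mem_of_getElem? hi')
    · exact main _ (List.mem_of_getElem? hj) (List.mem_of_getElem? hj')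

lemma length_view {Y : Type} (p : Policy n Y) (y : Fin n → Y) (t : ℕ) (j : Fin n) :
    (p.view y t j).length = t := by
  induction t with
  | zero => rfl
  | succ t ih => simp [Policy.view, ih]

/-- The partial sum held by node `j` at time `t`. -/
def heldAt {Y : Type} (ψ : Fin n → Y → ℝ) (w : ℕ → ℕ) (out : List (ℕ × List (Fin n)))
    (y : Fin n → Y) (t : ℕ) (j : Fin n) : ℝ :=
  held ψ (aggSchedule w out) j (y j) ((aggPolicy ψ w out).view y t j)

lemma heldAt_succ {Y : Type} (ψ : Fin n → Y → ℝ) (y : Fin n → Y) (t : ℕ) (j : Fin n) :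
    heldAt ψ w out y (t + 1) j =
      (if ∃ i, (t, j, i) ∈ aggSchedule w out then 0 else heldAt ψ w out y t j) +
        ∑ i, if (t, i, j) ∈ aggSchedule w out then heldAt ψ w out y t i else 0 := by
  simp only [heldAt, Policy.view, held, length_view]
  congr 1
  refine sum_congr rfl fun i _ => ?_
  by_cases hi : (t, i, j) ∈ aggSchedule w out
  · have hi' : (t, i, j) ∈ (aggPolicy ψ w out).tx := hi
    rw [if_pos hi', if_pos hi]; rfl
  · have hi' : (t, i, j) ∉ (aggPolicy ψ w out).tx := hi
    rw [if_neg hi', if_neg hi]; rfl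

lemma GoodPaths.sum_heldAt {Y : Type} {r : Fin n} (h : GoodPaths w r out) (ψ : Fin n → Y → ℝ)
    (y : Fin n → Y) (t : ℕ) : ∑ j, heldAt ψ w out y t j = sumFunction ψ y := by
  induction t with
  | zero => rfl
  | succ t ih =>
    rw [← ih]
    simp only [heldAt_succ]
    rw [sum_add_distrib, sum_comm, ← sum_add_distrib]
    refine sum_congr rfl fun i _ => ?_
    by_cases hi : ∃ j, (t, i, j) ∈ aggSchedule w out
    · obtain ⟨j, hj⟩ := hi
      rw [if_pos ⟨j, hj⟩, sum_eq_single j, if_pos hj, zero_add]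
      · intro j' _ hne
        refine if_neg fun hj' => ?_
        exact ((h.conflictFree ψ).2 t i j i j' hj hj' (by simp [hne.symm])).1 rfl
      · simp
    · rw [if_neg hi, sum_eq_zero, add_zero]
      intro j _
      exact if_neg fun hj => hi ⟨j, hj⟩

/-- In the end only the root holds data: a node transmits on its first path, which is the last one
to be used, and receives nothing later. -/
lemma GoodPaths.heldAt_eq_zero {Y : Type} {r : Fin n} (h : GoodPaths w r out) (ψ : Fin n → Y → ℝ)
    (y : Fin n → Y) {v : Fin n} (hv : v ≠ r) :
    heldAt ψ w out y (∑ l ∈ range (Nat.clog 2 n), (1 + w l)) v = 0 := by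
  obtain ⟨q, hq, hvq, hlast, hmin⟩ := h.exists_first v hv
  obtain ⟨e, he, hev⟩ := List.mem_iff_getElem.1 hvq
  have he1 : e + 1 < q.2.length := by
    by_contra hlt
    apply hlast
    rw [List.getLast?_eq_getElem?, show q.2.length - 1 = e by omega]
    exact List.getElem?_eq_some_iff.2 ⟨he, hev⟩
  have hgv : q.2[e]? = some v := List.getElem?_eq_some_iff.2 ⟨he, hev⟩
  set t₀ := blockStart n w q.1 + e with ht₀
  have hsend : ∃ j, (t₀, v, j) ∈ aggSchedule w out :=
    ⟨q.2[e + 1], mem_aggSchedule.2 ⟨q, hq, e, rfl, hgv, List.getElem?_eq_some_iff.2 ⟨he1, rfl⟩⟩⟩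
  have hrec : ∀ t, t₀ ≤ t → ∀ i, (t, i, v) ∉ aggSchedule w out := by
    intro t ht i hi
    obtain ⟨q', hq', e', rfl, -, hv'⟩ := mem_aggSchedule.1 hi
    have hle := hmin q' hq' (List.mem_of_getElem? hv')
    have he' := (List.getElem?_eq_some_iff.1 hv').1
    have hge := h.iteration_le hq' he' (ht₀ ▸ ht)
    have hk : q.1 = q'.1 := le_antisymm hle hge
    obtain rfl := h.eq_of_mem q hq q' hq' v hvq (List.mem_of_getElem? hv') hk
    have := (List.getElem?_inj he (h.nodup q hq)).1 (hgv.trans hv'.symm)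
    omega
  have hzero : ∀ s, heldAt ψ w out y (t₀ + 1 + s) v = 0 := by
    intro s
    induction s with
    | zero =>
      rw [add_zero, heldAt_succ, if_pos hsend, zero_add]
      exact sum_eq_zero fun i _ => if_neg (hrec t₀ le_rfl i)
    | succ s ih =>
      rw [← add_assoc, heldAt_succ, ih, ite_self, zero_add]
      exact sum_eq_zero fun i _ => if_neg (hrec _ (by omega) i)
  have h1 := blockStart_add_le_sum (w := w) (h.lt_clog q hq)
  have h2 := h.length_le q hq
  obtain ⟨s, hs⟩ := Nat.exists_eq_add_of_le
    (show t₀ + 1 ≤ ∑ l ∈ range (Nat.clog 2 n), (1 + w l) by omega)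
  rw [hs]
  exact hzero s

lemma GoodPaths.computableAt {Y : Type} {r : Fin n} (h : GoodPaths w r out) (ψ : Fin n → Y → ℝ) :
    (aggPolicy ψ w out).ComputableAt r (sumFunction ψ) (∑ l ∈ range (Nat.clog 2 n), (1 + w l)) := by
  refine ⟨held ψ (aggSchedule w out) r, fun y => ?_⟩
  rw [← h.sum_heldAt ψ y (∑ l ∈ range (Nat.clog 2 n), (1 + w l)),
    sum_eq_single r (fun v _ hv => h.heldAt_eq_zero ψ y hv) (by simp)]
  rfl

lemma GoodPaths.valid {Y : Type} {r : Fin n} (h : GoodPaths w r out) (ψ : Fin n → Y → ℝ) :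
    (aggPolicy ψ w out).Valid r (sumFunction ψ) := ⟨h.conflictFree ψ, _, h.computableAt ψ⟩

lemma GoodPaths.latency_le {Y : Type} {r : Fin n} (h : GoodPaths w r out) (ψ : Fin n → Y → ℝ) :
    (aggPolicy ψ w out).latency r (sumFunction ψ) ≤ ∑ l ∈ range (Nat.clog 2 n), (1 + w l) :=
  Nat.sInf_le (h.computableAt ψ)

lemma exists_isBisectionOutput {d : ℕ} (hd : 1 ≤ d) (ν : ℝ) (V : Fin n → EuclideanSpace ℝ (Fin d))
    (w : ℕ → ℕ) (r : Fin n) : ∃ out, IsBisectionOutput ν V w r out :=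
  exists_bisectionRun hd ν V w _ 0 _ r _ le_rfl (by simp [Region.whole])

/-- The minimum latency is `⌈log₂ n⌉`. -/
lemma minLatency_eq {Y : Type} {r : Fin n} {ψ : Fin n → Y → ℝ} (hψ : ∀ i, ∃ a b, ψ i a ≠ ψ i b) :
    minLatency r (sumFunction ψ) = Nat.clog 2 n := by
  obtain ⟨out, ho⟩ := exists_isBisectionOutput (n := n) (d := 1) le_rfl 0 (fun _ => 0) (fun _ => 0) r
  have hg := ho.goodPaths
  have hmem : (aggPolicy ψ (fun _ => 0) out).latency r (sumFunction ψ) ∈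
      {l | ∃ p : Policy n Y, p.Valid r (sumFunction ψ) ∧ p.latency r (sumFunction ψ) = l} :=
    ⟨_, hg.valid ψ, rfl⟩
  apply le_antisymm
  · refine (Nat.sInf_le hmem).trans ((hg.latency_le ψ).trans ?_)
    simp
  · obtain ⟨p, hp, hl⟩ := Nat.sInf_mem ⟨_, hmem⟩
    rw [minLatency, ← hl]
    exact clog_le_latency hψ hp

end Schedule

/-! ### Boxes and the cube -/

section Geometry

open ProbabilityTheory

variable {d : ℕ}

/-- The closed box `∏ [lo c, hi c]`. -/
def box (lo hi : Fin d → ℝ) : Set (EuclideanSpace ℝ (Fin d)) := {x | ∀ c, x c ∈ Set.Icc (lo c) (hi c)}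

lemma box_eq_preimage (lo hi : Fin d → ℝ) :
    box lo hi = (WithLp.ofLp : EuclideanSpace ℝ (Fin d) → Fin d → ℝ) ⁻¹' Set.Icc lo hi := by
  ext x
  simp [box, Set.mem_Icc, Pi.le_def, forall_and]

lemma measurableSet_box (lo hi : Fin d → ℝ) : MeasurableSet (box lo hi) := by
  rw [box_eq_preimage]
  exact (PiLp.volume_preserving_ofLp (Fin d)).measurable measurableSet_Icc

lemma volume_box (lo hi : Fin d → ℝ) :
    volume (box lo hi) = ∏ c, ENNReal.ofReal (hi c - lo c) := by
  rw [box_eq_preimage, (PiLp.volume_preserving_ofLp (Fin d)).measure_preimage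
    measurableSet_Icc.nullMeasurableSet, Real.volume_Icc_pi]

lemma cube_eq_box (d n : ℕ) : cube d n = box (fun _ => 0) fun _ => side d n := rfl

lemma side_nonneg (d n : ℕ) : 0 ≤ side d n := by unfold side; positivity

lemma side_pos {n : ℕ} (d : ℕ) (hn : 0 < n) : 0 < side d n := by
  have : (0 : ℝ) < n := by exact_mod_cast hn
  unfold side; positivity

lemma side_pow (hd : 1 ≤ d) (n : ℕ) : side d n ^ d = n := by
  have : (d : ℝ) ≠ 0 := by positivity
  rw [side, ← Real.rpow_natCast, ← Real.rpow_mul (by positivity), one_div_mul_cancel this,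
    Real.rpow_one]

lemma side_rpow (n : ℕ) (ν : ℝ) : side d n ^ ν = (n : ℝ) ^ (ν / d) := by
  rw [side, ← Real.rpow_mul (by positivity)]; congr 1; ring

lemma volume_cube (hd : 1 ≤ d) (n : ℕ) : volume (cube d n) = n := by
  rw [cube_eq_box, volume_box]
  simp only [sub_zero, prod_const, card_univ, Fintype.card_fin]
  rw [← ENNReal.ofReal_pow (side_nonneg d n), side_pow hd, ENNReal.ofReal_natCast]

lemma isProbabilityMeasure_cube (hd : 1 ≤ d) {n : ℕ} (hn : 0 < n) :
    IsProbabilityMeasure (cond volume (cube d n)) := by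
  refine cond_isProbabilityMeasure_of_finite ?_ ?_ <;> rw [volume_cube hd]
  · exact_mod_cast hn.ne'
  · exact ENNReal.natCast_ne_top n

lemma cond_cube_le (hd : 1 ≤ d) (n : ℕ) (s : Set (EuclideanSpace ℝ (Fin d))) :
    cond volume (cube d n) s ≤ (n : ℝ≥0∞)⁻¹ * volume s := by
  rw [ProbabilityTheory.cond, Measure.smul_apply, volume_cube hd, smul_eq_mul]
  gcongr
  exact Measure.restrict_le_self

end Geometry

/-! ### Random locations -/

section Locations

open ProbabilityTheory

variable {d n : ℕ}

lemma isProbabilityMeasure_locationLaw (hd : 1 ≤ d) (hn : 0 < n) :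
    IsProbabilityMeasure (locationLaw d n) := by
  have := isProbabilityMeasure_cube hd hn
  unfold locationLaw; infer_instance

/-- The probability of an event for two nodes is at most its largest conditional probability given
the location of the first one. -/
lemma locationLaw_pair_le (hd : 1 ≤ d) (hn : 0 < n) {x y : Fin n} (hxy : x ≠ y)
    {D : Set (EuclideanSpace ℝ (Fin d) × EuclideanSpace ℝ (Fin d))} (hD : MeasurableSet D)
    {p : ℝ≥0∞} (hp : ∀ a, cond volume (cube d n) {b | (a, b) ∈ D} ≤ p) :
    locationLaw d n {V | (V x, V y) ∈ D} ≤ p := by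
  have hpr := isProbabilityMeasure_cube (d := d) hd hn
  have hpr' := isProbabilityMeasure_locationLaw (d := d) hd hn
  have hm : MeasurableSet {V : Fin n → EuclideanSpace ℝ (Fin d) | (V x, V y) ∈ D} :=
    ((measurable_pi_apply x).prodMk (measurable_pi_apply y)) hD
  have hle : ∫⁻ V, ({V : Fin n → EuclideanSpace ℝ (Fin d) | (V x, V y) ∈ D}.indicator 1 V : ℝ≥0∞)
      ∂locationLaw d n ≤ ∫⁻ _, p ∂locationLaw d n := by
    refine lintegral_le_of_lmarginal_le (μ := fun _ : Fin n => cond volume (cube d n)) {y}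
      (measurable_one.indicator hm) measurable_const ?_
    rw [lmarginal_singleton, lmarginal_singleton]
    intro V
    simp only [lintegral_const, measure_univ, mul_one]
    refine le_trans (le_of_eq ?_) (hp (V x))
    have hmb : MeasurableSet {b | (V x, b) ∈ D} := measurable_prodMk_left hD
    rw [← lintegral_indicator_one hmb]
    refine lintegral_congr fun b => ?_
    have hW : ∀ W : Fin n → EuclideanSpace ℝ (Fin d), W x = V x → W y = b →
        ({V : Fin n → EuclideanSpace ℝ (Fin d) | (V x, V y) ∈ D}.indicator 1 W : ℝ≥0∞) =
          {b | (V x, b) ∈ D}.indicator 1 b := by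
      intro W h1 h2
      have hb : W ∈ {V : Fin n → EuclideanSpace ℝ (Fin d) | (V x, V y) ∈ D} ↔
          b ∈ {b | (V x, b) ∈ D} := by
        change (W x, W y) ∈ D ↔ (V x, b) ∈ D
        rw [h1, h2]
      by_cases h : b ∈ {b | (V x, b) ∈ D}
      · rw [Set.indicator_of_mem (hb.2 h), Set.indicator_of_mem h]
        rfl
      · rw [Set.indicator_of_notMem (fun h' => h (hb.1 h')), Set.indicator_of_notMem h]
    exact hW _ (Function.update_of_ne hxy _ _) (Function.update_self _ _ _)
  rwa [lintegral_indicator_one hm, lintegral_const, measure_univ, mul_one] at hle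

/-- The volume of the unit ball plus one, so that positivity and finiteness are trivial. -/
noncomputable def ballConst (d : ℕ) : ℝ := (volume (Metric.ball (0 : EuclideanSpace ℝ (Fin d)) 1)).toReal + 1

lemma ballConst_ge_one (d : ℕ) : 1 ≤ ballConst d := by
  unfold ballConst
  have := ENNReal.toReal_nonneg (a := volume (Metric.ball (0 : EuclideanSpace ℝ (Fin d)) 1))
  linarith

lemma locationLaw_dist_le (hd : 1 ≤ d) (hn : 0 < n) {x y : Fin n} (hxy : x ≠ y) {ρ : ℝ}
    (hρ : 0 ≤ ρ) : (locationLaw d n).real {V | dist (V x) (V y) ≤ ρ} ≤ ballConst d * ρ ^ d / n := by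
  have h0 : 0 ≤ ballConst d * ρ ^ d / n := by
    have := ballConst_ge_one d
    positivity
  refine ENNReal.toReal_le_of_le_ofReal h0 ?_
  refine locationLaw_pair_le hd hn hxy (D := {q | dist q.1 q.2 ≤ ρ})
    (measurableSet_le (by fun_prop) (by fun_prop)) fun a => ?_
  refine (cond_cube_le hd n _).trans ?_
  have e : {b | (a, b) ∈ {q : EuclideanSpace ℝ (Fin d) × EuclideanSpace ℝ (Fin d) |
      dist q.1 q.2 ≤ ρ}} = Metric.closedBall a ρ := by
    ext b; simp [Metric.mem_closedBall, dist_comm]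
  have hn' : (0 : ℝ) < n := by exact_mod_cast hn
  have e2 : ballConst d * ρ ^ d / n = (n : ℝ)⁻¹ * (ρ ^ d * ballConst d) := by
    field_simp
  rw [e, Measure.addHaar_closedBall _ _ hρ, finrank_euclideanSpace, Fintype.card_fin, e2,
    ENNReal.ofReal_mul (by positivity), ENNReal.ofReal_mul (by positivity),
    ENNReal.ofReal_inv_of_pos hn', ENNReal.ofReal_natCast]
  gcongr
  rw [← ENNReal.ofReal_toReal (measure_ball_lt_top (μ := volume)
    (x := (0 : EuclideanSpace ℝ (Fin d))) (r := 1)).ne]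
  exact ENNReal.ofReal_le_ofReal (by unfold ballConst; linarith)

lemma ae_mem_cube (hd : 1 ≤ d) (hn : 0 < n) : ∀ᵐ V ∂locationLaw d n, ∀ x, V x ∈ cube d n := by
  have hpr := isProbabilityMeasure_cube (d := d) hd hn
  rw [ae_all_iff]
  intro x
  have h : ∀ᵐ a ∂cond volume (cube d n), a ∈ cube d n :=
    ae_cond_mem (measurableSet_box _ _)
  exact (measurePreserving_eval (fun _ : Fin n => cond volume (cube d n)) x).quasiMeasurePreserving.ae h

lemma volume_coord_eq (c : Fin d) (a : ℝ) :
    volume {b : EuclideanSpace ℝ (Fin d) | b c = a} = 0 := by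
  have e : {b : EuclideanSpace ℝ (Fin d) | b c = a} =
      (WithLp.ofLp : EuclideanSpace ℝ (Fin d) → Fin d → ℝ) ⁻¹' (Function.eval c ⁻¹' {a}) := rfl
  have hm : MeasurableSet (Function.eval c ⁻¹' {a} : Set (Fin d → ℝ)) :=
    measurable_pi_apply c (measurableSet_singleton a)
  rw [e, (PiLp.volume_preserving_ofLp (Fin d)).measure_preimage hm.nullMeasurableSet, volume_pi]
  exact Measure.pi_hyperplane (fun _ : Fin d => (volume : Measure ℝ)) c a

lemma ae_coord_ne (hd : 1 ≤ d) (hn : 0 < n) :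
    ∀ᵐ V ∂locationLaw d n, ∀ c : Fin d, Function.Injective fun x => V x c := by
  rw [ae_all_iff]
  intro c
  have h : ∀ᵐ V ∂locationLaw d n, ∀ x y : Fin n, x ≠ y → V x c ≠ V y c := by
    simp only [ae_all_iff]
    intro x y hxy
    rw [ae_iff, ← nonpos_iff_eq_zero]
    have := locationLaw_pair_le hd hn hxy (D := {q | q.1 c = q.2 c})
      (measurableSet_eq_fun (by fun_prop) (by fun_prop)) (p := 0) fun a => ?_
    · simpa using this
    · refine (cond_cube_le hd n _).trans ?_
      simp only [Set.mem_ofPred_eq, nonpos_iff_eq_zero, mul_eq_zero]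
      right
      simpa [eq_comm] using volume_coord_eq c (a c)
  filter_upwards [h] with V hV x y hxy
  by_contra hne
  exact hV x y hne hxy

end Locations

/-! ### Lower bounds for the expected minimum energy -/

section MinEnergy

open ProbabilityTheory

variable {d n : ℕ} {Y : Type} {ν δ : ℝ} {r : Fin n} {ψ : Fin n → Y → ℝ}

lemma le_minEnergy (hδ : 0 ≤ δ) (hψ : ∀ i, ∃ a b, ψ i a ≠ ψ i b)
    {V : Fin n → EuclideanSpace ℝ (Fin d)} {b : ℝ}
    (h : ∀ p : Policy n Y, p.Valid r (sumFunction ψ) →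
      (p.latency r (sumFunction ψ) : ℝ) ≤ Nat.clog 2 n + δ → b ≤ p.energy ν V) :
    b ≤ minEnergy ν δ r (sumFunction ψ) V := by
  refine le_csInf ?_ ?_
  · obtain ⟨out, ho⟩ :=
      exists_isBisectionOutput (n := n) (d := 1) le_rfl 0 (fun _ => 0) (fun _ => 0) r
    refine ⟨_, _, ho.goodPaths.valid ψ, ?_, rfl⟩
    rw [minLatency_eq hψ]
    have h1 : ((aggPolicy ψ (fun _ => 0) out).latency r (sumFunction ψ) : ℝ) ≤ Nat.clog 2 n := by
      have := ho.goodPaths.latency_le ψ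
      simp only [add_zero, sum_const, card_range, smul_eq_mul, mul_one] at this
      exact_mod_cast this
    linarith
  · rintro _ ⟨p, hp, hl, rfl⟩
    rw [minLatency_eq hψ] at hl
    exact h p hp hl

lemma minEnergy_le {V : Fin n → EuclideanSpace ℝ (Fin d)} {p : Policy n Y} {Ψ : (Fin n → Y) → ℝ}
    (hp : p.Valid r Ψ) (hl : (p.latency r Ψ : ℝ) ≤ minLatency r Ψ + δ) :
    minEnergy ν δ r Ψ V ≤ p.energy ν V :=
  csInf_le ⟨0, by rintro _ ⟨p, -, -, rfl⟩; exact energy_nonneg ν V p⟩ ⟨p, hp, hl, rfl⟩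

lemma minEnergy_nonneg (Ψ : (Fin n → Y) → ℝ) (V : Fin n → EuclideanSpace ℝ (Fin d)) :
    0 ≤ minEnergy ν δ r Ψ V :=
  Real.sInf_nonneg (by rintro _ ⟨p, -, -, rfl⟩; exact energy_nonneg ν V p)

/-- The minimum energy is a minimum over the finitely many possible sets of links. -/
lemma measurable_minEnergy (Ψ : (Fin n → Y) → ℝ) :
    Measurable fun V : Fin n → EuclideanSpace ℝ (Fin d) => minEnergy ν δ r Ψ V := by
  set Λ : Set (Finset (Fin n × Fin n)) := {F | ∃ p : Policy n Y, p.Valid r Ψ ∧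
    (p.latency r Ψ : ℝ) ≤ minLatency r Ψ + δ ∧ p.links = F} with hΛ
  have e : (fun V : Fin n → EuclideanSpace ℝ (Fin d) => minEnergy ν δ r Ψ V) =
      fun V => ⨅ F : Λ, ∑ e ∈ (F : Finset (Fin n × Fin n)), dist (V e.1) (V e.2) ^ ν := by
    funext V
    rw [minEnergy, iInf]
    congr 1
    ext E
    constructor
    · rintro ⟨p, hp, hl, rfl⟩
      exact ⟨⟨p.links, p, hp, hl, rfl⟩, rfl⟩
    · rintro ⟨⟨_, p, hp, hl, rfl⟩, rfl⟩
      exact ⟨p, hp, hl, rfl⟩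
  rw [e]
  refine Measurable.iInf fun F => ?_
  refine Finset.measurable_sum _ fun e _ => ?_
  fun_prop

lemma integrable_indicator_law (hd : 1 ≤ d) (hn : 0 < n)
    {s : Set (Fin n → EuclideanSpace ℝ (Fin d))} (hs : MeasurableSet s) :
    Integrable (s.indicator fun _ => (1 : ℝ)) (locationLaw d n) := by
  have := isProbabilityMeasure_locationLaw (d := d) hd hn
  exact (integrable_const (1 : ℝ)).indicator hs

lemma measurableSet_dist_le (x y : Fin n) (ρ : ℝ) :
    MeasurableSet {V : Fin n → EuclideanSpace ℝ (Fin d) | dist (V x) (V y) ≤ ρ} :=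
  measurableSet_le (by fun_prop) (by fun_prop)

/-- In expectation a positive fraction of the nodes is isolated at a constant scale, which costs
energy of order `n`. -/
lemma linear_le_integral_minEnergy (hd : 1 ≤ d) (hν : 1 < ν) : ∃ c : ℝ, 0 < c ∧ ∀ {n : ℕ} {Y : Type}
    {δ : ℝ} {r : Fin n} {ψ : Fin n → Y → ℝ}, 2 ≤ n → 0 ≤ δ → (∀ i, ∃ a b, ψ i a ≠ ψ i b) →
    Integrable (minEnergy ν δ r (sumFunction ψ)) (locationLaw d n) →
    c * n ≤ ∫ V, minEnergy ν δ r (sumFunction ψ) V ∂locationLaw d n := by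
  have hκ := ballConst_ge_one d
  set ρ : ℝ := 1 / (2 * ballConst d) with hρ
  have hρ0 : 0 < ρ := by positivity
  have hρ1 : ρ ≤ 1 := by rw [hρ, div_le_one (by positivity)]; linarith
  have hρd : ballConst d * ρ ^ d ≤ 1 / 2 := by
    have : ρ ^ d ≤ ρ := by
      simpa using pow_le_pow_of_le_one hρ0.le hρ1 hd
    calc ballConst d * ρ ^ d ≤ ballConst d * ρ := by gcongr
      _ = 1 / 2 := by rw [hρ]; field_simp
  refine ⟨ρ ^ ν / 4, by positivity, ?_⟩
  intro n Y δ r ψ hn hδ hψ hint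
  have hpr := isProbabilityMeasure_locationLaw (d := d) hd (show 0 < n by omega)
  have hn0 : (0 : ℝ) < n := by exact_mod_cast (by omega : 0 < n)
  set near : Fin n → Fin n → (Fin n → EuclideanSpace ℝ (Fin d)) → ℝ := fun v y =>
    {V : Fin n → EuclideanSpace ℝ (Fin d) | dist (V v) (V y) ≤ ρ}.indicator fun _ => 1 with hnear
  have hnear0 : ∀ v y V, 0 ≤ near v y V := fun v y V => Set.indicator_nonneg (by simp) _
  have hi : ∀ v y, Integrable (near v y) (locationLaw d n) := fun v y =>
    integrable_indicator_law hd (by omega) (measurableSet_dist_le v y ρ)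
  set g : (Fin n → EuclideanSpace ℝ (Fin d)) → ℝ := fun V =>
    ρ ^ ν * ∑ v ∈ univ.erase r, (1 - ∑ y ∈ univ.erase v, near v y V) with hg
  have hgi : Integrable g (locationLaw d n) :=
    (integrable_finsetSum _ fun v _ =>
      (integrable_const (1 : ℝ)).sub (integrable_finsetSum _ fun y _ => hi v y)).const_mul _
  have hle : ∀ V, g V ≤ minEnergy ν δ r (sumFunction ψ) V := by
    intro V
    refine le_minEnergy hδ hψ fun p hp _ => ?_
    set A := (univ.erase r).filter fun v => ∀ j, j ≠ v → ρ ≤ dist (V v) (V j) with hA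
    refine le_trans ?_ (isolated_le_energy (by linarith) hρ0.le V hψ hp A ?_)
    · change ρ ^ ν * _ ≤ _
      rw [mul_comm]
      refine mul_le_mul_of_nonneg_right ?_ (by positivity)
      rw [hA, card_filter]
      push_cast
      refine sum_le_sum fun v _ => ?_
      split_ifs with h
      · have := sum_nonneg fun y (_ : y ∈ univ.erase v) => hnear0 v y V
        linarith
      · push Not at h
        obtain ⟨j, hj, hlt⟩ := h
        have h1 : near v j V = 1 := by
          exact Set.indicator_of_mem (f := fun _ => (1 : ℝ)) (show dist (V v) (V j) ≤ ρ from hlt.le)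
        have h2 := single_le_sum (f := fun y => near v y V)
          (fun y (_ : y ∈ univ.erase v) => hnear0 v y V) (mem_erase.2 ⟨hj, mem_univ j⟩)
        simp only [h1] at h2
        linarith
    · intro v hv
      have := mem_filter.1 hv
      exact ⟨(mem_erase.1 this.1).1, this.2⟩
  have hgint : ρ ^ ν / 4 * n ≤ ∫ V, g V ∂locationLaw d n := by
    have hterm_int : ∀ v ∈ univ.erase r, Integrable (fun V => 1 - ∑ y ∈ univ.erase v, near v y V)
        (locationLaw d n) := fun v _ =>
      (integrable_const (1 : ℝ)).sub (integrable_finsetSum _ fun y _ => hi v y)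
    rw [hg, integral_const_mul, integral_finsetSum _ hterm_int]
    have hterm : ∀ v ∈ univ.erase r, (1 / 2 : ℝ) ≤
        ∫ V, (1 - ∑ y ∈ univ.erase v, near v y V) ∂locationLaw d n := by
      intro v _
      rw [integral_sub (integrable_const (1 : ℝ)) (integrable_finsetSum _ fun y _ => hi v y),
        integral_finsetSum _ fun y _ => hi v y]
      simp only [integral_const, probReal_univ, smul_eq_mul, mul_one]
      have h1 : ∀ y ∈ univ.erase v, ∫ V, near v y V ∂locationLaw d n ≤ (1 / 2) / n := by
        intro y hy
        simp only [hnear]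
        rw [integral_indicator_const _ (measurableSet_dist_le v y ρ), smul_eq_mul, mul_one]
        refine (locationLaw_dist_le hd (by omega) (mem_erase.1 hy).1.symm hρ0.le).trans ?_
        gcongr
      have h2 := sum_le_card_nsmul _ _ _ h1
      have h3 : (#(univ.erase v) : ℝ) ≤ n := by
        have := card_le_univ (univ.erase v)
        rw [Fintype.card_fin] at this
        exact_mod_cast this
      rw [nsmul_eq_mul] at h2
      have h4 : (#(univ.erase v) : ℝ) * ((1 / 2) / n) ≤ n * ((1 / 2) / n) := by gcongr
      have h5 : (n : ℝ) * ((1 / 2) / n) = 1 / 2 := by field_simp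
      linarith
    have h6 := card_nsmul_le_sum _ _ _ hterm
    rw [nsmul_eq_mul, card_erase_of_mem (mem_univ r), card_univ, Fintype.card_fin,
      Nat.cast_sub (by omega)] at h6
    have h7 : (n : ℝ) / 4 ≤ ((n : ℝ) - (1 : ℕ)) * (1 / 2) := by
      have : (2 : ℝ) ≤ n := by exact_mod_cast hn
      push_cast; linarith
    calc ρ ^ ν / 4 * n = ρ ^ ν * (n / 4) := by ring
      _ ≤ _ := mul_le_mul_of_nonneg_left (h7.trans h6) (by positivity)
  exact hgint.trans (integral_mono hgi hint hle)

/-- With positive probability half of the nodes are at distance of order `n ^ (1 / d)` from the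
root. -/
lemma far_le_integral_minEnergy (hd : 1 ≤ d) (hν : 1 < ν) : ∃ c : ℝ, 0 < c ∧ ∀ {n : ℕ} {Y : Type}
    {δ : ℝ} {r : Fin n} {ψ : Fin n → Y → ℝ}, 4 ≤ n → 0 ≤ δ → (∀ i, ∃ a b, ψ i a ≠ ψ i b) →
    Integrable (minEnergy ν δ r (sumFunction ψ)) (locationLaw d n) →
    c * ((n : ℝ) ^ (ν / d) * (1 + δ) ^ (1 - ν)) ≤
      ∫ V, minEnergy ν δ r (sumFunction ψ) V ∂locationLaw d n := by
  have hκ := ballConst_ge_one d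
  obtain ⟨c₀, hc₀, hfar⟩ := far_le_energy hν
  set a : ℝ := 1 / (8 * ballConst d) with ha
  have ha0 : 0 < a := by positivity
  have ha1 : a ≤ 1 := by rw [ha, div_le_one (by positivity)]; linarith
  have had : ballConst d * a ^ d ≤ 1 / 8 := by
    have : a ^ d ≤ a := by simpa using pow_le_pow_of_le_one ha0.le ha1 hd
    calc ballConst d * a ^ d ≤ ballConst d * a := by gcongr
      _ = 1 / 8 := by rw [ha]; field_simp
  refine ⟨c₀ * a ^ ν / 4, by positivity, ?_⟩
  intro n Y δ r ψ hn hδ hψ hint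
  have hpr := isProbabilityMeasure_locationLaw (d := d) hd (show 0 < n by omega)
  have hn0 : (0 : ℝ) < n := by exact_mod_cast (by omega : 0 < n)
  set D : ℝ := a * side d n with hD
  have hs := side_pos d (show 0 < n by omega)
  have hD0 : 0 < D := by positivity
  set X : ℝ := c₀ * (D ^ ν * (1 + δ) ^ (1 - ν)) with hX
  have hX0 : 0 ≤ X := by positivity
  set near : Fin n → (Fin n → EuclideanSpace ℝ (Fin d)) → ℝ := fun y =>
    {V : Fin n → EuclideanSpace ℝ (Fin d) | dist (V y) (V r) ≤ D}.indicator fun _ => 1 with hnear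
  have hi : ∀ y, Integrable (near y) (locationLaw d n) := fun y =>
    integrable_indicator_law hd (by omega) (measurableSet_dist_le y r D)
  set g : (Fin n → EuclideanSpace ℝ (Fin d)) → ℝ := fun V =>
    X * (1 - 2 / n * ∑ y, near y V) with hg
  have hgi : Integrable g (locationLaw d n) :=
    ((integrable_const (1 : ℝ)).sub ((integrable_finsetSum _ fun y _ => hi y).const_mul _)).const_mul _
  have hle : ∀ V, g V ≤ minEnergy ν δ r (sumFunction ψ) V := by
    intro V
    have hsum : ∑ y, near y V = n - #(univ.filter fun v => D < dist (V v) (V r)) := by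
      have h1 := card_filter_add_card_filter_not (s := (univ : Finset (Fin n)))
        (fun v => D < dist (V v) (V r))
      have h2 : ∑ y, near y V = #(univ.filter fun v => ¬ D < dist (V v) (V r)) := by
        rw [card_filter]
        push_cast
        refine sum_congr rfl fun y _ => ?_
        simp [hnear, Set.indicator]
      rw [card_univ, Fintype.card_fin] at h1
      have h3 : (#(univ.filter fun v => D < dist (V v) (V r)) : ℝ) +
          #(univ.filter fun v => ¬ D < dist (V v) (V r)) = n := by exact_mod_cast h1
      rw [h2]; linarith
    by_cases hc : n ≤ 2 * #(univ.filter fun v => D < dist (V v) (V r))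
    · refine le_minEnergy hδ hψ fun p hp hl => ?_
      refine le_trans ?_ (hfar V hψ hp (by omega) hδ hD0 hl hc)
      have h0 : 0 ≤ ∑ y, near y V := sum_nonneg fun y _ => Set.indicator_nonneg (by simp) _
      have : 0 ≤ 2 / (n : ℝ) * ∑ y, near y V := by positivity
      calc g V ≤ X * 1 := mul_le_mul_of_nonneg_left (by linarith) hX0
        _ = _ := mul_one X
    · refine le_trans ?_ (minEnergy_nonneg _ V)
      have hc' : 2 * (#(univ.filter fun v => D < dist (V v) (V r)) : ℝ) < n := by
        exact_mod_cast not_le.1 hc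
      have : 1 ≤ 2 / (n : ℝ) * ∑ y, near y V := by
        rw [hsum, div_mul_eq_mul_div, le_div_iff₀ hn0]; linarith
      exact mul_nonpos_of_nonneg_of_nonpos hX0 (by linarith)
  have hgint : X / 4 ≤ ∫ V, g V ∂locationLaw d n := by
    rw [hg, integral_const_mul, integral_sub (integrable_const (1 : ℝ))
      ((integrable_finsetSum _ fun y _ => hi y).const_mul _), integral_const_mul,
      integral_finsetSum _ fun y _ => hi y]
    simp only [integral_const, probReal_univ, smul_eq_mul, mul_one]
    have h1 : ∀ y, y ≠ r → ∫ V, near y V ∂locationLaw d n ≤ 1 / 8 := by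
      intro y hy
      simp only [hnear]
      rw [integral_indicator_const _ (measurableSet_dist_le y r D), smul_eq_mul, mul_one]
      refine (locationLaw_dist_le hd (by omega) hy hD0.le).trans ?_
      rw [hD, mul_pow, side_pow hd, ← mul_assoc, mul_div_assoc, div_self hn0.ne', mul_one]
      exact had
    have h2 : ∫ V, near r V ∂locationLaw d n ≤ 1 := by
      simp only [hnear]
      rw [integral_indicator_const _ (measurableSet_dist_le r r D), smul_eq_mul, mul_one]
      exact measureReal_le_one
    have h3 : ∑ y, ∫ V, near y V ∂locationLaw d n ≤ 1 + n * (1 / 8) := by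
      rw [← add_sum_erase _ _ (mem_univ r)]
      refine add_le_add h2 ?_
      refine (sum_le_card_nsmul _ _ _ fun y hy => h1 y (mem_erase.1 hy).1).trans ?_
      rw [nsmul_eq_mul]
      have := card_le_univ (univ.erase r)
      rw [Fintype.card_fin] at this
      gcongr
    have h4 : 2 / (n : ℝ) * ∑ y, ∫ V, near y V ∂locationLaw d n ≤ 3 / 4 := by
      calc _ ≤ 2 / (n : ℝ) * (1 + n * (1 / 8)) := by gcongr
        _ = 2 / n + 1 / 4 := by field_simp; ring
        _ ≤ 2 / 4 + 1 / 4 := by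
          have : (4 : ℝ) ≤ n := by exact_mod_cast hn
          gcongr
        _ = 3 / 4 := by norm_num
    calc X / 4 = X * (1 / 4) := by ring
      _ ≤ _ := mul_le_mul_of_nonneg_left (by linarith) hX0
  refine le_trans (le_of_eq ?_) (hgint.trans (integral_mono hgi hint hle))
  rw [hX, hD, Real.mul_rpow ha0.le hs.le, side_rpow]
  ring

end MinEnergy

/-! ### A moment bound for beta distributions -/

section Beta

lemma integral_beta_succ (a b : ℕ) :
    (a + 1 : ℝ) * ∫ x in (0 : ℝ)..1, x ^ a * (1 - x) ^ (b + 1) =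
      (b + 1 : ℝ) * ∫ x in (0 : ℝ)..1, x ^ (a + 1) * (1 - x) ^ b := by
  have hderiv : ∀ x ∈ Set.uIcc (0 : ℝ) 1, HasDerivAt (fun x : ℝ => x ^ (a + 1) * (1 - x) ^ (b + 1))
      ((a + 1) * (x ^ a * (1 - x) ^ (b + 1)) - (b + 1) * (x ^ (a + 1) * (1 - x) ^ b)) x := by
    intro x _
    have h1 := hasDerivAt_pow (a + 1) x
    have h2 := ((hasDerivAt_id x).const_sub 1).pow (b + 1)
    refine (h1.mul h2).congr_deriv ?_
    simp only [id, Nat.add_sub_cancel, Pi.pow_apply]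
    push_cast
    ring
  have hi1 : IntervalIntegrable (fun x : ℝ => (a + 1 : ℝ) * (x ^ a * (1 - x) ^ (b + 1))) volume 0 1 :=
    Continuous.intervalIntegrable (by fun_prop) _ _
  have hi2 : IntervalIntegrable (fun x : ℝ => (b + 1 : ℝ) * (x ^ (a + 1) * (1 - x) ^ b)) volume 0 1 :=
    Continuous.intervalIntegrable (by fun_prop) _ _
  have h := intervalIntegral.integral_eq_sub_of_hasDerivAt hderiv (hi1.sub hi2)
  rw [intervalIntegral.integral_sub hi1 hi2, intervalIntegral.integral_const_mul,
    intervalIntegral.integral_const_mul] at h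
  simp only [one_pow, sub_self, ne_eq, Nat.add_eq_zero_iff, one_ne_zero, and_false,
    not_false_eq_true, zero_pow, mul_zero, zero_mul] at h
  linarith

lemma integral_beta (b : ℕ) : ∀ a : ℕ, ∫ x in (0 : ℝ)..1, x ^ a * (1 - x) ^ b =
    (a.factorial : ℝ) * b.factorial / (a + b + 1).factorial := by
  induction b with
  | zero =>
    intro a
    have : ((a + 1 : ℕ).factorial : ℝ) = (a + 1) * a.factorial := by
      rw [Nat.factorial_succ]; push_cast; ring
    have h0 : (a.factorial : ℝ) ≠ 0 := by positivity
    simp only [pow_zero, mul_one, integral_pow, one_pow, add_zero, this, Nat.factorial_zero,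
      Nat.cast_one]
    rw [zero_pow (by omega)]
    field_simp
    simp
  | succ b ih =>
    intro a
    have h := integral_beta_succ a b
    rw [ih (a + 1)] at h
    have e1 : a + 1 + b + 1 = a + (b + 1) + 1 := by omega
    rw [e1, Nat.factorial_succ a] at h
    rw [Nat.factorial_succ b]
    push_cast at h ⊢
    have ha : (a + 1 : ℝ) ≠ 0 := by positivity
    apply mul_left_cancel₀ ha
    rw [h]; ring

/-- The chord bound `max 1 (2 s) ^ ν ≤ 1 + (2 ^ ν - 1) (2 s - 1)⁺`, with the positive part
replaced by a quadratic polynomial. -/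
lemma max_rpow_le {ν : ℝ} (hν : 1 < ν) {s η : ℝ} (hs : s ≤ 1) (hη : 0 < η) :
    (max 1 (2 * s)) ^ ν ≤ 1 + (2 ^ ν - 1) * (η / 2 + (2 * s - 1) ^ 2 / (2 * η)) := by
  have h2 : 1 ≤ (2 : ℝ) ^ ν := Real.one_le_rpow (by norm_num) (by linarith)
  have hq : ∀ x : ℝ, x ≤ η / 2 + x ^ 2 / (2 * η) := by
    intro x
    have : η / 2 + x ^ 2 / (2 * η) - x = (x - η) ^ 2 / (2 * η) := by field_simp; ring
    have : 0 ≤ (x - η) ^ 2 / (2 * η) := by positivity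
    linarith
  rcases le_total (2 * s) 1 with h | h
  · rw [max_eq_left h, Real.one_rpow]
    have : 0 ≤ (2 ^ ν - 1) * (η / 2 + (2 * s - 1) ^ 2 / (2 * η)) :=
      mul_nonneg (by linarith) (by positivity)
    linarith
  · rw [max_eq_right h]
    have hc := convexOn_rpow hν.le
    have hconv := hc.2 (show (1 : ℝ) ∈ Set.Ici 0 by simp) (show (2 : ℝ) ∈ Set.Ici 0 by simp)
      (show 0 ≤ 2 - 2 * s by linarith) (show 0 ≤ 2 * s - 1 by linarith) (by ring)
    simp only [smul_eq_mul, Real.one_rpow, mul_one] at hconv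
    have e : 2 - 2 * s + (2 * s - 1) * 2 = 2 * s := by ring
    rw [e] at hconv
    have := mul_le_mul_of_nonneg_left (hq (2 * s - 1)) (show 0 ≤ (2 : ℝ) ^ ν - 1 by linarith)
    linarith

set_option maxHeartbeats 1000000 in
/-- For a beta distribution with mean near `1 / 2` the expectation of `max 1 (2 s) ^ ν` is
`1 + O(m ^ (-1 / 2))`. -/
lemma lintegral_beta_max_le {ν : ℝ} (hν : 1 < ν) {m l u : ℕ} (hm : l + u = m) (hl : 1 ≤ l) (hu : 1 ≤ u)
    (h1 : 2 * l ≤ m + 1) (h2 : m ≤ 2 * l + 1) :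
    ∫⁻ s in Set.Icc (0 : ℝ) 1, ENNReal.ofReal (s ^ l * (1 - s) ^ (u - 1) * (max 1 (2 * s)) ^ ν) ≤
      ENNReal.ofReal ((1 + 2 * 2 ^ ν / √m) / (u * m.choose l)) := by
  obtain ⟨v, rfl⟩ : ∃ v, u = v + 1 := ⟨u - 1, by omega⟩
  simp only [Nat.add_sub_cancel]
  have hm0 : (0 : ℝ) < m := by exact_mod_cast (by omega : 0 < m)
  have h2ν : 1 ≤ (2 : ℝ) ^ ν := Real.one_le_rpow (by norm_num) (by linarith)
  have hcont : Continuous fun s : ℝ => s ^ l * (1 - s) ^ v * (max 1 (2 * s)) ^ ν := by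
    refine Continuous.mul (by fun_prop) ?_
    exact Continuous.rpow_const (by fun_prop) fun s => Or.inl (by positivity)
  rw [← ofReal_integral_eq_lintegral_ofReal (hcont.integrableOn_Icc)
    (by
      rw [Filter.EventuallyLE, ae_restrict_iff' measurableSet_Icc]
      refine Filter.Eventually.of_forall fun s hs => ?_
      have := sub_nonneg.2 hs.2
      have := hs.1
      simp only [Pi.zero_apply]
      positivity),
    integral_Icc_eq_integral_Ioc, ← intervalIntegral.integral_of_le zero_le_one]
  refine ENNReal.ofReal_le_ofReal ?_
  set η : ℝ := 1 / √m with hη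
  have hη0 : 0 < η := by positivity
  have hle : ∫ s in (0 : ℝ)..1, s ^ l * (1 - s) ^ v * (max 1 (2 * s)) ^ ν ≤
      ∫ s in (0 : ℝ)..1, ((1 + (2 ^ ν - 1) * (η / 2 + 1 / (2 * η))) * (s ^ l * (1 - s) ^ v) -
        (2 ^ ν - 1) * (2 / η) * (s ^ (l + 1) * (1 - s) ^ v) +
        (2 ^ ν - 1) * (2 / η) * (s ^ (l + 2) * (1 - s) ^ v)) := by
    refine intervalIntegral.integral_mono_on zero_le_one (hcont.intervalIntegrable _ _)
      (Continuous.intervalIntegrable (by fun_prop) _ _) fun s hs => ?_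
    have a1 : 0 ≤ s ^ l * (1 - s) ^ v :=
      mul_nonneg (pow_nonneg hs.1 _) (pow_nonneg (sub_nonneg.2 hs.2) _)
    refine (mul_le_mul_of_nonneg_left (max_rpow_le hν hs.2 hη0) a1).trans (le_of_eq ?_)
    field_simp
    ring
  refine hle.trans ?_
  have c1 : ∀ (a b : ℝ) (k : ℕ), IntervalIntegrable (fun s : ℝ => a * (s ^ k * (1 - s) ^ v))
    volume 0 1 := fun a b k => Continuous.intervalIntegrable (by fun_prop) _ _
  rw [intervalIntegral.integral_add ((c1 _ 0 _).sub (c1 _ 0 _)) (c1 _ 0 _),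
    intervalIntegral.integral_sub (c1 _ 0 _) (c1 _ 0 _), intervalIntegral.integral_const_mul,
    intervalIntegral.integral_const_mul, intervalIntegral.integral_const_mul,
    integral_beta, integral_beta, integral_beta]
  have hchoose : ((v + 1 : ℕ) * m.choose l : ℝ) = (m.factorial : ℝ) / (l.factorial * v.factorial) := by
    have := Nat.choose_mul_factorial_mul_factorial (show l ≤ m by omega)
    rw [show m - l = v + 1 by omega, Nat.factorial_succ v] at this
    rw [eq_div_iff (by positivity), ← this]
    push_cast; ring
  rw [hchoose, show l + v + 1 = m by omega, show l + 1 + v + 1 = m + 1 by omega,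
    show l + 2 + v + 1 = m + 2 by omega]
  have f1 : ((l + 1).factorial : ℝ) = (l + 1) * l.factorial := by
    rw [Nat.factorial_succ]; push_cast; ring
  have f2 : ((l + 2).factorial : ℝ) = (l + 2) * ((l + 1) * l.factorial) := by
    rw [Nat.factorial_succ, Nat.factorial_succ]; push_cast; ring
  have f3 : ((m + 1).factorial : ℝ) = (m + 1) * m.factorial := by
    rw [Nat.factorial_succ]; push_cast; ring
  have f4 : ((m + 2).factorial : ℝ) = (m + 2) * ((m + 1) * m.factorial) := by
    rw [Nat.factorial_succ, Nat.factorial_succ]; push_cast; ring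
  rw [f1, f2, f3, f4]
  set B : ℝ := l.factorial * v.factorial / m.factorial with hB
  have hB0 : 0 ≤ B := by positivity
  have e1 : (1 + 2 * 2 ^ ν / √m) / ((m.factorial : ℝ) / (l.factorial * v.factorial)) =
      B * (1 + 2 * 2 ^ ν / √m) := by
    rw [hB]; field_simp
  -- `Q` is four times the variance-like quantity `E (s - 1 / 2) ^ 2`
  set Q : ℝ := 1 - 4 * ((l + 1) / (m + 1)) + 4 * ((l + 2) * (l + 1) / ((m + 2) * (m + 1))) with hQ
  have e2 : (1 + (2 ^ ν - 1) * (η / 2 + 1 / (2 * η))) * (l.factorial * v.factorial / m.factorial) -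
      (2 ^ ν - 1) * (2 / η) * ((l + 1) * l.factorial * v.factorial / ((m + 1) * m.factorial)) +
      (2 ^ ν - 1) * (2 / η) *
        ((l + 2) * ((l + 1) * l.factorial) * v.factorial / ((m + 2) * ((m + 1) * m.factorial))) =
      B * (1 + (2 ^ ν - 1) * (η / 2 + Q / (2 * η))) := by
    rw [hB, hQ]; field_simp; ring
  rw [e1, e2]
  refine mul_le_mul_of_nonneg_left ?_ hB0
  have hl' : (2 * l : ℝ) ≤ m + 1 := by exact_mod_cast h1
  have hl'' : (m : ℝ) ≤ 2 * l + 1 := by exact_mod_cast h2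
  have hm2 : (2 : ℝ) ≤ m := by exact_mod_cast (by omega : 2 ≤ m)
  have hQle : Q ≤ 3 / m := by
    have : Q = ((m + 1) * (m + 2) - 4 * (l + 1) * (m + 2) + 4 * (l + 2) * (l + 1)) /
        ((m + 2) * (m + 1)) := by rw [hQ]; field_simp
    rw [this, div_le_div_iff₀ (by positivity) hm0]
    have h3 : (2 * l - m : ℝ) ^ 2 ≤ 1 := by
      rw [sq_le_one_iff_abs_le_one, abs_le]; constructor <;> linarith
    nlinarith
  have hη2 : η * η = 1 / m := by
    rw [hη, div_mul_div_comm, Real.mul_self_sqrt hm0.le, one_mul]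
  have h4 : Q / (2 * η) ≤ 3 / 2 * η := by
    rw [div_le_iff₀ (by positivity)]
    calc Q ≤ 3 / m := hQle
      _ = 3 * (η * η) := by rw [hη2]; ring
      _ = _ := by ring
  have h5 : (2 ^ ν - 1) * (η / 2 + Q / (2 * η)) ≤ 2 ^ ν * (2 * η) :=
    mul_le_mul (by linarith) (by linarith) (by
      have : 0 ≤ Q := by
        have : Q = ((m + 1) * (m + 2) - 4 * (l + 1) * (m + 2) + 4 * (l + 2) * (l + 1)) /
          ((m + 2) * (m + 1)) := by rw [hQ]; field_simp
        rw [this]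
        refine div_nonneg ?_ (by positivity)
        nlinarith [sq_nonneg (2 * l - m : ℝ)]
      positivity) (by positivity)
  have h6 : 2 * 2 ^ ν / √m = 2 ^ ν * (2 * η) := by rw [hη]; ring
  rw [h6]; linarith

end Beta

/-! ### Conditioning on the boundary of a half -/

section Split

variable {n : ℕ} {E : Type*} [MeasurableSpace E]

open Classical in
lemma lmarginal_ite_mem (μ : Measure E) [SigmaFinite μ] {A : Set E} (hA : MeasurableSet A)
    (S : Finset (Fin n)) (f : (Fin n → E) → ℝ≥0∞) (W : Fin n → E) :
    (∫⋯∫⁻_S, (fun V => if ∀ x ∈ S, V x ∈ A then f V else 0) ∂fun _ => μ) W =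
      (∫⋯∫⁻_S, f ∂fun _ => μ.restrict A) W := by
  unfold lmarginal
  rw [← Measure.restrict_pi_pi (fun _ : S => μ) (fun _ => A),
    ← lintegral_indicator (MeasurableSet.univ_pi fun _ => hA)]
  refine lintegral_congr fun y => ?_
  have : (∀ x ∈ S, Function.updateFinset W S y x ∈ A) ↔ y ∈ Set.univ.pi fun _ : S => A := by
    simp only [Set.mem_univ_pi, Subtype.forall]
    refine forall₂_congr fun x hx => ?_
    simp [Function.updateFinset, hx]
  beta_reduce
  by_cases h : y ∈ Set.univ.pi fun _ : S => A
  · rw [if_pos (this.2 h), Set.indicator_of_mem h]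
  · rw [if_neg (mt this.1 h), Set.indicator_of_notMem h]

lemma lmarginal_const_eq (μ : Measure E) [SigmaFinite μ] (S : Finset (Fin n)) (c : ℝ≥0∞)
    (W : Fin n → E) : (∫⋯∫⁻_S, (fun _ => c) ∂fun _ => μ) W = c * μ Set.univ ^ #S := by
  simp [lmarginal, Measure.pi_univ]

end Split

section MinOn

variable {n : ℕ} {E : Type*}

/-- The smallest value of `r` on the nodes of `S`, or `0` if there are none. -/
noncomputable def minOn (r : E → ℝ) (S : Finset (Fin n)) (V : Fin n → E) : ℝ :=
  if h : S.Nonempty then S.inf' h fun x => r (V x) else 0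

lemma minOn_le (r : E → ℝ) {S : Finset (Fin n)} {x : Fin n} (hx : x ∈ S) (V : Fin n → E) :
    minOn r S V ≤ r (V x) := by
  rw [minOn, dif_pos ⟨x, hx⟩]; exact inf'_le _ hx

lemma exists_minOn_eq (r : E → ℝ) {S : Finset (Fin n)} (hS : S.Nonempty) (V : Fin n → E) :
    ∃ x ∈ S, minOn r S V = r (V x) := by
  rw [minOn, dif_pos hS]; exact exists_mem_eq_inf' hS _

lemma measurable_minOn {α : Type*} [MeasurableSpace α] {r : α → E → ℝ} {V : α → Fin n → E}
    (h : ∀ x, Measurable fun a => r a (V a x)) (S : Finset (Fin n)) :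
    Measurable fun a => minOn (r a) S (V a) := by
  unfold minOn
  by_cases hS : S.Nonempty
  · simp only [hS, dif_pos]
    have e : (fun a => S.inf' hS fun x => r a (V a x)) = S.inf' hS fun x a => r a (V a x) := by
      funext a; simp [Finset.inf'_apply]
    rw [e]
    refine Finset.inf'_induction (p := fun g : α → ℝ => Measurable g) hS _
      (fun _ hf _ hg => hf.inf hg) fun x _ => h x
  · simp only [hS, dif_neg, not_false_eq_true, measurable_const]

end MinOn

section SplitBound

variable {n : ℕ} {E : Type*} [MeasurableSpace E]

open Classical in
/-- Integration over the configurations in which the nodes of `M` rank below those of `M'`: the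
nodes of `M` are then independent below the lowest rank in `M'`. -/
lemma lmarginal_split_le (μ : Measure E) [SigmaFinite μ] {r : E → ℝ} (hr : Measurable r)
    {M M' : Finset (Fin n)} (hdis : Disjoint M' M) (hne : M'.Nonempty)
    {f : ℝ → (Fin n → E) → ℝ≥0∞} (hf : Measurable (Function.uncurry f)) {φ : ℝ → ℝ≥0∞}
    (hφ : Measurable φ)
    (H : ∀ t W, (∫⋯∫⁻_M, f t ∂fun _ => μ.restrict {a | r a ≤ t}) W ≤ φ t) (W : Fin n → E) :
    (∫⋯∫⁻_(M' ∪ M), (fun V => if ∀ x ∈ M, ∀ y ∈ M', r (V x) ≤ r (V y) then f (minOn r M' V) V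
      else 0) ∂fun _ => μ) W ≤
      #M' * ∫⁻ a, φ (r a) * μ {b | r a ≤ r b} ^ (#M' - 1) ∂μ := by
  have hrx : ∀ x : Fin n, Measurable fun V : Fin n → E => r (V x) := fun x =>
    hr.comp (measurable_pi_apply x)
  have hmin : Measurable fun V : Fin n → E => minOn r M' V :=
    measurable_minOn (r := fun _ => r) (V := fun V => V) hrx M'
  have hg : Measurable fun V : Fin n → E =>
      if ∀ x ∈ M, ∀ y ∈ M', r (V x) ≤ r (V y) then f (minOn r M' V) V else 0 := by
    refine Measurable.ite ?_ (hf.comp (hmin.prodMk measurable_id)) measurable_const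
    refine measurableSet_setOfPred.2 ?_
    refine Measurable.forall fun x => Measurable.forall fun _ => Measurable.forall fun y =>
      Measurable.forall fun _ => ?_
    exact measurableSet_setOfPred.1 (measurableSet_le (hrx x) (hrx y))
  rw [lmarginal_union _ _ hg hdis]
  have inner : (∫⋯∫⁻_M, (fun V => if ∀ x ∈ M, ∀ y ∈ M', r (V x) ≤ r (V y) then f (minOn r M' V) V
      else 0) ∂fun _ => μ) ≤ fun V => φ (minOn r M' V) := by
    intro W
    refine le_trans (le_of_eq ?_) (H (minOn r M' W) W)
    rw [← lmarginal_ite_mem μ (measurableSet_le hr measurable_const)]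
    unfold lmarginal
    refine lintegral_congr fun y => ?_
    have hup : ∀ x ∈ M', Function.updateFinset W M y x = W x := by
      intro x hx
      have : x ∉ M := disjoint_left.1 hdis hx
      simp [Function.updateFinset, this]
    have hm : minOn r M' (Function.updateFinset W M y) = minOn r M' W := by
      simp only [minOn, hne, dif_pos]
      exact inf'_congr _ rfl fun x hx => by rw [hup x hx]
    beta_reduce
    rw [hm]
    refine if_congr (forall₂_congr fun x _ => ?_) rfl rfl
    constructor
    · intro h
      obtain ⟨z, hz, hz'⟩ := exists_minOn_eq r hne W
      have := h z hz
      rw [hup z hz] at this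
      exact this.trans hz'.ge
    · intro h y' hy'
      rw [hup y' hy']
      exact le_trans h (minOn_le r hy' W)
  refine (lmarginal_mono inner W).trans ?_
  have outer : (fun V => φ (minOn r M' V)) ≤ fun V => ∑ x ∈ M',
      if ∀ y ∈ M'.erase x, V y ∈ {b | r (V x) ≤ r b} then φ (r (V x)) else 0 := by
    intro V
    obtain ⟨x, hx, hx'⟩ := exists_minOn_eq r hne V
    refine le_trans ?_ (single_le_sum (f := fun x =>
      if ∀ y ∈ M'.erase x, V y ∈ {b | r (V x) ≤ r b} then φ (r (V x)) else 0)
      (fun _ _ => zero_le) hx)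
    simp only
    rw [if_pos, hx']
    intro y hy
    change r (V x) ≤ r (V y)
    rw [← hx']; exact minOn_le r (mem_of_mem_erase hy) V
  refine (lmarginal_mono outer W).trans ?_
  have hterm : ∀ x, Measurable fun V : Fin n → E =>
      if ∀ y ∈ M'.erase x, V y ∈ {b | r (V x) ≤ r b} then φ (r (V x)) else 0 := by
    intro x
    refine Measurable.ite ?_ (hφ.comp (hrx x)) measurable_const
    refine measurableSet_setOfPred.2 (Measurable.forall fun y => Measurable.forall fun _ => ?_)
    exact measurableSet_setOfPred.1 (measurableSet_le (hrx x) (hrx y))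
  have hsum : (∫⋯∫⁻_M', (fun V => ∑ x ∈ M',
      if ∀ y ∈ M'.erase x, V y ∈ {b | r (V x) ≤ r b} then φ (r (V x)) else 0) ∂fun _ => μ) W =
      ∑ x ∈ M', (∫⋯∫⁻_M', (fun V =>
        if ∀ y ∈ M'.erase x, V y ∈ {b | r (V x) ≤ r b} then φ (r (V x)) else 0) ∂fun _ => μ) W := by
    unfold lmarginal
    rw [lintegral_finsetSum]
    intro x _
    exact (hterm x).comp measurable_updateFinset
  rw [hsum, ← nsmul_eq_mul]
  refine sum_le_card_nsmul _ _ _ fun x hx => ?_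
  rw [lmarginal_erase (X := fun _ => E) (μ := fun _ => μ) _ (hterm x) hx]
  refine lintegral_mono fun a => le_of_eq ?_
  have hset : MeasurableSet {b | r a ≤ r b} := measurableSet_le measurable_const hr
  have e := lmarginal_ite_mem μ hset (M'.erase x) (fun _ => φ (r a)) (Function.update W x a)
  rw [lmarginal_const_eq, Measure.restrict_apply_univ, card_erase_of_mem hx] at e
  rw [← e]
  unfold lmarginal
  refine lintegral_congr fun y => ?_
  have : Function.updateFinset (Function.update W x a) (M'.erase x) y x = a := by
    simp [Function.updateFinset]
  simp only [this]

end SplitBound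

/-! ### Boxes and their subdivision -/

section Boxes

variable {d n : ℕ}

/-- A box `∏ [lo c, hi c]`, given as `(lo, hi, t)` together with a bound `t` on its extents. -/
abbrev BoxState (d : ℕ) := (Fin d → ℝ) × (Fin d → ℝ) × ℝ

/-- The extent of a box in coordinate `c`. -/
def extent (B : BoxState d) (c : Fin d) : ℝ := B.2.1 c - B.1 c

/-- The set of points of a box. -/
def BoxState.toSet (B : BoxState d) : Set (EuclideanSpace ℝ (Fin d)) := box B.1 B.2.1

/-- The relative position of a point in coordinate `c`, measured from the lower face of the box, or
from the upper face if `up` is true. -/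
noncomputable def rank (up : Bool) (c : Fin d) (B : BoxState d) (x : EuclideanSpace ℝ (Fin d)) : ℝ :=
  if up then (B.2.1 c - x c) / extent B c else (x c - B.1 c) / extent B c

/-- The part of a box consisting of the points of rank at most `s`.  The bound on the extents is
updated by the factor `2 ^ (-1 / d) * max 1 (2 * s)`, see `FitsBound.child`. -/
noncomputable def child (up : Bool) (c : Fin d) (s : ℝ) (B : BoxState d) : BoxState d :=
  (if up then Function.update B.1 c (B.2.1 c - s * extent B c) else B.1,
    if up then B.2.1 else Function.update B.2.1 c (B.1 c + s * extent B c),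
    2 ^ (-(1 / (d : ℝ))) * max 1 (2 * s) * B.2.2)

lemma extent_child (up : Bool) (c : Fin d) (s : ℝ) (B : BoxState d) (c' : Fin d) :
    extent (child up c s B) c' = if c' = c then s * extent B c else extent B c' := by
  rcases eq_or_ne c' c with rfl | h
  · cases up <;> simp [child, extent]
  · cases up <;> simp [child, extent, h]

lemma toSet_child (up : Bool) (c : Fin d) {s : ℝ} (hs : s ≤ 1) {B : BoxState d}
    (hc : 0 < extent B c) : (child up c s B).toSet = {x | rank up c B x ≤ s} ∩ B.toSet := by
  have hse : s * extent B c ≤ extent B c := by nlinarith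
  have hdef : extent B c = B.2.1 c - B.1 c := rfl
  ext x
  cases up
  · have hr : rank false c B x ≤ s ↔ x c ≤ B.1 c + s * extent B c := by
      simp only [rank, Bool.false_eq_true, if_false]
      rw [div_le_iff₀ hc]; constructor <;> intro h <;> linarith
    change (∀ c', _) ↔ rank false c B x ≤ s ∧ ∀ c', _
    rw [hr]
    simp only [child, Bool.false_eq_true, if_false, Set.mem_Icc]
    constructor
    · intro h
      refine ⟨by simpa using (h c).2, fun c' => ⟨(h c').1, ?_⟩⟩
      rcases eq_or_ne c' c with rfl | hne
      · have := (h c').2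
        simp only [Function.update_self] at this
        linarith
      · simpa [hne] using (h c').2
    · rintro ⟨h1, h⟩ c'
      refine ⟨(h c').1, ?_⟩
      rcases eq_or_ne c' c with rfl | hne
      · simpa using h1
      · simpa [hne] using (h c').2
  · have hr : rank true c B x ≤ s ↔ B.2.1 c - s * extent B c ≤ x c := by
      simp only [rank, if_true]
      rw [div_le_iff₀ hc]; constructor <;> intro h <;> linarith
    change (∀ c', _) ↔ rank true c B x ≤ s ∧ ∀ c', _
    rw [hr]
    simp only [child, if_true, Set.mem_Icc]
    constructor
    · intro h
      refine ⟨by simpa using (h c).1, fun c' => ⟨?_, (h c').2⟩⟩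
      rcases eq_or_ne c' c with rfl | hne
      · have := (h c').1
        simp only [Function.update_self] at this
        linarith
      · simpa [hne] using (h c').1
    · rintro ⟨h1, h⟩ c'
      refine ⟨?_, (h c').2⟩
      rcases eq_or_ne c' c with rfl | hne
      · simpa using h1
      · simpa [hne] using (h c').1

lemma volume_toSet (B : BoxState d) : volume B.toSet = ∏ c, ENNReal.ofReal (extent B c) :=
  volume_box _ _

lemma measurableSet_toSet (B : BoxState d) : MeasurableSet B.toSet := measurableSet_box _ _

lemma volume_toSet_ne_top (B : BoxState d) : volume B.toSet ≠ ⊤ := by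
  rw [volume_toSet]
  exact ENNReal.prod_ne_top fun c _ => ENNReal.ofReal_ne_top

lemma volume_toSet_child (up : Bool) (c : Fin d) {s : ℝ} (hs : 0 ≤ s) (B : BoxState d) :
    volume (child up c s B).toSet = ENNReal.ofReal s * volume B.toSet := by
  rw [volume_toSet, volume_toSet, ← mul_prod_erase _ _ (mem_univ c),
    ← mul_prod_erase univ (fun c => ENNReal.ofReal (extent B c)) (mem_univ c), extent_child,
    if_pos rfl, ENNReal.ofReal_mul hs, mul_assoc]
  congr 2
  refine prod_congr rfl fun c' hc' => ?_
  rw [extent_child, if_neg (mem_erase.1 hc').1]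

lemma measurable_rank (up : Bool) (c : Fin d) (B : BoxState d) : Measurable (rank up c B) := by
  unfold rank
  cases up
  · simp only [Bool.false_eq_true, if_false]; fun_prop
  · simp only [if_true]; fun_prop

lemma rank_nonneg (up : Bool) (c : Fin d) {B : BoxState d} (hc : 0 < extent B c)
    {x : EuclideanSpace ℝ (Fin d)} (hx : x ∈ B.toSet) : 0 ≤ rank up c B x := by
  have h := hx c
  unfold rank
  split_ifs
  · exact div_nonneg (sub_nonneg.2 h.2) hc.le
  · exact div_nonneg (sub_nonneg.2 h.1) hc.le

lemma rank_le_one (up : Bool) (c : Fin d) {B : BoxState d} (hc : 0 < extent B c)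
    {x : EuclideanSpace ℝ (Fin d)} (hx : x ∈ B.toSet) : rank up c B x ≤ 1 := by
  have h := hx c
  unfold rank
  split_ifs
  · rw [div_le_one hc]; unfold extent; linarith [h.1]
  · rw [div_le_one hc]; unfold extent; linarith [h.2]

/-- The rank of a uniform point of a box is uniform in `[0, 1]`. -/
lemma map_rank (up : Bool) (c : Fin d) {B : BoxState d} (hc : 0 < extent B c) :
    (volume.restrict B.toSet).map (rank up c B) =
      volume B.toSet • (volume.restrict (Set.Icc (0 : ℝ) 1)) := by
  have : IsFiniteMeasure (volume.restrict B.toSet) :=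
    ⟨by rw [Measure.restrict_apply_univ]; exact (volume_toSet_ne_top B).lt_top⟩
  have hfin : IsFiniteMeasure ((volume.restrict B.toSet).map (rank up c B)) := by infer_instance
  refine Measure.ext_of_Iic _ _ fun a => ?_
  rw [Measure.map_apply (measurable_rank up c B) measurableSet_Iic,
    Measure.restrict_apply (measurable_rank up c B measurableSet_Iic), Measure.smul_apply,
    Measure.restrict_apply measurableSet_Iic, smul_eq_mul]
  have hpre : rank up c B ⁻¹' Set.Iic a = {x | rank up c B x ≤ a} := rfl
  rcases lt_or_ge a 0 with h0 | h0
  · have e1 : rank up c B ⁻¹' Set.Iic a ∩ B.toSet = ∅ := by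
      ext x; simp only [Set.mem_inter_iff, Set.mem_preimage, Set.mem_Iic, Set.mem_empty_iff_false,
        iff_false, not_and]
      intro h hx
      linarith [rank_nonneg up c hc hx]
    have e2 : Set.Iic a ∩ Set.Icc (0 : ℝ) 1 = ∅ := by
      ext x; simp only [Set.mem_inter_iff, Set.mem_Iic, Set.mem_Icc, Set.mem_empty_iff_false,
        iff_false]
      rintro ⟨h1, h2, -⟩; linarith
    simp [e1, e2]
  · rcases le_or_gt a 1 with h1 | h1
    · have e2 : Set.Iic a ∩ Set.Icc (0 : ℝ) 1 = Set.Icc 0 a := by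
        ext x; simp only [Set.mem_inter_iff, Set.mem_Iic, Set.mem_Icc]
        constructor
        · rintro ⟨h1, h2, -⟩; exact ⟨h2, h1⟩
        · rintro ⟨h2, h3⟩; exact ⟨h3, h2, h3.trans h1⟩
      rw [hpre, ← toSet_child up c h1 hc, volume_toSet_child up c h0, e2, Real.volume_Icc, sub_zero,
        mul_comm]
    · have e1 : rank up c B ⁻¹' Set.Iic a ∩ B.toSet = B.toSet := by
        refine Set.inter_eq_right.2 fun x hx => ?_
        exact (rank_le_one up c hc hx).trans h1.le
      have e2 : Set.Iic a ∩ Set.Icc (0 : ℝ) 1 = Set.Icc 0 1 :=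
        Set.inter_eq_right.2 fun x hx => hx.2.trans h1.le
      rw [e1, e2, Real.volume_Icc]; simp

lemma volume_rank_ge_le (up : Bool) (c : Fin d) {B : BoxState d} (hc : 0 < extent B c) (s : ℝ) :
    volume.restrict B.toSet {x | s ≤ rank up c B x} ≤ volume B.toSet * ENNReal.ofReal (1 - s) := by
  have h : volume.restrict B.toSet {x | s ≤ rank up c B x} =
      (volume.restrict B.toSet).map (rank up c B) (Set.Ici s) := by
    rw [Measure.map_apply (measurable_rank up c B) measurableSet_Ici]; rfl
  rw [h, map_rank up c hc, Measure.smul_apply, smul_eq_mul, Measure.restrict_apply measurableSet_Ici]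
  gcongr
  rw [← Real.volume_Icc]
  exact measure_mono fun x hx => ⟨hx.1, hx.2.2⟩

/-- The number of coordinates in which the extent of the box is tied with another one. -/
noncomputable def tieCount (B : BoxState d) : ℕ :=
  #(univ.filter fun c' => ∃ c'', c'' ≠ c' ∧ extent B c' = extent B c'')

/-- The number of tied coordinates left when coordinate `c` is removed. -/
noncomputable def tieCountErase (B : BoxState d) (c : Fin d) : ℕ :=
  #(univ.filter fun c' => c' ≠ c ∧ ∃ c'', c'' ≠ c' ∧ c'' ≠ c ∧ extent B c' = extent B c'')

lemma tieCount_child_le (up : Bool) (c : Fin d) {s : ℝ} {B : BoxState d}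
    (hs : ∀ c', c' ≠ c → s * extent B c ≠ extent B c') :
    tieCount (child up c s B) ≤ tieCountErase B c := by
  refine card_le_card fun c' hc' => ?_
  obtain ⟨-, c'', hne, he⟩ := mem_filter.1 hc'
  refine mem_filter.2 ⟨mem_univ _, ?_⟩
  rw [extent_child, extent_child] at he
  by_cases h1 : c' = c
  · subst h1
    rw [if_pos rfl, if_neg hne] at he
    exact absurd he (hs _ hne)
  · by_cases h2 : c'' = c
    · subst h2
      rw [if_pos rfl, if_neg h1] at he
      exact absurd he.symm (hs _ h1)
    · rw [if_neg h1, if_neg h2] at he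
      exact ⟨h1, c'', hne, h2, he⟩

/-- Whichever of the longest coordinates is cut, the ties lost pay for the number of choices. -/
lemma sum_pow_tieCountErase_le (hd : 1 ≤ d) (B : BoxState d) :
    ∑ c ∈ univ.filter (fun c => ∀ c', extent B c' ≤ extent B c), (d : ℝ≥0∞) ^ tieCountErase B c ≤
      (d : ℝ≥0∞) ^ tieCount B := by
  have hd1 : (1 : ℝ≥0∞) ≤ d := by exact_mod_cast hd
  set Lg := univ.filter (fun c => ∀ c', extent B c' ≤ extent B c) with hLg
  have hsub : ∀ c, (univ.filter fun c' => c' ≠ c ∧ ∃ c'', c'' ≠ c' ∧ c'' ≠ c ∧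
      extent B c' = extent B c'') ⊆
      (univ.filter fun c' => ∃ c'', c'' ≠ c' ∧ extent B c' = extent B c'').erase c := by
    intro c c' hc'
    obtain ⟨-, h1, c'', h2, -, h3⟩ := mem_filter.1 hc'
    exact mem_erase.2 ⟨h1, mem_filter.2 ⟨mem_univ _, c'', h2, h3⟩⟩
  by_cases hcard : #Lg ≤ 1
  · rcases Lg.eq_empty_or_nonempty with h | ⟨c, hc⟩
    · simp [h]
    · have : Lg = {c} := eq_singleton_iff_unique_mem.2 ⟨hc, fun x hx => card_le_one.1 hcard x hx c hc⟩
      rw [this, sum_singleton]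
      exact pow_le_pow_right₀ hd1 (card_le_card ((hsub c).trans (erase_subset _ _)))
  · have hlt : ∀ c ∈ Lg, tieCountErase B c + 1 ≤ tieCount B := by
      intro c hc
      obtain ⟨c', hc', hne⟩ := exists_mem_ne (not_le.1 hcard) c
      have hmem : c ∈ univ.filter fun c' => ∃ c'', c'' ≠ c' ∧ extent B c' = extent B c'' := by
        refine mem_filter.2 ⟨mem_univ _, c', hne, ?_⟩
        exact le_antisymm ((mem_filter.1 hc').2 c) ((mem_filter.1 hc).2 c')
      have h1 := card_le_card (hsub c)
      rw [card_erase_of_mem hmem] at h1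
      have h2 := card_pos.2 ⟨c, hmem⟩
      unfold tieCountErase tieCount
      omega
    obtain ⟨c, hc⟩ := card_pos.1 (show 0 < #Lg by omega)
    have ht := hlt c hc
    calc ∑ c ∈ Lg, (d : ℝ≥0∞) ^ tieCountErase B c ≤ ∑ c ∈ Lg, (d : ℝ≥0∞) ^ (tieCount B - 1) :=
          sum_le_sum fun c hc => pow_le_pow_right₀ hd1 (by have := hlt c hc; omega)
      _ = #Lg * (d : ℝ≥0∞) ^ (tieCount B - 1) := by rw [sum_const, nsmul_eq_mul]
      _ ≤ d * (d : ℝ≥0∞) ^ (tieCount B - 1) := by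
          gcongr
          have := card_le_univ Lg
          rwa [Fintype.card_fin] at this
      _ = (d : ℝ≥0∞) ^ tieCount B := by
          rw [← pow_succ', Nat.sub_add_cancel (by omega)]

end Boxes

/-! ### Sums over the regions of a level -/

section LevelSum

variable {d n : ℕ}

/-- The number of nodes in the lower or upper half of `m` nodes. -/
def halfCard (up : Bool) (m : ℕ) : ℕ := if up then m - m / 2 else m / 2

/-- The least relative position of a node of `S` in the box. If `S` are the nodes of the half that is
split off, the box of the remaining half extends up to there. -/
noncomputable def cut (up : Bool) (c : Fin d) (S : Finset (Fin n)) (B : BoxState d)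
    (V : Fin n → EuclideanSpace ℝ (Fin d)) : ℝ := minOn (rank up c B) S V

open Classical in
/-- The sum of `f` over the regions that arise from the nodes `S` and the box `B` by `j` bisections.
Instead of a maximum over the choice of the coordinate, the sum over all longest coordinates is
taken.  The sum over `M` runs over all possible halves; almost surely one of them is the actual
one. -/
noncomputable def levelSum (f : Finset (Fin n) → BoxState d → (Fin n → EuclideanSpace ℝ (Fin d)) → ℝ≥0∞) :
    ℕ → Finset (Fin n) → BoxState d → (Fin n → EuclideanSpace ℝ (Fin d)) → ℝ≥0∞
  | 0, S, B, V => f S B V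
  | j + 1, S, B, V => if 2 ≤ #S then
      ∑ c, if ∀ c', extent B c' ≤ extent B c then
        ∑ up : Bool, ∑ M ∈ S.powersetCard (halfCard up #S),
          if ∀ x ∈ M, ∀ y ∈ S \ M, rank up c B (V x) ≤ rank up c B (V y) then
            levelSum f j M (child up c (cut up c (S \ M) B V) B) V else 0
      else 0
    else 0

lemma measurable_extent (c : Fin d) : Measurable fun B : BoxState d => extent B c := by
  unfold extent; fun_prop

lemma measurable_rank_prod (up : Bool) (c : Fin d) (x : Fin n) :
    Measurable fun q : BoxState d × (Fin n → EuclideanSpace ℝ (Fin d)) => rank up c q.1 (q.2 x) := by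
  unfold rank extent
  cases up
  · simp only [Bool.false_eq_true, if_false]; fun_prop
  · simp only [if_true]; fun_prop

lemma measurable_child (up : Bool) (c : Fin d) {α : Type*} [MeasurableSpace α] {s : α → ℝ}
    {B : α → BoxState d} (hs : Measurable s) (hB : Measurable B) :
    Measurable fun a => child up c (s a) (B a) := by
  have hext : Measurable fun a => extent (B a) c := (measurable_extent c).comp hB
  have h1 : ∀ c', Measurable fun a => (B a).1 c' := fun c' => by fun_prop
  have h2 : ∀ c', Measurable fun a => (B a).2.1 c' := fun c' => by fun_prop
  have hupd : ∀ {g : α → Fin d → ℝ} {v : α → ℝ}, Measurable g → Measurable v →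
      Measurable fun a => Function.update (g a) c (v a) := by
    intro g v hg hv
    refine measurable_pi_iff.2 fun c' => ?_
    rcases eq_or_ne c' c with rfl | hne
    · simpa using hv
    · simp only [Function.update_of_ne hne]
      exact (measurable_pi_apply c').comp hg
  unfold child
  refine Measurable.prodMk ?_ (Measurable.prodMk ?_ ?_)
  · cases up
    · simpa using by fun_prop
    · simpa using hupd (by fun_prop) ((h2 c).sub (hs.mul hext))
  · cases up
    · simpa using hupd (by fun_prop) ((h1 c).add (hs.mul hext))
    · simpa using by fun_prop
  · fun_prop

lemma measurable_cut (up : Bool) (c : Fin d) (S : Finset (Fin n)) :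
    Measurable fun q : BoxState d × (Fin n → EuclideanSpace ℝ (Fin d)) => cut up c S q.1 q.2 :=
  measurable_minOn (r := fun q : BoxState d × (Fin n → EuclideanSpace ℝ (Fin d)) => rank up c q.1)
    (V := fun q => q.2) (fun x => measurable_rank_prod up c x) S

lemma measurable_levelSum
    {f : Finset (Fin n) → BoxState d → (Fin n → EuclideanSpace ℝ (Fin d)) → ℝ≥0∞}
    (hf : ∀ S, Measurable fun q : BoxState d × (Fin n → EuclideanSpace ℝ (Fin d)) => f S q.1 q.2) :
    ∀ j S, Measurable fun q : BoxState d × (Fin n → EuclideanSpace ℝ (Fin d)) =>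
      levelSum f j S q.1 q.2 := by
  intro j
  induction j with
  | zero => exact hf
  | succ j ih =>
    intro S
    simp only [levelSum]
    by_cases hS : 2 ≤ #S
    · simp only [hS, if_true]
      refine Finset.measurable_sum _ fun c _ => Measurable.ite ?_ ?_ measurable_const
      · refine measurableSet_setOfPred.2 (Measurable.forall fun c' => ?_)
        exact measurableSet_setOfPred.1 (measurableSet_le ((measurable_extent c').comp measurable_fst)
          ((measurable_extent c).comp measurable_fst))
      · refine Finset.measurable_sum _ fun up _ => Finset.measurable_sum _ fun M _ =>
          Measurable.ite ?_ ?_ measurable_const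
        · refine measurableSet_setOfPred.2 (Measurable.forall fun x => Measurable.forall fun _ =>
            Measurable.forall fun y => Measurable.forall fun _ => ?_)
          exact measurableSet_setOfPred.1 (measurableSet_le (measurable_rank_prod up c x)
            (measurable_rank_prod up c y))
        · exact (ih M).comp ((measurable_child up c (measurable_cut up c (S \ M))
            measurable_fst).prodMk measurable_snd)
    · simp only [hS, if_false, measurable_const]

lemma measurable_of_prod {g : BoxState d → (Fin n → EuclideanSpace ℝ (Fin d)) → ℝ≥0∞}
    (hg : Measurable fun q : BoxState d × (Fin n → EuclideanSpace ℝ (Fin d)) => g q.1 q.2)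
    (B : BoxState d) : Measurable (g B) := hg.comp (measurable_const.prodMk measurable_id)

open Classical in
/-- The induction step for a single half: conditionally on its box, the nodes of a half are
independent and uniform, and its relative extent has a beta distribution. -/
lemma lmarginal_half_le {ν : ℝ} (hν : 1 < ν) {S M : Finset (Fin n)} (hMS : M ⊆ S) (hS : 2 ≤ #S)
    {up : Bool} (hM : #M = halfCard up #S) {a : ℝ} (ha : 0 ≤ a) {γ : ℝ≥0∞}
    {g : BoxState d → (Fin n → EuclideanSpace ℝ (Fin d)) → ℝ≥0∞}
    (hg : Measurable fun q : BoxState d × (Fin n → EuclideanSpace ℝ (Fin d)) => g q.1 q.2)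
    (H : ∀ (B : BoxState d) W, (∀ c, 0 < extent B c) → 0 < B.2.2 →
      (∫⋯∫⁻_M, g B ∂fun _ => volume.restrict B.toSet) W ≤
        volume B.toSet ^ #M * (ENNReal.ofReal (B.2.2 ^ ν * a) * (d : ℝ≥0∞) ^ tieCount B * γ))
    (hd : 1 ≤ d) (B : BoxState d) (hB : ∀ c, 0 < extent B c) (hB2 : 0 < B.2.2) (c : Fin d)
    (W : Fin n → EuclideanSpace ℝ (Fin d)) :
    (∫⋯∫⁻_S, (fun V => if ∀ x ∈ M, ∀ y ∈ S \ M, rank up c B (V x) ≤ rank up c B (V y) then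
        g (child up c (cut up c (S \ M) B V) B) V else 0) ∂fun _ => volume.restrict B.toSet) W ≤
      volume B.toSet ^ #S * (ENNReal.ofReal (B.2.2 ^ ν * a * 2 ^ (-(ν / d)) *
        (1 + 2 * 2 ^ ν / √(#S : ℝ)) / (#S).choose #M) * (d : ℝ≥0∞) ^ tieCountErase B c * γ) := by
  set m := #S with hm
  set l := #M with hl
  set u := #(S \ M) with hu
  have hlu : l + u = m := by
    have := card_sdiff_add_card_eq_card hMS
    omega
  have hl1 : 1 ≤ l ∧ 1 ≤ u ∧ 2 * l ≤ m + 1 ∧ m ≤ 2 * l + 1 := by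
    rw [halfCard] at hM
    split_ifs at hM <;> omega
  set vol := volume B.toSet with hvol
  set T := B.2.2 with hT
  set bad : Set ℝ := ⋃ c' : Fin d, {s | s * extent B c = extent B c'} with hbad
  have hbadfin : bad.Finite := by
    refine Set.finite_iUnion fun c' => (Set.finite_singleton (extent B c' / extent B c)).subset ?_
    intro s hs
    exact eq_div_of_mul_eq (hB c).ne' hs
  set D : ℝ≥0∞ := (d : ℝ≥0∞) ^ tieCountErase B c * γ with hD
  set nice : ℝ → ℝ≥0∞ := fun s => (ENNReal.ofReal s * vol) ^ l *
    (ENNReal.ofReal ((2 ^ (-(1 / (d : ℝ))) * max 1 (2 * s) * T) ^ ν * a) * D) with hnice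
  have hnicem : Measurable nice := by
    refine Measurable.mul (by fun_prop) (Measurable.mul_const (Measurable.ennreal_ofReal ?_) _)
    exact (Measurable.pow_const (by fun_prop) ν).mul_const a
  set good : Set ℝ := Set.Ioc 0 1 \ bad with hgood
  have hgoodm : MeasurableSet good := measurableSet_Ioc.diff hbadfin.measurableSet
  set φ : ℝ → ℝ≥0∞ := fun s => if s ∈ good then nice s else ⊤ with hφ
  have hφm : Measurable φ := Measurable.ite hgoodm hnicem measurable_const
  have key := lmarginal_split_le (volume.restrict B.toSet) (measurable_rank up c B)
    (M := M) (M' := S \ M) sdiff_disjoint (card_pos.1 (by omega))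
    (f := fun s V => g (child up c s B) V)
    (hg.comp ((measurable_child up c measurable_fst measurable_const).prodMk measurable_snd))
    hφm (fun s W => by
      by_cases hs : s ∈ good
      · have hs' := hs
        obtain ⟨⟨hs0, hs1⟩, hsb⟩ := hs'
        simp only [hφ, hs, if_true]
        rw [Measure.restrict_restrict (measurableSet_le (measurable_rank up c B) measurable_const),
          ← toSet_child up c hs1 (hB c)]
        refine (H (child up c s B) W ?_ ?_).trans ?_
        · intro c'
          rw [extent_child]
          split_ifs
          · exact mul_pos hs0 (hB c)
          · exact hB c'
        · change 0 < 2 ^ (-(1 / (d : ℝ))) * max 1 (2 * s) * B.2.2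
          have : 0 < max 1 (2 * s) := lt_max_of_lt_left one_pos
          positivity
        · rw [volume_toSet_child up c hs0.le, hnice, hD, mul_assoc (ENNReal.ofReal _)]
          have htie : tieCount (child up c s B) ≤ tieCountErase B c := by
            refine tieCount_child_le up c fun c' _ h => hsb ?_
            exact Set.mem_iUnion.2 ⟨c', h⟩
          have hd1 : (1 : ℝ≥0∞) ≤ d := by exact_mod_cast hd
          refine mul_le_mul_right (mul_le_mul_right (mul_le_mul_left ?_ _) _) _
          exact pow_le_pow_right₀ hd1 htie
      · simp only [hφ, hs, if_false, le_top]) W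
  rw [sdiff_union_of_subset hMS] at key
  refine key.trans ?_
  have h1 : ∫⁻ x, φ (rank up c B x) * (volume.restrict B.toSet)
      {b | rank up c B x ≤ rank up c B b} ^ (u - 1) ∂volume.restrict B.toSet ≤
      ∫⁻ x, φ (rank up c B x) * (vol * ENNReal.ofReal (1 - rank up c B x)) ^ (u - 1)
        ∂volume.restrict B.toSet := by
    refine lintegral_mono fun x => ?_
    gcongr
    exact volume_rank_ge_le up c (hB c) _
  have h2 : ∫⁻ x, φ (rank up c B x) * (vol * ENNReal.ofReal (1 - rank up c B x)) ^ (u - 1)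
        ∂volume.restrict B.toSet =
      vol * ∫⁻ s in Set.Icc (0 : ℝ) 1, φ s * (vol * ENNReal.ofReal (1 - s)) ^ (u - 1) := by
    have hm : Measurable fun s : ℝ => φ s * (vol * ENNReal.ofReal (1 - s)) ^ (u - 1) :=
      hφm.mul (by fun_prop)
    rw [← smul_eq_mul, ← lintegral_smul_measure, ← map_rank up c (hB c),
      lintegral_map hm (measurable_rank up c B)]
  set κ : ℝ := T ^ ν * a * 2 ^ (-(ν / d)) with hκ
  have hκ0 : 0 ≤ κ := by positivity
  have h3 : ∫⁻ s in Set.Icc (0 : ℝ) 1, φ s * (vol * ENNReal.ofReal (1 - s)) ^ (u - 1) =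
      ∫⁻ s in Set.Icc (0 : ℝ) 1, (vol ^ (l + (u - 1)) * ENNReal.ofReal κ * D) *
        ENNReal.ofReal (s ^ l * (1 - s) ^ (u - 1) * (max 1 (2 * s)) ^ ν) := by
    refine setLIntegral_congr_fun_ae measurableSet_Icc ?_
    have hnull : ∀ᵐ s : ℝ, s ∉ insert 0 bad := 
      measure_eq_zero_iff_ae_notMem.1 ((hbadfin.insert 0).measure_zero _)
    filter_upwards [hnull] with s hs hsI
    have hs' : s ≠ 0 ∧ s ∉ bad := by
      simpa [not_or] using hs
    have hs0 : 0 < s := lt_of_le_of_ne hsI.1 hs'.1.symm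
    have hsg : s ∈ good := ⟨⟨hs0, hsI.2⟩, hs'.2⟩
    have hs1 : 0 ≤ 1 - s := sub_nonneg.2 hsI.2
    have hmx : 0 ≤ max 1 (2 * s) := le_max_of_le_left zero_le_one
    simp only [hφ, hsg, if_true, hnice]
    have e : (2 ^ (-(1 / (d : ℝ))) * max 1 (2 * s) * T) ^ ν * a = κ * max 1 (2 * s) ^ ν := by
      rw [Real.mul_rpow (by positivity) hB2.le, Real.mul_rpow (by positivity) hmx,
        ← Real.rpow_mul (by norm_num), hκ, show -(1 / (d : ℝ)) * ν = -(ν / d) by ring]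
      ring
    rw [e, ENNReal.ofReal_mul (p := κ) hκ0,
      ENNReal.ofReal_mul (p := s ^ l * (1 - s) ^ (u - 1)) (by positivity),
      ENNReal.ofReal_mul (p := s ^ l) (by positivity),
      ENNReal.ofReal_pow hs0.le, ENNReal.ofReal_pow hs1, pow_add]
    ring
  have h4 := lintegral_beta_max_le hν hlu hl1.1 hl1.2.1 hl1.2.2.1 hl1.2.2.2
  have hmeas : Measurable fun s : ℝ => ENNReal.ofReal (s ^ l * (1 - s) ^ (u - 1) * (max 1 (2 * s)) ^ ν) := by
    fun_prop
  rw [lintegral_const_mul _ hmeas] at h3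
  have hu0 : (0 : ℝ) < u := by exact_mod_cast hl1.2.1
  have hchoose : (0 : ℝ) < m.choose l := by
    exact_mod_cast Nat.choose_pos (show l ≤ m by omega)
  calc (u : ℝ≥0∞) * ∫⁻ x, φ (rank up c B x) * (volume.restrict B.toSet)
        {b | rank up c B x ≤ rank up c B b} ^ (u - 1) ∂volume.restrict B.toSet
      ≤ u * (vol * ((vol ^ (l + (u - 1)) * ENNReal.ofReal κ * D) *
          ENNReal.ofReal ((1 + 2 * 2 ^ ν / √m) / (u * m.choose l)))) := by
        refine mul_le_mul_right ((h1.trans h2.le).trans ?_) _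
        rw [h3]
        exact mul_le_mul_right (mul_le_mul_right h4 _) _
    _ = vol ^ (1 + (l + (u - 1))) * (ENNReal.ofReal κ * (ENNReal.ofReal u *
          ENNReal.ofReal ((1 + 2 * 2 ^ ν / √m) / (u * m.choose l))) * D) := by
        rw [ENNReal.ofReal_natCast, pow_add vol 1, pow_one]; ring
    _ = _ := by
        rw [← ENNReal.ofReal_mul hu0.le, ← ENNReal.ofReal_mul hκ0,
          show 1 + (l + (u - 1)) = m by omega, hD, mul_assoc (ENNReal.ofReal _)]
        have e : κ * (u * ((1 + 2 * 2 ^ ν / √(m : ℝ)) / (u * m.choose l))) =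
            κ * (1 + 2 * 2 ^ ν / √(m : ℝ)) / m.choose l := by
          rw [mul_div_assoc κ, ← mul_div_assoc (u : ℝ), mul_div_mul_left _ _ hu0.ne']
        rw [e]

end LevelSum

/-! ### The expected sum over a level -/

section LevelSumBound

variable {d n : ℕ}

/-- A bounded increasing function of the number of nodes that absorbs, at every bisection, the
deviation of the expected `ν`-th power of the normalized relative extent from `1`. -/
noncomputable def growth (ν : ℝ) (m : ℕ) : ℝ := Real.exp (20 * 2 ^ ν * (1 - 1 / √(m : ℝ)))

lemma growth_pos (ν : ℝ) (m : ℕ) : 0 < growth ν m := Real.exp_pos _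

lemma growth_le (ν : ℝ) (m : ℕ) : growth ν m ≤ Real.exp (20 * 2 ^ ν) := by
  refine Real.exp_le_exp.2 (mul_le_of_le_one_right (by positivity) ?_)
  have : 0 ≤ 1 / √(m : ℝ) := by positivity
  linarith

lemma one_le_growth (ν : ℝ) {m : ℕ} (hm : 1 ≤ m) : 1 ≤ growth ν m := by
  refine Real.one_le_exp (mul_nonneg (by positivity) ?_)
  have h : 1 ≤ √(m : ℝ) := Real.one_le_sqrt.2 (by exact_mod_cast hm)
  rw [sub_nonneg, div_le_one (by linarith)]
  exact h

/-- As `√l` is smaller than `√m` by a fixed factor, the increase of `-1 / √m` from `l` to `m` is of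
the order `1 / √m`; the constant `20` in `growth` makes it sufficient. -/
lemma growth_mul_le (ν : ℝ) {l m : ℕ} (hl : 1 ≤ l) (hm : 2 ≤ m) (hlm : 2 * l ≤ m + 1) :
    growth ν l * (1 + 2 * 2 ^ ν / √(m : ℝ)) ≤ growth ν m := by
  have hl' : (1 : ℝ) ≤ l := by exact_mod_cast hl
  have hm' : (2 : ℝ) ≤ m := by exact_mod_cast hm
  have hlm' : 2 * (l : ℝ) ≤ m + 1 := by exact_mod_cast hlm
  have hsl : 0 < √(l : ℝ) := Real.sqrt_pos.2 (by linarith)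
  have hsm : 0 < √(m : ℝ) := Real.sqrt_pos.2 (by linarith)
  have h11 : 11 / 10 * √(l : ℝ) ≤ √(m : ℝ) := by
    refine Real.le_sqrt_of_sq_le ?_
    rw [mul_pow, Real.sq_sqrt (by linarith)]
    linarith
  have hinv : 11 / 10 * (1 / √(m : ℝ)) ≤ 1 / √(l : ℝ) := by
    rw [mul_one_div, div_le_div_iff₀ hsm hsl]
    linarith
  have h2 : (0 : ℝ) < 2 ^ ν := by positivity
  have h1 : 1 + 2 * 2 ^ ν / √(m : ℝ) ≤ Real.exp (2 * 2 ^ ν * (1 / √(m : ℝ))) := by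
    have := Real.add_one_le_exp (2 * 2 ^ ν * (1 / √(m : ℝ)))
    rw [mul_one_div] at this ⊢
    linarith
  refine (mul_le_mul_of_nonneg_left h1 (growth_pos ν l).le).trans ?_
  rw [growth, growth, ← Real.exp_add, Real.exp_le_exp]
  nlinarith

lemma lmarginal_finsetSum {δ ι : Type*} {X : δ → Type*} [DecidableEq δ] [∀ i, MeasurableSpace (X i)]
    (μ : ∀ i, Measure (X i)) (s : Finset δ) (t : Finset ι) {f : ι → (∀ i, X i) → ℝ≥0∞}
    (hf : ∀ i ∈ t, Measurable (f i)) (x : ∀ i, X i) :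
    (∫⋯∫⁻_s, (fun y => ∑ i ∈ t, f i y) ∂μ) x = ∑ i ∈ t, (∫⋯∫⁻_s, f i ∂μ) x := by
  unfold lmarginal
  exact lintegral_finsetSum _ fun i hi => (hf i hi).comp measurable_updateFinset

open Classical in
/-- The expected sum over the regions of a level, given such a bound for a single region: each
bisection doubles the number of regions and multiplies the `d`-th power of the extents by `1 / 2`,
up to factors whose product converges. -/
theorem lmarginal_levelSum_le (hd : 1 ≤ d) {ν : ℝ} (hν : 1 < ν) {X : ℝ} {γ : ℝ≥0∞}
    {f : Finset (Fin n) → BoxState d → (Fin n → EuclideanSpace ℝ (Fin d)) → ℝ≥0∞}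
    (hfm : ∀ S, Measurable fun q : BoxState d × (Fin n → EuclideanSpace ℝ (Fin d)) => f S q.1 q.2)
    (hf : ∀ S (B : BoxState d) W, X ≤ #S + 1 → S.Nonempty → (∀ c, 0 < extent B c) → 0 < B.2.2 →
      (∫⋯∫⁻_S, f S B ∂fun _ => volume.restrict B.toSet) W ≤
        volume B.toSet ^ #S * (ENNReal.ofReal (B.2.2 ^ ν) * γ)) (j : ℕ) :
    ∀ S (B : BoxState d) W, X * 2 ^ j ≤ #S + 1 → S.Nonempty → (∀ c, 0 < extent B c) → 0 < B.2.2 →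
      (∫⋯∫⁻_S, levelSum f j S B ∂fun _ => volume.restrict B.toSet) W ≤
        volume B.toSet ^ #S * (ENNReal.ofReal (B.2.2 ^ ν *
          (growth ν #S * (2 * 2 ^ (-(ν / d))) ^ j)) * (d : ℝ≥0∞) ^ tieCount B * γ) := by
  have hd1 : (1 : ℝ≥0∞) ≤ d := by exact_mod_cast hd
  induction j with
  | zero =>
    intro S B W hX hS hB hB2
    refine (hf S B W (by simpa using hX) hS hB hB2).trans ?_
    refine mul_le_mul_right ?_ _
    refine mul_le_mul_left ?_ _
    rw [← mul_one (ENNReal.ofReal (B.2.2 ^ ν))]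
    refine mul_le_mul' (ENNReal.ofReal_le_ofReal ?_) (one_le_pow₀ hd1)
    have := one_le_growth ν hS.card_pos
    have h0 : 0 ≤ B.2.2 ^ ν := by positivity
    simpa using le_mul_of_one_le_right h0 this
  | succ j ih =>
    intro S B W hX hS hB hB2
    by_cases hS2 : 2 ≤ #S
    swap
    · have : levelSum f (j + 1) S B = fun _ => 0 := by
        funext V; simp [levelSum, hS2]
      rw [this]
      simp [lmarginal]
    set m := #S with hm
    set Lg := univ.filter (fun c => ∀ c', extent B c' ≤ extent B c) with hLg
    set term : Fin d → Bool → Finset (Fin n) → (Fin n → EuclideanSpace ℝ (Fin d)) → ℝ≥0∞ :=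
      fun c up M V => if ∀ x ∈ M, ∀ y ∈ S \ M, rank up c B (V x) ≤ rank up c B (V y) then
            levelSum f j M (child up c (cut up c (S \ M) B V) B) V else 0 with hterm
    have e : levelSum f (j + 1) S B = fun V => ∑ c ∈ Lg, ∑ up : Bool,
        ∑ M ∈ S.powersetCard (halfCard up m), term c up M V := by
      funext V
      rw [levelSum, if_pos hS2, hLg, sum_filter]
    have hmt : ∀ c up M, Measurable (term c up M) := by
      intro c up M
      refine Measurable.ite ?_ ?_ measurable_const
      · refine measurableSet_setOfPred.2 (Measurable.forall fun x => Measurable.forall fun _ =>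
            Measurable.forall fun y => Measurable.forall fun _ => ?_)
        exact measurableSet_setOfPred.1 (measurableSet_le
          ((measurable_rank up c B).comp (measurable_pi_apply x))
          ((measurable_rank up c B).comp (measurable_pi_apply y)))
      · exact measurable_of_prod (g := fun B V => levelSum f j M
          (child up c (cut up c (S \ M) B V) B) V) ((measurable_levelSum hfm j M).comp
          ((measurable_child up c (measurable_cut up c (S \ M))
            measurable_fst).prodMk measurable_snd)) B
    set κ : ℝ := B.2.2 ^ ν * (growth ν m * (2 * 2 ^ (-(ν / d))) ^ j) * 2 ^ (-(ν / d)) with hκ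
    have hbase : 0 ≤ (2 : ℝ) * 2 ^ (-(ν / d)) := by positivity
    have hκ0 : 0 ≤ κ := by have := growth_pos ν m; positivity
    have hM : ∀ c ∈ Lg, ∀ up : Bool, ∀ M ∈ S.powersetCard (halfCard up m),
        (∫⋯∫⁻_S, term c up M ∂fun _ => volume.restrict B.toSet) W ≤
          volume B.toSet ^ m * (ENNReal.ofReal (κ / m.choose (halfCard up m)) *
            (d : ℝ≥0∞) ^ tieCountErase B c * γ) := by
      intro c _ up M hM
      obtain ⟨hMS, hMc⟩ := mem_powersetCard.1 hM
      have hl : 1 ≤ #M ∧ 2 * #M ≤ m + 1 ∧ m ≤ 2 * #M + 1 := by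
        rw [hMc, halfCard]
        split_ifs <;> omega
      have hXj : X * 2 ^ j ≤ #M + 1 := by
        have h1 : (m : ℝ) ≤ 2 * #M + 1 := by exact_mod_cast hl.2.2
        rw [pow_succ] at hX
        linarith
      refine (lmarginal_half_le hν hMS hS2 hMc (a := growth ν #M * (2 * 2 ^ (-(ν / d))) ^ j)
        (mul_nonneg (growth_pos _ _).le (pow_nonneg hbase j)) (γ := γ)
        (g := fun B V => levelSum f j M B V) (measurable_levelSum hfm j M)
        (fun B W h1 h2 => ih M B W hXj (card_pos.1 hl.1) h1 h2) hd B hB hB2 c W).trans ?_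
      rw [hMc]
      refine mul_le_mul_right (mul_le_mul_left (mul_le_mul_left (ENNReal.ofReal_le_ofReal ?_) _) _) _
      refine div_le_div_of_nonneg_right ?_ (Nat.cast_nonneg _)
      have hg := growth_mul_le ν hl.1 hS2 hl.2.1
      rw [hMc] at hg
      have h0 : 0 ≤ B.2.2 ^ ν * (2 * 2 ^ (-(ν / d))) ^ j * 2 ^ (-(ν / d)) := by positivity
      calc _ = B.2.2 ^ ν * (2 * 2 ^ (-(ν / d))) ^ j * 2 ^ (-(ν / d)) *
            (growth ν (halfCard up m) * (1 + 2 * 2 ^ ν / √(m : ℝ))) := by ring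
        _ ≤ B.2.2 ^ ν * (2 * 2 ^ (-(ν / d))) ^ j * 2 ^ (-(ν / d)) * growth ν m :=
            mul_le_mul_of_nonneg_left hg h0
        _ = κ := by rw [hκ]; ring
    rw [e, lmarginal_finsetSum _ _ _ (fun c _ => Finset.measurable_sum _ fun up _ =>
      Finset.measurable_sum _ fun M _ => hmt c up M)]
    calc ∑ c ∈ Lg, (∫⋯∫⁻_S, (fun V => ∑ up : Bool, ∑ M ∈ S.powersetCard (halfCard up m),
            term c up M V) ∂fun _ => volume.restrict B.toSet) W
        = ∑ c ∈ Lg, ∑ up : Bool, ∑ M ∈ S.powersetCard (halfCard up m),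
            (∫⋯∫⁻_S, term c up M ∂fun _ => volume.restrict B.toSet) W := by
          refine sum_congr rfl fun c _ => ?_
          rw [lmarginal_finsetSum _ _ _ (fun up _ => Finset.measurable_sum _ fun M _ => hmt c up M)]
          refine sum_congr rfl fun up _ => ?_
          rw [lmarginal_finsetSum _ _ _ (fun M _ => hmt c up M)]
      _ ≤ ∑ c ∈ Lg, ∑ up : Bool, ∑ M ∈ S.powersetCard (halfCard up m),
          volume B.toSet ^ m * (ENNReal.ofReal (κ / m.choose (halfCard up m)) *
            (d : ℝ≥0∞) ^ tieCountErase B c * γ) :=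
          sum_le_sum fun c hc => sum_le_sum fun up _ => sum_le_sum fun M h => hM c hc up M h
      _ = ∑ c ∈ Lg, ∑ up : Bool, volume B.toSet ^ m * (ENNReal.ofReal κ *
            (d : ℝ≥0∞) ^ tieCountErase B c * γ) := by
          refine sum_congr rfl fun c _ => sum_congr rfl fun up _ => ?_
          have hle : halfCard up m ≤ m := by rw [halfCard]; split_ifs <;> omega
          have hch : (0 : ℝ) < m.choose (halfCard up m) := by exact_mod_cast Nat.choose_pos hle
          have e1 : ENNReal.ofReal κ = m.choose (halfCard up m) *
              ENNReal.ofReal (κ / m.choose (halfCard up m)) := by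
            rw [← ENNReal.ofReal_natCast, ← ENNReal.ofReal_mul hch.le, mul_div_cancel₀ _ hch.ne']
          rw [sum_const, card_powersetCard, nsmul_eq_mul, e1]
          ring
      _ = volume B.toSet ^ m * (2 * ENNReal.ofReal κ *
            (∑ c ∈ Lg, (d : ℝ≥0∞) ^ tieCountErase B c) * γ) := by
          simp only [sum_const, card_univ, Fintype.card_bool, nsmul_eq_mul]
          rw [mul_sum, sum_mul, mul_sum]
          refine sum_congr rfl fun c _ => ?_
          push_cast
          ring
      _ ≤ volume B.toSet ^ m * (2 * ENNReal.ofReal κ * (d : ℝ≥0∞) ^ tieCount B * γ) :=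
          mul_le_mul_right (mul_le_mul_left (mul_le_mul_right (sum_pow_tieCountErase_le hd B) _) _) _
      _ = _ := by
          have e2 : 2 * ENNReal.ofReal κ = ENNReal.ofReal (B.2.2 ^ ν *
              (growth ν m * (2 * 2 ^ (-(ν / d))) ^ (j + 1))) := by
            rw [← ENNReal.ofReal_ofNat, ← ENNReal.ofReal_mul (by norm_num), hκ]
            congr 1; ring
          rw [e2]

end LevelSumBound

/-! ### Paths in a box all of whose cells are hit -/

section Cells

variable {d n : ℕ}

/-- One of the `u ^ d` cells into which a box is divided by cutting each side into `u` parts. -/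
noncomputable def cell {u : ℕ} (κ : Fin d → Fin u) (B : BoxState d) : BoxState d :=
  (fun c => B.1 c + (κ c : ℝ) * (extent B c / u), fun c => B.1 c + ((κ c : ℝ) + 1) * (extent B c / u),
    B.2.2)

/-- Every cell contains a node of `S`. -/
def AllCellsHit (u : ℕ) (S : Finset (Fin n)) (B : BoxState d)
    (V : Fin n → EuclideanSpace ℝ (Fin d)) : Prop :=
  ∀ κ : Fin d → Fin u, ∃ x ∈ S, V x ∈ (cell κ B).toSet

open Classical in
/-- A bound for the energy of a path with at least `u` links allowed in a box: the links have length
of order `1 / u` times the extent of the box if all cells are hit, and the direct link is used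
otherwise. -/
noncomputable def pathBound (ν : ℝ) (u : ℕ) (S : Finset (Fin n)) (B : BoxState d)
    (V : Fin n → EuclideanSpace ℝ (Fin d)) : ℝ≥0∞ :=
  ENNReal.ofReal ((√d * B.2.2) ^ ν) * (ENNReal.ofReal (3 ^ ν * (u : ℝ) ^ (1 - ν)) +
    if AllCellsHit u S B V then 0 else 1)

lemma measurable_pathBound (ν : ℝ) (u : ℕ) (S : Finset (Fin n)) :
    Measurable fun q : BoxState d × (Fin n → EuclideanSpace ℝ (Fin d)) =>
      pathBound ν u S q.1 q.2 := by
  unfold pathBound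
  refine Measurable.mul (Measurable.ennreal_ofReal (Measurable.pow_const (by fun_prop) ν))
    (Measurable.const_add (Measurable.ite ?_ measurable_const measurable_const) _)
  refine measurableSet_setOfPred.2 (Measurable.forall fun κ => Measurable.exists fun x => ?_)
  refine (measurable_const : Measurable fun _ => x ∈ S).and ?_
  change Measurable fun q : BoxState d × (Fin n → EuclideanSpace ℝ (Fin d)) =>
    ∀ c, q.2 x c ∈ Set.Icc ((cell κ q.1).1 c) ((cell κ q.1).2.1 c)
  refine Measurable.forall fun c => ?_
  simp only [cell, Set.mem_Icc, extent]
  refine Measurable.and (measurableSet_setOfPred.1 (measurableSet_le ?_ ?_))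
    (measurableSet_setOfPred.1 (measurableSet_le ?_ ?_)) <;> fun_prop

lemma volume_diff_cell_le {u : ℕ} (hu : 1 ≤ u) (κ : Fin d → Fin u) {B : BoxState d}
    (hB : ∀ c, 0 < extent B c) :
    volume (B.toSet \ (cell κ B).toSet) ≤
      volume B.toSet * ENNReal.ofReal (Real.exp (-(1 / (u : ℝ) ^ d))) := by
  have hu0 : (0 : ℝ) < u := by exact_mod_cast hu
  have hsub : (cell κ B).toSet ⊆ B.toSet := by
    intro x hx c
    have h := hx c
    have hk : (κ c : ℝ) + 1 ≤ u := by exact_mod_cast (κ c).2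
    have hq : 0 < extent B c / u := div_pos (hB c) hu0
    have he : (u : ℝ) * (extent B c / u) = extent B c := by field_simp
    have hdef : extent B c = B.2.1 c - B.1 c := rfl
    constructor
    · refine le_trans ?_ h.1
      change B.1 c ≤ B.1 c + (κ c : ℝ) * (extent B c / u)
      have : 0 ≤ (κ c : ℝ) * (extent B c / u) := by positivity
      linarith
    · refine h.2.trans ?_
      change B.1 c + ((κ c : ℝ) + 1) * (extent B c / u) ≤ B.2.1 c
      have := mul_le_mul_of_nonneg_right hk hq.le
      linarith
  have hvol : volume (cell κ B).toSet = volume B.toSet * ENNReal.ofReal (1 / (u : ℝ) ^ d) := by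
    rw [volume_toSet, volume_toSet]
    have e : ∀ c, ENNReal.ofReal (extent (cell κ B) c) =
        ENNReal.ofReal (extent B c) * ENNReal.ofReal (1 / u) := by
      intro c
      rw [← ENNReal.ofReal_mul (hB c).le]
      congr 1
      simp only [extent, cell]
      ring
    simp only [e]
    rw [prod_mul_distrib, prod_const, card_univ, Fintype.card_fin,
      ← ENNReal.ofReal_pow (by positivity), div_pow, one_pow]
  rw [measure_sdiff hsub (measurableSet_toSet _).nullMeasurableSet
    (volume_toSet_ne_top _), hvol]
  have h1 : (1 : ℝ≥0∞) ≤ ENNReal.ofReal (Real.exp (-(1 / (u : ℝ) ^ d))) +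
      ENNReal.ofReal (1 / (u : ℝ) ^ d) := by
    rw [← ENNReal.ofReal_add (Real.exp_pos _).le (by positivity), ← ENNReal.ofReal_one]
    refine ENNReal.ofReal_le_ofReal ?_
    have := Real.add_one_le_exp (-(1 / (u : ℝ) ^ d))
    linarith
  refine tsub_le_iff_right.2 ?_
  calc volume B.toSet = volume B.toSet * 1 := (mul_one _).symm
    _ ≤ _ := mul_le_mul_right h1 _
    _ = _ := mul_add _ _ _

/-- A cell is missed by all nodes with exponentially small probability. -/
lemma lmarginal_pathBound_le {ν : ℝ} {u : ℕ} (hu : 1 ≤ u) {X : ℝ} (S : Finset (Fin n))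
    (B : BoxState d) (W : Fin n → EuclideanSpace ℝ (Fin d)) (hX : X ≤ #S + 1)
    (hB : ∀ c, 0 < extent B c) (hB2 : 0 < B.2.2) :
    (∫⋯∫⁻_S, pathBound ν u S B ∂fun _ => volume.restrict B.toSet) W ≤
      volume B.toSet ^ #S * (ENNReal.ofReal (B.2.2 ^ ν) * ENNReal.ofReal ((√d) ^ ν *
        (3 ^ ν * (u : ℝ) ^ (1 - ν) + (u : ℝ) ^ d * Real.exp (-((X - 1) / (u : ℝ) ^ d))))) := by
  classical
  have hu0 : (0 : ℝ) < u := by exact_mod_cast hu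
  set K : ℝ≥0∞ := ENNReal.ofReal ((√d * B.2.2) ^ ν) with hK
  set A : ℝ≥0∞ := ENNReal.ofReal (3 ^ ν * (u : ℝ) ^ (1 - ν)) with hA
  set E : ℝ≥0∞ := ENNReal.ofReal (Real.exp (-((X - 1) / (u : ℝ) ^ d))) with hE
  have hfin : IsFiniteMeasure (volume.restrict B.toSet) :=
    ⟨by rw [Measure.restrict_apply_univ]; exact (volume_toSet_ne_top B).lt_top⟩
  set g : (Fin d → Fin u) → (Fin n → EuclideanSpace ℝ (Fin d)) → ℝ≥0∞ := fun κ V =>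
    if ∀ x ∈ S, V x ∈ ((cell κ B).toSet)ᶜ then K else 0 with hg
  have hgm : ∀ κ, Measurable (g κ) := by
    intro κ
    refine Measurable.ite ?_ measurable_const measurable_const
    refine measurableSet_setOfPred.2 (Measurable.forall fun x => Measurable.forall fun _ =>
      measurableSet_setOfPred.1 ?_)
    exact measurable_pi_apply x (measurableSet_toSet (cell κ B)).compl
  have hle : pathBound ν u S B ≤ fun V => K * A + ∑ κ, g κ V := by
    intro V
    rw [pathBound, mul_add]
    refine add_le_add le_rfl ?_
    split_ifs with h
    · simp
    · obtain ⟨κ, hκ⟩ := not_forall.1 h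
      have hκ' : ∀ x ∈ S, V x ∈ ((cell κ B).toSet)ᶜ := fun x hx hm => hκ ⟨x, hx, hm⟩
      calc K * 1 = g κ V := by rw [mul_one, hg]; simp only; rw [if_pos hκ']
        _ ≤ _ := single_le_sum (f := fun κ => g κ V) (fun _ _ => zero_le) (mem_univ κ)
  have hgle : ∀ κ, (∫⋯∫⁻_S, g κ ∂fun _ => volume.restrict B.toSet) W ≤
      volume B.toSet ^ #S * (K * E) := by
    intro κ
    have e : (∫⋯∫⁻_S, g κ ∂fun _ => volume.restrict B.toSet) W =
        (∫⋯∫⁻_S, (fun _ => K) ∂fun _ => (volume.restrict B.toSet).restrict ((cell κ B).toSet)ᶜ) W := by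
      rw [← lmarginal_ite_mem (volume.restrict B.toSet) (measurableSet_toSet (cell κ B)).compl S]
      simp only [hg]
      congr!
    rw [e, lmarginal_const_eq, Measure.restrict_restrict (measurableSet_toSet _).compl,
      Measure.restrict_apply_univ, Set.inter_comm, ← Set.sdiff_eq]
    calc K * volume (B.toSet \ (cell κ B).toSet) ^ #S
        ≤ K * (volume B.toSet * ENNReal.ofReal (Real.exp (-(1 / (u : ℝ) ^ d)))) ^ #S := by
          gcongr; exact volume_diff_cell_le hu κ hB
      _ = volume B.toSet ^ #S * (K * ENNReal.ofReal (Real.exp (-(1 / (u : ℝ) ^ d)) ^ #S)) := by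
          rw [mul_pow, ENNReal.ofReal_pow (Real.exp_pos _).le]; ring
      _ ≤ _ := by
          gcongr
          refine ENNReal.ofReal_le_ofReal ?_
          rw [← Real.exp_nat_mul, Real.exp_le_exp, mul_neg, mul_one_div]
          gcongr
          linarith
  calc (∫⋯∫⁻_S, pathBound ν u S B ∂fun _ => volume.restrict B.toSet) W
      ≤ (∫⋯∫⁻_S, (fun V => K * A + ∑ κ, g κ V) ∂fun _ => volume.restrict B.toSet) W :=
        lmarginal_mono hle W
    _ = (∫⋯∫⁻_S, (fun _ => K * A) ∂fun _ => volume.restrict B.toSet) W +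
        (∫⋯∫⁻_S, (fun V => ∑ κ, g κ V) ∂fun _ => volume.restrict B.toSet) W :=
        lintegral_add_left measurable_const _
    _ ≤ K * A * volume B.toSet ^ #S + ∑ κ : Fin d → Fin u, volume B.toSet ^ #S * (K * E) := by
        rw [lmarginal_finsetSum _ _ _ (fun κ _ => hgm κ), lmarginal_const_eq,
          Measure.restrict_apply_univ]
        gcongr
        exact hgle _
    _ = volume B.toSet ^ #S * (K * (A + (u : ℝ≥0∞) ^ d * E)) := by
        rw [sum_const, card_univ, Fintype.card_fun, Fintype.card_fin, Fintype.card_fin, nsmul_eq_mul]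
        push_cast
        ring
    _ = _ := by
        have e1 : A + (u : ℝ≥0∞) ^ d * E = ENNReal.ofReal (3 ^ ν * (u : ℝ) ^ (1 - ν) +
            (u : ℝ) ^ d * Real.exp (-((X - 1) / (u : ℝ) ^ d))) := by
          rw [hA, hE, ENNReal.ofReal_add (by positivity) (by positivity),
            ENNReal.ofReal_mul (p := (u : ℝ) ^ d) (by positivity), ENNReal.ofReal_pow hu0.le,
            ENNReal.ofReal_natCast]
        have e2 : K = ENNReal.ofReal (B.2.2 ^ ν) * ENNReal.ofReal ((√d) ^ ν) := by
          rw [hK, Real.mul_rpow (Real.sqrt_nonneg _) hB2.le, mul_comm,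
            ENNReal.ofReal_mul (by positivity)]
        rw [e1, e2, mul_assoc (ENNReal.ofReal (B.2.2 ^ ν)), ← ENNReal.ofReal_mul (by positivity)]

lemma dist_le_of_coord {x y : EuclideanSpace ℝ (Fin d)} {ρ : ℝ} (hρ : 0 ≤ ρ)
    (h : ∀ c, |x c - y c| ≤ ρ) : dist x y ≤ √d * ρ := by
  rw [EuclideanSpace.dist_eq]
  refine Real.sqrt_le_iff.2 ⟨by positivity, ?_⟩
  calc ∑ i, dist (x i) (y i) ^ 2 ≤ ∑ _i : Fin d, ρ ^ 2 := by
        refine sum_le_sum fun i _ => ?_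
        rw [Real.dist_eq]
        exact pow_le_pow_left₀ (abs_nonneg _) (h i) 2
    _ = (√d * ρ) ^ 2 := by
        rw [mul_pow, Real.sq_sqrt (Nat.cast_nonneg d)]; simp

lemma pathEnergy_map_range (ν : ℝ) (V : Fin n → EuclideanSpace ℝ (Fin d)) (u : ℕ) (z : ℕ → Fin n) :
    pathEnergy ν V ((List.range (u + 1)).map z) =
      ∑ k ∈ range u, dist (V (z k)) (V (z (k + 1))) ^ ν := by
  induction u generalizing z with
  | zero => simp
  | succ u ih =>
    have h1 := ih (fun k => z (k + 1))
    have e : (List.range (u + 1 + 1)).map z = z 0 :: (List.range (u + 1)).map (fun k => z (k + 1)) := by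
      rw [List.range_succ_eq_map, List.map_cons, List.map_map]; rfl
    have e' : (List.range (u + 1)).map (fun k => z (k + 1)) =
        z 1 :: (List.range u).map (fun k => z (k + 2)) := by
      rw [List.range_succ_eq_map, List.map_cons, List.map_map]; rfl
    rw [e]
    rw [e'] at h1 ⊢
    rw [pathEnergy_cons_cons, h1, sum_range_succ', add_comm]

lemma exists_cell_index {u : ℕ} (hu : 1 ≤ u) {e y : ℝ} (he : 0 < e) (h0 : 0 ≤ y) (h1 : y ≤ e) :
    ∃ κ : Fin u, (κ : ℝ) * (e / u) ≤ y ∧ y ≤ ((κ : ℝ) + 1) * (e / u) := by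
  have hu0 : (0 : ℝ) < u := by exact_mod_cast hu
  have hq : 0 < e / u := div_pos he hu0
  have hue : (u : ℝ) * (e / u) = e := by field_simp
  rcases lt_or_ge ⌊y / (e / u)⌋₊ u with h | h
  · refine ⟨⟨⌊y / (e / u)⌋₊, h⟩, ?_, ?_⟩
    · exact (le_div_iff₀ hq).1 (Nat.floor_le (by positivity))
    · exact (div_le_iff₀ hq).1 (Nat.lt_floor_add_one _).le
  · have hy : e ≤ y := by
      have : (u : ℝ) ≤ y / (e / u) := (Nat.cast_le.2 h).trans (Nat.floor_le (by positivity))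
      rw [← hue]
      exact (le_div_iff₀ hq).1 this
    refine ⟨⟨u - 1, by omega⟩, ?_, ?_⟩
    · have : ((u - 1 : ℕ) : ℝ) ≤ u := by exact_mod_cast Nat.sub_le u 1
      have := mul_le_mul_of_nonneg_right this hq.le
      simp only
      linarith
    · have : (((u - 1 : ℕ) : ℝ) + 1) = u := by
        rw [Nat.cast_sub hu]; simp
      simp only [this]
      linarith

/-- If all cells are hit, a path follows the segment between its end points. -/
lemma IsLeastEnergyPath.ofReal_pathEnergy_le {ν : ℝ} (hν : 0 ≤ ν)
    {V : Fin n → EuclideanSpace ℝ (Fin d)} {S : Finset (Fin n)} {w : ℕ} {j i : Fin n}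
    {P : List (Fin n)} (h : IsLeastEnergyPath ν V S w j i P) {B : BoxState d}
    (hV : ∀ x ∈ S, V x ∈ B.toSet) (hB : ∀ c, 0 < extent B c) (hB2 : ∀ c, extent B c ≤ B.2.2)
    (ht : 0 ≤ B.2.2) {u : ℕ} (hu : 1 ≤ u) (huw : u ≤ w + 1) :
    ENNReal.ofReal (pathEnergy ν V P) ≤ pathBound ν u S B V := by
  have hu0 : (0 : ℝ) < u := by exact_mod_cast hu
  have hj : j ∈ S := h.1.2.2.2.1 j (List.mem_of_mem_head? h.1.2.1)
  have hi : i ∈ S := h.1.2.2.2.1 i (List.mem_of_getLast? h.1.2.2.1)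
  unfold pathBound
  split_ifs with hit
  · -- consecutive nodes `z k` lie in the cells of consecutive points of the segment
    set p : ℕ → Fin d → ℝ := fun k c => V j c + (k / u : ℝ) * (V i c - V j c) with hp
    have hpB : ∀ k ≤ u, ∀ c, 0 ≤ p k c - B.1 c ∧ p k c - B.1 c ≤ extent B c := by
      intro k hk c
      have h1 := hV j hj c
      have h2 := hV i hi c
      have hk0 : (0 : ℝ) ≤ k / u := by positivity
      have hk1 : (k / u : ℝ) ≤ 1 := (div_le_one hu0).2 (by exact_mod_cast hk)
      simp only [hp, extent]
      constructor <;> nlinarith [h1.1, h1.2, h2.1, h2.2]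
    have hex : ∀ k, ∃ x ∈ S, k ≤ u → ∀ c, |V x c - p k c| ≤ extent B c / u := by
      intro k
      by_cases hk : k ≤ u
      · choose κ hκ1 hκ2 using fun c => exists_cell_index hu (hB c) (hpB k hk c).1 (hpB k hk c).2
        obtain ⟨x, hx, hxc⟩ := hit κ
        refine ⟨x, hx, fun _ c => ?_⟩
        have h1 := (hxc c).1
        have h2 := (hxc c).2
        simp only [cell] at h1 h2
        have h3 := hκ1 c
        have h4 := hκ2 c
        rw [abs_le]
        constructor <;> linarith
      · exact ⟨j, hj, fun h => absurd h hk⟩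
    choose y hyS hy using hex
    set z : ℕ → Fin n := fun k => if k = 0 then j else if k = u then i else y k with hz
    have hzS : ∀ k, z k ∈ S := by
      intro k
      simp only [hz]
      split_ifs
      exacts [hj, hi, hyS k]
    have hzp : ∀ k ≤ u, ∀ c, |V (z k) c - p k c| ≤ extent B c / u := by
      intro k hk c
      have hq : 0 ≤ extent B c / u := (div_pos (hB c) hu0).le
      simp only [hz]
      split_ifs with h0 h1
      · subst h0
        simp [hp, hq]
      · subst h1
        simp only [hp, div_self hu0.ne']
        simp [hq]
      · exact hy k hk c
    have hstep : ∀ k < u, dist (V (z k)) (V (z (k + 1))) ≤ √d * (3 * B.2.2 / u) := by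
      intro k hk
      refine dist_le_of_coord (by positivity) fun c => ?_
      have h1 := abs_le.1 (hzp k hk.le c)
      have h2 := abs_le.1 (hzp (k + 1) hk c)
      have h3 : |p k c - p (k + 1) c| ≤ extent B c / u := by
        have e : p k c - p (k + 1) c = (V j c - V i c) / u := by
          simp only [hp]; push_cast; field_simp; ring
        rw [e, abs_div, abs_of_pos hu0]
        gcongr
        have hj' := hV j hj c
        have hi' := hV i hi c
        rw [abs_le]
        unfold extent
        constructor <;> linarith [hj'.1, hj'.2, hi'.1, hi'.2]
      have h4 := abs_le.1 h3
      have h5 : extent B c / u ≤ B.2.2 / u := by gcongr; exact hB2 c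
      have h6 : 3 * B.2.2 / u = 3 * (B.2.2 / u) := by ring
      rw [h6, abs_le]
      constructor <;> linarith [h1.1, h1.2, h2.1, h2.2, h4.1, h4.2]
    have hz0 : z 0 = j := by simp [hz]
    have hzu : z u = i := by simp only [hz, if_true]; rw [if_neg (by omega)]
    have hle := h.le_walk ν V (Q := (List.range (u + 1)).map z)
      (by rw [List.range_succ_eq_map]; simp [hz0]) (by rw [List.range_succ]; simp [hzu])
      (by intro x hx; obtain ⟨k, -, rfl⟩ := List.mem_map.1 hx; exact hzS k) (by simp; omega)
    rw [add_zero, ← ENNReal.ofReal_mul (by positivity)]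
    have hsum : pathEnergy ν V ((List.range (u + 1)).map z) ≤ u * (√d * (3 * B.2.2 / u)) ^ ν := by
      rw [pathEnergy_map_range]
      refine (sum_le_card_nsmul _ _ _ fun k hk => Real.rpow_le_rpow dist_nonneg
        (hstep k (mem_range.1 hk)) hν).trans ?_
      rw [card_range, nsmul_eq_mul]
    refine ENNReal.ofReal_le_ofReal ((hle.trans hsum).trans ?_)
    rw [show √d * (3 * B.2.2 / u) = (√d * B.2.2) * 3 * (u : ℝ)⁻¹ by ring,
      Real.mul_rpow (by positivity) (by positivity), Real.mul_rpow (by positivity) (by norm_num),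
      Real.rpow_sub hu0, Real.rpow_one, Real.inv_rpow hu0.le]
    refine le_of_eq ?_
    ring
  · have hle := h.le_walk ν V (Q := [j, i]) (by simp) (by simp) (by simp [hi, hj]) (by simp)
    rw [pathEnergy_cons_cons, pathEnergy_singleton, add_zero] at hle
    have hdist : dist (V j) (V i) ≤ √d * B.2.2 := by
      refine dist_le_of_coord ht fun c => le_trans ?_ (hB2 c)
      have hj' := hV j hj c
      have hi' := hV i hi c
      rw [abs_le]
      unfold extent
      constructor <;> linarith [hj'.1, hj'.2, hi'.1, hi'.2]
    calc ENNReal.ofReal (pathEnergy ν V P) ≤ ENNReal.ofReal ((√d * B.2.2) ^ ν) * 1 := by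
          rw [mul_one]
          exact ENNReal.ofReal_le_ofReal (hle.trans (Real.rpow_le_rpow dist_nonneg hdist hν))
      _ ≤ _ := mul_le_mul_right le_add_self _

end Cells

/-! ### The shape of the boxes -/

section Fits

variable {d n : ℕ}

/-- The extents of the box are bounded by `t, 2 ^ (-1 / d) * t, …, 2 ^ (-(d - 1) / d) * t` in some
order, where `t` is the bound recorded with the box.  Halving a longest side keeps this true with
`t` replaced by `2 ^ (-1 / d) * t`. -/
def FitsBound (B : BoxState d) : Prop :=
  ∃ σ : Equiv.Perm (Fin d), ∀ c, (2 : ℝ) ^ ((σ c : ℝ) / d) * extent B c ≤ B.2.2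

lemma FitsBound.extent_le {B : BoxState d} (h : FitsBound B) (hB : ∀ c, 0 < extent B c) (c : Fin d) :
    extent B c ≤ B.2.2 := by
  obtain ⟨σ, hσ⟩ := h
  refine le_trans (le_mul_of_one_le_left (hB c).le ?_) (hσ c)
  exact Real.one_le_rpow (by norm_num) (by positivity)

/-- The halved coordinate moves from the first to the last place, all others advance by one. -/
lemma FitsBound.child {B : BoxState d} (h : FitsBound B) (hB : ∀ c, 0 < extent B c) {c : Fin d}
    (hc : ∀ c', extent B c' ≤ extent B c) (up : Bool) (s : ℝ) :
    FitsBound (child up c s B) := by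
  obtain ⟨e, rfl⟩ : ∃ e, d = e + 1 := ⟨d - 1, by have := c.pos; omega⟩
  have ht : 0 ≤ B.2.2 := (hB c).le.trans (h.extent_le hB c)
  have hle := h.extent_le hB
  obtain ⟨σ, hσ⟩ := h
  -- a permutation with the longest coordinate `c` in the first place
  obtain ⟨τ, hτc, hτ⟩ : ∃ τ : Equiv.Perm (Fin (e + 1)), τ c = 0 ∧
      ∀ x, (2 : ℝ) ^ ((τ x : ℝ) / (e + 1 : ℕ)) * extent B x ≤ B.2.2 := by
    refine ⟨(Equiv.swap c (σ.symm 0)).trans σ, by simp, fun x => ?_⟩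
    by_cases h1 : x = c
    · subst h1
      simpa using hle x
    · by_cases h2 : x = σ.symm 0
      · subst h2
        simp only [Equiv.trans_apply, Equiv.swap_apply_right]
        exact le_trans (mul_le_mul_of_nonneg_left (hc _) (by positivity)) (hσ c)
      · simp only [Equiv.trans_apply, Equiv.swap_apply_of_ne_of_ne h1 h2]
        exact hσ x
  have hmax : 1 ≤ max 1 (2 * s) := le_max_left _ _
  have hp : (0 : ℝ) < 2 ^ (-(1 / ((e + 1 : ℕ) : ℝ))) := by positivity
  refine ⟨τ.trans (Equiv.subRight 1), fun x => ?_⟩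
  change _ ≤ 2 ^ (-(1 / ((e + 1 : ℕ) : ℝ))) * max 1 (2 * s) * B.2.2
  rw [extent_child]
  simp only [Equiv.trans_apply, Equiv.subRight_apply]
  split_ifs with hx
  · subst hx
    rw [hτc, Fin.coe_sub_one, if_pos rfl]
    have e1 : (2 : ℝ) ^ ((e : ℝ) / (e + 1 : ℕ)) = 2 ^ (-(1 / ((e + 1 : ℕ) : ℝ))) * 2 := by
      nth_rw 3 [← Real.rpow_one 2]
      rw [← Real.rpow_add (by norm_num)]
      congr 1
      push_cast
      field_simp
      ring
    rw [e1, mul_assoc, mul_assoc]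
    refine mul_le_mul_of_nonneg_left ?_ hp.le
    rw [← mul_assoc]
    rcases le_or_gt 0 s with hs | hs
    · exact mul_le_mul (le_max_right _ _) (hle x) (hB x).le (by linarith)
    · have : 2 * s * extent B x ≤ 0 := by nlinarith [hB x]
      exact this.trans (by positivity)
  · have hne : τ x ≠ 0 := fun h0 => hx (τ.injective (h0.trans hτc.symm))
    rw [Fin.coe_sub_one, if_neg hne]
    have hpos : 1 ≤ (τ x : ℕ) := Nat.one_le_iff_ne_zero.2 fun h => hne (Fin.ext h)
    have e1 : (2 : ℝ) ^ ((((τ x : ℕ) - 1 : ℕ) : ℝ) / (e + 1 : ℕ)) =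
        2 ^ (-(1 / ((e + 1 : ℕ) : ℝ))) * 2 ^ ((τ x : ℝ) / (e + 1 : ℕ)) := by
      rw [← Real.rpow_add (by norm_num), Nat.cast_sub hpos]
      congr 1
      push_cast
      ring
    rw [e1, mul_assoc, mul_assoc]
    refine mul_le_mul_of_nonneg_left ((hτ x).trans ?_) hp.le
    exact le_mul_of_one_le_left ht hmax

end Fits

/-! ### The energy as a sum over regions -/

section RunBound

variable {d n : ℕ} {ν : ℝ} {V : Fin n → EuclideanSpace ℝ (Fin d)} {w : ℕ → ℕ}

/-- The box state `B` describes the box of the region `R`, whose nodes lie in it. -/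
structure Describes (V : Fin n → EuclideanSpace ℝ (Fin d)) (B : BoxState d) (R : Region d n) :
    Prop where
  lo_eq : B.1 = R.lo
  hi_eq : B.2.1 = R.hi
  extent_pos : ∀ c, 0 < extent B c
  fits : FitsBound B
  mem : ∀ x ∈ R.nodes, V x ∈ B.toSet

lemma Describes.bound_pos {B : BoxState d} {R : Region d n} (h : Describes V B R) (hd : 1 ≤ d) :
    0 < B.2.2 :=
  (h.extent_pos ⟨0, hd⟩).trans_le (h.fits.extent_le h.extent_pos _)

lemma Describes.child {B : BoxState d} {R R' : Region d n} (h : Describes V B R)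
    (hsub : R'.nodes ⊆ R.nodes) {c : Fin d} (hc : ∀ c', extent B c' ≤ extent B c) {up : Bool} {s : ℝ}
    (hs : 0 < s) (hs1 : s ≤ 1) (hlo : (child up c s B).1 = R'.lo) (hhi : (child up c s B).2.1 = R'.hi)
    (hmem : ∀ x ∈ R'.nodes, rank up c B (V x) ≤ s) : Describes V (child up c s B) R' where
  lo_eq := hlo
  hi_eq := hhi
  extent_pos c' := by
    rw [extent_child]
    split_ifs
    · exact mul_pos hs (h.extent_pos c)
    · exact h.extent_pos c'
  fits := h.fits.child h.extent_pos hc up s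
  mem x hx := by
    rw [toSet_child up c hs1 (h.extent_pos c)]
    exact ⟨hmem x hx, h.mem x (hsub hx)⟩

/-- The two regions produced by a bisection occur among the terms of `levelSum`. -/
lemma Bisects.exists_describes (hV : ∀ c, Function.Injective fun x => V x c) {R L U : Region d n}
    (hb : Bisects V R L U) (hR : 2 ≤ #R.nodes) {B : BoxState d} (h : Describes V B R) :
    ∃ BL BU, Describes V BL L ∧ Describes V BU U ∧
      ∀ (f : Finset (Fin n) → BoxState d → (Fin n → EuclideanSpace ℝ (Fin d)) → ℝ≥0∞) (j : ℕ),
        levelSum f j L.nodes BL V + levelSum f j U.nodes BU V ≤ levelSum f (j + 1) R.nodes B V := by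
  classical
  obtain ⟨c, a, b, hc, hLR, hU, hcard, hLU, ha, hbU, hLlo, hLhi, hUlo, hUhi⟩ := hb
  have hc' : ∀ c', extent B c' ≤ extent B c := by
    intro c'
    simp only [extent, h.lo_eq, h.hi_eq]
    exact hc c'
  have he := h.extent_pos c
  have hURs : U.nodes ⊆ R.nodes := by rw [hU]; exact sdiff_subset
  have hRL : R.nodes \ L.nodes = U.nodes := hU.symm
  have hRU : R.nodes \ U.nodes = L.nodes := by rw [hU, Finset.sdiff_sdiff_eq_self hLR]
  obtain ⟨⟨xa, hxa, hxa'⟩, hamax⟩ := ha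
  obtain ⟨⟨yb, hyb, hyb'⟩, hbmin⟩ := hbU
  simp only at hxa' hyb'
  have hxaL : xa ∈ L.nodes := hxa
  have hybU : yb ∈ U.nodes := hyb
  have hlt : a < b := by
    rw [← hxa', ← hyb']
    refine lt_of_le_of_ne (hLU xa hxaL yb hybU) fun heq => ?_
    have := hV c heq
    subst this
    rw [hU] at hybU
    exact (mem_sdiff.1 hybU).2 hxaL
  have hxaB := h.mem xa (hLR hxaL) c
  have hybB := h.mem yb (hURs hybU) c
  rw [hxa'] at hxaB
  rw [hyb'] at hybB
  have hdef : extent B c = B.2.1 c - B.1 c := rfl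
  have hcutL : cut false c U.nodes B V = (b - B.1 c) / extent B c := by
    obtain ⟨y, hy, hye⟩ := exists_minOn_eq (rank false c B) ⟨yb, hybU⟩ V
    refine le_antisymm ?_ ?_
    · refine (minOn_le (rank false c B) hybU V).trans (le_of_eq ?_)
      simp [rank, hyb']
    · rw [cut, hye]
      simp only [rank, Bool.false_eq_true, if_false]
      have := hbmin ⟨y, hy, rfl⟩
      simp only at this
      gcongr
  have hcutU : cut true c L.nodes B V = (B.2.1 c - a) / extent B c := by
    obtain ⟨y, hy, hye⟩ := exists_minOn_eq (rank true c B) ⟨xa, hxaL⟩ V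
    refine le_antisymm ?_ ?_
    · refine (minOn_le (rank true c B) hxaL V).trans (le_of_eq ?_)
      simp [rank, hxa']
    · rw [cut, hye]
      simp only [rank, if_true]
      have := hamax ⟨y, hy, rfl⟩
      simp only at this
      gcongr
  have hmulL : (b - B.1 c) / extent B c * extent B c = b - B.1 c := div_mul_cancel₀ _ he.ne'
  have hmulU : (B.2.1 c - a) / extent B c * extent B c = B.2.1 c - a := div_mul_cancel₀ _ he.ne'
  have hrankL : ∀ x ∈ L.nodes, ∀ y ∈ U.nodes, rank false c B (V x) ≤ rank false c B (V y) := by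
    intro x hx y hy
    simp only [rank, Bool.false_eq_true, if_false]
    have := hLU x hx y hy
    gcongr
  have hrankU : ∀ x ∈ U.nodes, ∀ y ∈ L.nodes, rank true c B (V x) ≤ rank true c B (V y) := by
    intro x hx y hy
    simp only [rank, if_true]
    have := hLU y hy x hx
    gcongr
  refine ⟨child false c (cut false c U.nodes B V) B, child true c (cut true c L.nodes B V) B,
    h.child hLR hc' ?_ ?_ ?_ ?_ ?_, h.child hURs hc' ?_ ?_ ?_ ?_ ?_, fun f j => ?_⟩
  · rw [hcutL]; exact div_pos (by linarith [hxaB.1]) he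
  · rw [hcutL, div_le_one he]; linarith [hybB.2]
  · simp only [child, Bool.false_eq_true, if_false]; rw [h.lo_eq, hLlo]
  · simp only [child, Bool.false_eq_true, if_false]
    rw [hcutL, hmulL, hLhi, h.hi_eq]
    congr 1
    ring
  · intro x hx
    obtain ⟨y, hy, hye⟩ := exists_minOn_eq (rank false c B) ⟨yb, hybU⟩ V
    rw [cut, hye]
    exact hrankL x hx y hy
  · rw [hcutU]; exact div_pos (by linarith [hybB.2]) he
  · rw [hcutU, div_le_one he]; linarith [hxaB.1]
  · simp only [child, if_true]
    rw [hcutU, hmulU, hUlo, h.lo_eq]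
    congr 1
    ring
  · simp only [child, if_true]; rw [h.hi_eq, hUhi]
  · intro x hx
    obtain ⟨y, hy, hye⟩ := exists_minOn_eq (rank true c B) ⟨xa, hxaL⟩ V
    rw [cut, hye]
    exact hrankU x hx y hy
  · rw [levelSum, if_pos hR]
    refine le_trans ?_ (single_le_sum (fun _ _ => zero_le) (mem_univ c))
    rw [if_pos hc', Fintype.sum_bool, add_comm]
    refine add_le_add ?_ ?_
    · have hm : U.nodes ∈ R.nodes.powersetCard (halfCard true #R.nodes) := by
        refine mem_powersetCard.2 ⟨hURs, ?_⟩
        rw [hU, card_sdiff_of_subset hLR, hcard]; rfl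
      refine le_trans (le_of_eq ?_) (single_le_sum (fun _ _ => zero_le) hm)
      rw [hRU, if_pos hrankU]
    · have hm : L.nodes ∈ R.nodes.powersetCard (halfCard false #R.nodes) :=
        mem_powersetCard.2 ⟨hLR, hcard⟩
      refine le_trans (le_of_eq ?_) (single_le_sum (fun _ _ => zero_le) hm)
      rw [hRL, if_pos hrankL]

/-- The energy of the paths of iteration `K`. -/
noncomputable def iterationEnergy (ν : ℝ) (V : Fin n → EuclideanSpace ℝ (Fin d)) (K : ℕ)
    (out : List (ℕ × List (Fin n))) : ℝ≥0∞ :=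
  (out.map fun q => if q.1 = K then ENNReal.ofReal (pathEnergy ν V q.2) else 0).sum

lemma iterationEnergy_cons (K : ℕ) (q : ℕ × List (Fin n)) (out : List (ℕ × List (Fin n))) :
    iterationEnergy ν V K (q :: out) =
      (if q.1 = K then ENNReal.ofReal (pathEnergy ν V q.2) else 0) + iterationEnergy ν V K out := by
  simp [iterationEnergy]

lemma iterationEnergy_append (K : ℕ) (o₁ o₂ : List (ℕ × List (Fin n))) :
    iterationEnergy ν V K (o₁ ++ o₂) = iterationEnergy ν V K o₁ + iterationEnergy ν V K o₂ := by
  simp [iterationEnergy]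

lemma iterationEnergy_eq_zero {K : ℕ} {out : List (ℕ × List (Fin n))} (h : ∀ q ∈ out, q.1 ≠ K) :
    iterationEnergy ν V K out = 0 := by
  induction out with
  | nil => simp [iterationEnergy]
  | cons q out ih =>
    rw [iterationEnergy_cons, if_neg (h q (by simp)), ih fun q' hq' => h q' (by simp [hq']), zero_add]

/-- The energy spent in an iteration is bounded by the sum of any bound for single paths. -/
lemma BisectionRun.iterationEnergy_le (hV : ∀ c, Function.Injective fun x => V x c)
    {k : ℕ} {R : Region d n} {i : Fin n} {A : Finset (Fin n)} {out : List (ℕ × List (Fin n))}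
    (h : BisectionRun ν V w k R i A out) :
    ∀ (j K : ℕ), K = k + j →
    ∀ (f : Finset (Fin n) → BoxState d → (Fin n → EuclideanSpace ℝ (Fin d)) → ℝ≥0∞),
    (∀ (R : Region d n) B i j P, Describes V B R → IsLeastEnergyPath ν V R.nodes (w K) j i P →
      ENNReal.ofReal (pathEnergy ν V P) ≤ f R.nodes B V) →
    ∀ B, Describes V B R → iterationEnergy ν V K out ≤ levelSum f j R.nodes B V := by
  have hzero : ∀ {k : ℕ} {R : Region d n} {i A} {out : List (ℕ × List (Fin n))},
      BisectionRun ν V w (k + 1) R i A out → iterationEnergy ν V k out = 0 := by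
    intro k R i A out h
    refine iterationEnergy_eq_zero fun q hq => ?_
    have := (h.path_props q hq).1
    omega
  induction h with
  | halt => intro j K _ f _ B _; simp [iterationEnergy]
  | join k R R₁ R₂ i j A P o₁ o₂ hR hb hi hj hjA hP hr₁ hr₂ ih₁ ih₂ =>
    intro l K hK f hf B hB
    obtain ⟨B₁, B₂, h1, h2, hle⟩ : ∃ B₁ B₂, Describes V B₁ R₁ ∧ Describes V B₂ R₂ ∧
        ∀ j, levelSum f j R₁.nodes B₁ V + levelSum f j R₂.nodes B₂ V ≤
          levelSum f (j + 1) R.nodes B V := by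
      rcases hb with hb | hb
      · obtain ⟨BL, BU, h1, h2, h3⟩ := hb.exists_describes hV hR hB
        exact ⟨BL, BU, h1, h2, h3 f⟩
      · obtain ⟨BL, BU, h1, h2, h3⟩ := hb.exists_describes hV hR hB
        exact ⟨BU, BL, h2, h1, fun j => by rw [add_comm]; exact h3 f j⟩
    rw [iterationEnergy_cons, iterationEnergy_append]
    cases l with
    | zero =>
      subst hK
      rw [hzero hr₁, hzero hr₂, if_pos rfl, add_zero, add_zero]
      exact hf R B i j P hB hP
    | succ l =>
      rw [if_neg (by simp only; omega), zero_add]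
      exact (add_le_add (ih₁ l K (by omega) f hf B₁ h1) (ih₂ l K (by omega) f hf B₂ h2)).trans (hle l)
  | skip k R R₁ R₂ i A o hR hb hi hsub hr ih =>
    intro l K hK f hf B hB
    obtain ⟨B₁, h1, hle⟩ : ∃ B₁, Describes V B₁ R₁ ∧
        ∀ j, levelSum f j R₁.nodes B₁ V ≤ levelSum f (j + 1) R.nodes B V := by
      rcases hb with hb | hb
      · obtain ⟨BL, BU, h1, h2, h3⟩ := hb.exists_describes hV hR hB
        exact ⟨BL, h1, fun j => le_self_add.trans (h3 f j)⟩
      · obtain ⟨BL, BU, h1, h2, h3⟩ := hb.exists_describes hV hR hB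
        exact ⟨BU, h2, fun j => le_add_self.trans (h3 f j)⟩
    cases l with
    | zero =>
      subst hK
      rw [hzero hr]
      exact zero_le
    | succ l => exact (ih l K (by omega) f hf B₁ h1).trans (hle l)

lemma sum_toFinset_le {α : Type*} [DecidableEq α] (g : α → ℝ) (hg : ∀ a, 0 ≤ g a) (l : List α) :
    ∑ a ∈ l.toFinset, g a ≤ (l.map g).sum := by
  induction l with
  | nil => simp
  | cons a l ih =>
    rw [List.toFinset_cons, List.map_cons, List.sum_cons]
    by_cases h : a ∈ l.toFinset
    · rw [insert_eq_of_mem h]; linarith [hg a]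
    · rw [sum_insert h]; linarith

lemma links_aggPolicy_subset {Y : Type} (ψ : Fin n → Y → ℝ) (w : ℕ → ℕ)
    (out : List (ℕ × List (Fin n))) {e : Fin n × Fin n} (he : e ∈ (aggPolicy ψ w out).links) :
    ∃ q ∈ out, e ∈ pathLinks q.2 := by
  obtain ⟨⟨t, i, j⟩, ht, rfl⟩ := mem_image.1 he
  obtain ⟨q, hq, e, -, h1, h2⟩ := mem_aggSchedule.1 ht
  exact ⟨q, hq, List.mem_of_getElem? (mem_pathLinks.2 ⟨h1, h2⟩)⟩

lemma energy_aggPolicy_le {Y : Type} (ψ : Fin n → Y → ℝ) (w : ℕ → ℕ)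
    (out : List (ℕ × List (Fin n))) :
    (aggPolicy ψ w out).energy ν V ≤ (out.map fun q => pathEnergy ν V q.2).sum := by
  have hnn : ∀ e : Fin n × Fin n, 0 ≤ dist (V e.1) (V e.2) ^ ν := fun e => by positivity
  calc (aggPolicy ψ w out).energy ν V
      ≤ ∑ e ∈ (out.flatMap fun q => pathLinks q.2).toFinset, dist (V e.1) (V e.2) ^ ν := by
        refine sum_le_sum_of_subset_of_nonneg (fun e he => ?_) fun e _ _ => hnn e
        obtain ⟨q, hq, h⟩ := links_aggPolicy_subset ψ w out he
        exact List.mem_toFinset.2 (List.mem_flatMap.2 ⟨q, hq, h⟩)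
    _ ≤ _ := sum_toFinset_le _ hnn _
    _ = _ := by
        induction out with
        | nil => simp
        | cons q out ih =>
          rw [List.flatMap_cons, List.map_append, List.sum_append, ih, List.map_cons, List.sum_cons]
          rfl

lemma ofReal_sum_pathEnergy {N : ℕ} (out : List (ℕ × List (Fin n))) (h : ∀ q ∈ out, q.1 < N) :
    ENNReal.ofReal (out.map fun q => pathEnergy ν V q.2).sum =
      ∑ K ∈ range N, iterationEnergy ν V K out := by
  induction out with
  | nil => simp [iterationEnergy]
  | cons q out ih =>
    have hnn : 0 ≤ (out.map fun q => pathEnergy ν V q.2).sum := List.sum_nonneg fun x hx => by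
      obtain ⟨q, -, rfl⟩ := List.mem_map.1 hx
      exact pathEnergy_nonneg ν V _
    simp only [iterationEnergy_cons]
    rw [List.map_cons, List.sum_cons, ENNReal.ofReal_add (pathEnergy_nonneg ν V _) hnn,
      ih fun q' hq' => h q' (by simp [hq']), sum_add_distrib, sum_ite_eq,
      if_pos (mem_range.2 (h q (by simp)))]

/-- The box of the whole cube. -/
noncomputable def wholeBox (d n : ℕ) : BoxState d := (fun _ => 0, fun _ => side d n, 2 * side d n)

lemma describes_whole (hn : 0 < n) (hV : ∀ x, V x ∈ cube d n) :
    Describes V (wholeBox d n) (Region.whole d n) where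
  lo_eq := rfl
  hi_eq := rfl
  extent_pos c := by simp [extent, wholeBox, side_pos d hn]
  fits := by
    refine ⟨1, fun c => ?_⟩
    simp only [extent, wholeBox, sub_zero]
    refine mul_le_mul_of_nonneg_right ?_ (side_nonneg d n)
    have hd : (0 : ℝ) < d := by exact_mod_cast c.pos
    calc (2 : ℝ) ^ ((((1 : Equiv.Perm (Fin d)) c : Fin d) : ℝ) / d) ≤ 2 ^ (1 : ℝ) := by
          refine Real.rpow_le_rpow_of_exponent_le (by norm_num) ((div_le_one hd).2 ?_)
          exact_mod_cast ((1 : Equiv.Perm (Fin d)) c).2.le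
      _ = 2 := Real.rpow_one 2
  mem x _ := hV x

/-- The energy of the aggregation policy in terms of sums over regions. -/
lemma IsBisectionOutput.ofReal_energy_le {Y : Type} (ψ : Fin n → Y → ℝ) {r : Fin n}
    (hV : ∀ c, Function.Injective fun x => V x c) (hV' : ∀ x, V x ∈ cube d n)
    {out : List (ℕ × List (Fin n))} (h : IsBisectionOutput ν V w r out)
    (f : ℕ → Finset (Fin n) → BoxState d → (Fin n → EuclideanSpace ℝ (Fin d)) → ℝ≥0∞)
    (hf : ∀ K (R : Region d n) B i j P, Describes V B R →
      IsLeastEnergyPath ν V R.nodes (w K) j i P →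
      ENNReal.ofReal (pathEnergy ν V P) ≤ f K R.nodes B V) :
    ENNReal.ofReal ((aggPolicy ψ w out).energy ν V) ≤
      ∑ K ∈ range (Nat.clog 2 n), levelSum (f K) K univ (wholeBox d n) V := by
  refine (ENNReal.ofReal_le_ofReal (energy_aggPolicy_le ψ w out)).trans ?_
  rw [ofReal_sum_pathEnergy out h.goodPaths.lt_clog]
  refine sum_le_sum fun K _ => ?_
  exact BisectionRun.iterationEnergy_le hV h K K (zero_add K).symm (f K) (hf K) _
    (describes_whole r.pos hV')

end RunBound

/-! ### The expected energy of an iteration -/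

section Law

variable {d n : ℕ}

lemma lintegral_locationLaw (hd : 1 ≤ d) (hn : 0 < n)
    {g : (Fin n → EuclideanSpace ℝ (Fin d)) → ℝ≥0∞} (W : Fin n → EuclideanSpace ℝ (Fin d)) :
    ∫⁻ V, g V ∂locationLaw d n = ((n : ℝ≥0∞) ^ n)⁻¹ *
      (∫⋯∫⁻_univ, g ∂fun _ => volume.restrict (cube d n)) W := by
  have hn0 : (n : ℝ≥0∞) ≠ 0 := by exact_mod_cast hn.ne'
  have hnt : (n : ℝ≥0∞) ≠ ⊤ := ENNReal.natCast_ne_top n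
  have hfin : IsFiniteMeasure (volume.restrict (cube d n)) :=
    ⟨by rw [Measure.restrict_apply_univ, volume_cube hd]; exact hnt.lt_top⟩
  have hpr := isProbabilityMeasure_cube hd hn
  have e : locationLaw d n =
      ((n : ℝ≥0∞) ^ n)⁻¹ • Measure.pi fun _ : Fin n => volume.restrict (cube d n) := by
    refine Measure.pi_eq fun s hs => ?_
    rw [Measure.smul_apply, Measure.pi_pi, smul_eq_mul]
    simp only [ProbabilityTheory.cond, Measure.smul_apply, smul_eq_mul, volume_cube hd]
    rw [prod_mul_distrib, prod_const, card_univ, Fintype.card_fin, ENNReal.inv_pow]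
  rw [e, lintegral_smul_measure, smul_eq_mul, lmarginal_univ]

/-- The expected sum of a bound for paths over the regions of iteration `K`. -/
theorem lintegral_levelSum_pathBound_le (hd : 1 ≤ d) (hn : 0 < n) {ν : ℝ} (hν : 1 < ν) (K : ℕ)
    {u : ℕ} (hu : 1 ≤ u) :
    ∫⁻ V, levelSum (pathBound ν u) K univ (wholeBox d n) V ∂locationLaw d n ≤
      ENNReal.ofReal (2 ^ ν * Real.exp (20 * 2 ^ ν) * d ^ d * √d ^ ν *
        ((n : ℝ) ^ (ν / d) * (2 * 2 ^ (-(ν / d))) ^ K *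
        (3 ^ ν * (u : ℝ) ^ (1 - ν) +
          (u : ℝ) ^ d * Real.exp (-(((n + 1) / 2 ^ K - 1) / (u : ℝ) ^ d))))) := by
  have hn0 : (n : ℝ≥0∞) ≠ 0 := by exact_mod_cast hn.ne'
  have hnt : (n : ℝ≥0∞) ≠ ⊤ := ENNReal.natCast_ne_top n
  have hsd := side_pos d hn
  have hext : ∀ c, 0 < extent (wholeBox d n) c := fun c => by
    simp [extent, wholeBox, hsd]
  have hcube : (wholeBox d n).toSet = cube d n := rfl
  have hne : (univ : Finset (Fin n)).Nonempty := ⟨⟨0, hn⟩, mem_univ _⟩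
  set X : ℝ := (n + 1) / 2 ^ K with hX
  set b : ℝ := √d ^ ν * (3 ^ ν * (u : ℝ) ^ (1 - ν) +
    (u : ℝ) ^ d * Real.exp (-((X - 1) / (u : ℝ) ^ d))) with hb
  have hb0 : 0 ≤ b := by positivity
  have h := lmarginal_levelSum_le hd hν (X := X) (γ := ENNReal.ofReal b)
    (f := pathBound ν u) (measurable_pathBound ν u)
    (fun S B W h1 _ h3 h4 => lmarginal_pathBound_le hu S B W h1 h3 h4) K univ (wholeBox d n)
    (fun _ => 0) (by rw [hX, div_mul_cancel₀ _ (by positivity)]; simp) hne hext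
    (by simp [wholeBox, hsd])
  rw [hcube, volume_cube hd, card_univ, Fintype.card_fin] at h
  rw [lintegral_locationLaw hd hn (fun _ => 0)]
  refine (mul_le_mul_right h _).trans ?_
  rw [← mul_assoc, ENNReal.inv_mul_cancel (pow_ne_zero _ hn0) (ENNReal.pow_ne_top hnt), one_mul]
  have htie : (d : ℝ≥0∞) ^ tieCount (wholeBox d n) ≤ ENNReal.ofReal ((d : ℝ) ^ d) := by
    rw [ENNReal.ofReal_pow (Nat.cast_nonneg d), ENNReal.ofReal_natCast]
    refine pow_le_pow_right₀ (by exact_mod_cast hd) ?_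
    exact (card_le_univ _).trans (Fintype.card_fin d).le
  have hq : (0 : ℝ) ≤ 2 * 2 ^ (-(ν / d)) := by positivity
  refine (mul_le_mul_left (mul_le_mul_right htie _) _).trans ?_
  have e1 : (wholeBox d n).2.2 ^ ν = 2 ^ ν * (n : ℝ) ^ (ν / d) := by
    simp only [wholeBox]
    rw [Real.mul_rpow (by norm_num) hsd.le, side_rpow]
  rw [e1, ← ENNReal.ofReal_mul (by have := (growth_pos ν n).le; positivity),
    ← ENNReal.ofReal_mul (by have := (growth_pos ν n).le; positivity)]
  refine ENNReal.ofReal_le_ofReal ?_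
  calc 2 ^ ν * (n : ℝ) ^ (ν / d) * (growth ν n * (2 * 2 ^ (-(ν / d))) ^ K) * (d : ℝ) ^ d * b
      ≤ 2 ^ ν * (n : ℝ) ^ (ν / d) * (Real.exp (20 * 2 ^ ν) * (2 * 2 ^ (-(ν / d))) ^ K) *
        (d : ℝ) ^ d * b := by
        gcongr
        exact growth_le ν n
    _ = _ := by rw [hb]; ring

end Law

/-! ### Sums over the iterations -/

section Sums

variable {d n : ℕ} {ν δ : ℝ}

lemma two_pow_lt_of_lt_clog {K : ℕ} (hK : K < Nat.clog 2 n) : 2 ^ K < n :=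
  (Nat.lt_clog_iff_pow_lt (by norm_num)).1 hK

lemma two_pow_clog_le (hn : 2 ≤ n) : (2 : ℝ) ^ Nat.clog 2 n ≤ 2 * n := by
  have h1 : 1 ≤ Nat.clog 2 n := Nat.clog_pos (by norm_num) hn
  have h2 : 2 ^ (Nat.clog 2 n - 1) < n := two_pow_lt_of_lt_clog (by omega)
  have h3 : 2 ^ Nat.clog 2 n ≤ 2 * n := by
    obtain ⟨k, hk⟩ : ∃ k, Nat.clog 2 n = k + 1 := ⟨_, (Nat.sub_add_cancel h1).symm⟩
    rw [hk] at h2 ⊢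
    rw [pow_succ]
    simp only [Nat.add_sub_cancel] at h2
    omega
  exact_mod_cast h3

lemma two_pow_mul_rpow (n K : ℕ) (θ : ℝ) :
    (2 : ℝ) ^ K * ((n : ℝ) / 2 ^ K) ^ θ = (n : ℝ) ^ θ * ((2 : ℝ) ^ (1 - θ)) ^ K := by
  rw [Real.div_rpow (Nat.cast_nonneg n) (by positivity), ← Real.rpow_natCast, ← Real.rpow_natCast,
    ← Real.rpow_mul (by norm_num), ← Real.rpow_mul (by norm_num), sub_mul, one_mul,
    Real.rpow_sub (by norm_num), mul_comm θ]
  ring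

/-- If the number of regions grows faster than their energies decay, the last level dominates. -/
lemma sum_two_pow_mul_rpow_le {θ : ℝ} (hθ : θ < 1) : ∃ C : ℝ, 0 < C ∧ ∀ n : ℕ, 2 ≤ n →
    ∑ K ∈ range (Nat.clog 2 n), (2 : ℝ) ^ K * ((n : ℝ) / 2 ^ K) ^ θ ≤ C * n := by
  have hq : (1 : ℝ) < 2 ^ (1 - θ) := Real.one_lt_rpow (by norm_num) (by linarith)
  have hq' : (0 : ℝ) < 2 ^ (1 - θ) - 1 := by linarith
  refine ⟨2 ^ (1 - θ) / (2 ^ (1 - θ) - 1), by positivity, fun n hn => ?_⟩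
  have hn0 : (0 : ℝ) < n := by exact_mod_cast (by omega : 0 < n)
  simp only [two_pow_mul_rpow]
  rw [← mul_sum, geom_sum_eq hq.ne']
  have h1 : ((2 : ℝ) ^ (1 - θ)) ^ Nat.clog 2 n ≤ 2 ^ (1 - θ) * (n : ℝ) ^ (1 - θ) := by
    rw [← Real.mul_rpow (by norm_num) hn0.le, ← Real.rpow_natCast, ← Real.rpow_mul (by norm_num),
      mul_comm, Real.rpow_mul (by norm_num), Real.rpow_natCast]
    exact Real.rpow_le_rpow (by positivity) (two_pow_clog_le hn) (by linarith)
  calc (n : ℝ) ^ θ * ((((2 : ℝ) ^ (1 - θ)) ^ Nat.clog 2 n - 1) / (2 ^ (1 - θ) - 1))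
      ≤ (n : ℝ) ^ θ * ((2 ^ (1 - θ) * (n : ℝ) ^ (1 - θ)) / (2 ^ (1 - θ) - 1)) := by
        gcongr; linarith
    _ = 2 ^ (1 - θ) / (2 ^ (1 - θ) - 1) * ((n : ℝ) ^ θ * (n : ℝ) ^ (1 - θ)) := by ring
    _ = _ := by rw [← Real.rpow_add hn0]; simp

lemma half_le_one_add_floor {y : ℝ} : (1 + y) / 2 ≤ 1 + (⌊y⌋₊ : ℝ) := by
  have h1 := Nat.lt_floor_add_one y
  have h2 : (0 : ℝ) ≤ ⌊y⌋₊ := Nat.cast_nonneg _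
  linarith

lemma clog_le_log (hn : 2 ≤ n) : (Nat.clog 2 n : ℝ) ≤ 3 * Real.log n := by
  have hn0 : (0 : ℝ) < n := by exact_mod_cast (by omega : 0 < n)
  have h1 := Real.log_le_log (by positivity) (two_pow_clog_le hn)
  rw [Real.log_pow, Real.log_mul (by norm_num) hn0.ne'] at h1
  have h2 : Real.log 2 ≤ Real.log n := Real.log_le_log (by norm_num) (by exact_mod_cast hn)
  have h3 := Real.log_two_gt_d9
  have h4 : (0 : ℝ) ≤ Nat.clog 2 n := Nat.cast_nonneg _
  nlinarith

lemma zeta_nonneg (hd : 1 ≤ d) (h : (d : ℝ) ≤ ν) (n : ℕ) : 0 ≤ zeta d ν n := by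
  have hd0 : (0 : ℝ) < d := by exact_mod_cast hd
  unfold zeta
  split_ifs
  · positivity
  · rw [sub_nonneg]
    refine Real.rpow_le_one_of_one_le_of_nonpos (by norm_num) (sub_nonpos.2 ?_)
    exact one_div_le_one_div_of_le hd0 h

/-- The weights respect the latency budget. -/
lemma sum_weight_le (hd : 1 ≤ d) (hδ : 0 ≤ δ) :
    (∑ K ∈ range (Nat.clog 2 n), (weight d ν n δ K : ℝ)) ≤ δ := by
  have hd0 : (0 : ℝ) < d := by exact_mod_cast hd
  rcases lt_or_ge ν d with h | h
  · simp [weight, h, hδ]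
  have hle : ∀ K, (weight d ν n δ K : ℝ) ≤
      zeta d ν n * δ * ((2 : ℝ) ^ (1 / ν - 1 / (d : ℝ))) ^ K := by
    intro K
    rw [weight, if_neg (not_lt.2 h)]
    refine (Nat.floor_le ?_).trans (le_of_eq ?_)
    · have := zeta_nonneg hd h n
      positivity
    · rw [← Real.rpow_natCast, ← Real.rpow_mul (by norm_num), mul_comm (K : ℝ)]
  refine (sum_le_sum fun K _ => hle K).trans ?_
  rw [← mul_sum]
  rcases h.eq_or_lt with heq | hlt
  · subst heq
    simp only [zeta, if_true, sub_self, Real.rpow_zero, one_pow, sum_const, card_range, nsmul_eq_mul,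
      mul_one]
    rcases Nat.eq_zero_or_pos (Nat.clog 2 n) with h0 | h0
    · simp [h0, hδ]
    · have : (0 : ℝ) < Nat.clog 2 n := by exact_mod_cast h0
      refine le_of_eq ?_
      field_simp
  · have hq : (2 : ℝ) ^ (1 / ν - 1 / (d : ℝ)) < 1 := by
      refine Real.rpow_lt_one_of_one_lt_of_neg (by norm_num) (sub_neg.2 ?_)
      exact one_div_lt_one_div_of_lt hd0 hlt
    rw [zeta, if_neg hlt.ne']
    have h1 := mul_neg_geom_sum ((2 : ℝ) ^ (1 / ν - 1 / (d : ℝ))) (Nat.clog 2 n)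
    have h2 : 0 ≤ ((2 : ℝ) ^ (1 / ν - 1 / (d : ℝ))) ^ Nat.clog 2 n := by positivity
    rw [mul_right_comm, h1]
    nlinarith

lemma le_rate (n : ℕ) : (n : ℝ) ≤ rate d ν n δ := by
  unfold rate
  split_ifs
  exacts [le_rfl, le_max_left _ _, le_max_left _ _]

/-- The weights balance the energies of the levels. -/
lemma sum_weight_energy_le (hd : 1 ≤ d) (hν : 1 < ν) : ∃ C : ℝ, 0 < C ∧ ∀ n : ℕ, 2 ≤ n → ∀ δ : ℝ,
    0 ≤ δ → ∑ K ∈ range (Nat.clog 2 n), (2 : ℝ) ^ K * ((n : ℝ) / 2 ^ K) ^ (ν / d) *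
      (1 + (weight d ν n δ K : ℝ)) ^ (1 - ν) ≤ C * rate d ν n δ := by
  have hd0 : (0 : ℝ) < d := by exact_mod_cast hd
  have hν1 : 1 - ν ≤ 0 := by linarith
  rcases lt_trichotomy ν d with h | h | h
  · obtain ⟨C, hC, hs⟩ := sum_two_pow_mul_rpow_le (θ := ν / d) ((div_lt_one hd0).2 h)
    refine ⟨C, hC, fun n hn δ _ => ?_⟩
    simpa [weight, rate, h] using hs n hn
  · refine ⟨3 * 6 ^ (ν - 1), by positivity, fun n hn δ hδ => ?_⟩
    have hn0 : (0 : ℝ) < n := by exact_mod_cast (by omega : 0 < n)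
    have hlog : 0 < Real.log n := Real.log_pos (by exact_mod_cast (by omega : 1 < n))
    have hcl : (0 : ℝ) < Nat.clog 2 n := by
      exact_mod_cast Nat.clog_pos (by norm_num) hn
    have hle := clog_le_log hn
    have hterm : ∀ K, (2 : ℝ) ^ K * ((n : ℝ) / 2 ^ K) ^ (ν / d) *
        (1 + (weight d ν n δ K : ℝ)) ^ (1 - ν) ≤
        n * (6 ^ (ν - 1) * (1 + δ / Real.log n) ^ (1 - ν)) := by
      intro K
      have e1 : (2 : ℝ) ^ K * ((n : ℝ) / 2 ^ K) ^ (ν / d) = n := by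
        rw [h, div_self hd0.ne', Real.rpow_one, mul_div_cancel₀ _ (by positivity)]
      rw [e1]
      refine mul_le_mul_of_nonneg_left ?_ hn0.le
      have e2 : (6 : ℝ) ^ (ν - 1) * (1 + δ / Real.log n) ^ (1 - ν) =
          ((1 + δ / Real.log n) / 6) ^ (1 - ν) := by
        rw [Real.div_rpow (by positivity) (by norm_num), ← neg_sub ν 1, Real.rpow_neg (by norm_num : (0:ℝ) ≤ 6)]
        field_simp
      rw [e2]
      refine Real.rpow_le_rpow_of_nonpos (by positivity) ?_ hν1
      have hw : (weight d ν n δ K : ℝ) = (⌊δ / Nat.clog 2 n⌋₊ : ℝ) := by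
        rw [weight, if_neg (by rw [h]; exact lt_irrefl _), zeta, if_pos h, h]
        simp [inv_mul_eq_div]
      rw [hw]
      refine le_trans ?_ half_le_one_add_floor
      have h3 : δ / Real.log n / 3 ≤ δ / Nat.clog 2 n := by
        rw [div_div, mul_comm]
        gcongr
      linarith
    refine (sum_le_sum fun K _ => hterm K).trans ?_
    rw [sum_const, card_range, nsmul_eq_mul, rate, if_neg (by rw [h]; exact lt_irrefl _), if_pos h]
    calc (Nat.clog 2 n : ℝ) * (n * (6 ^ (ν - 1) * (1 + δ / Real.log n) ^ (1 - ν)))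
        ≤ 3 * Real.log n * (n * (6 ^ (ν - 1) * (1 + δ / Real.log n) ^ (1 - ν))) := by gcongr
      _ = 3 * 6 ^ (ν - 1) * (n * Real.log n * (1 + δ / Real.log n) ^ (1 - ν)) := by ring
      _ ≤ _ := mul_le_mul_of_nonneg_left (le_max_right _ _) (by positivity)
  · set q : ℝ := (2 : ℝ) ^ (1 / ν - 1 / (d : ℝ)) with hq
    have hq0 : 0 < q := by positivity
    have hq1 : q < 1 := by
      refine Real.rpow_lt_one_of_one_lt_of_neg (by norm_num) (sub_neg.2 ?_)
      exact one_div_lt_one_div_of_lt hd0 h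
    have hz : 0 < 1 - q := by linarith
    refine ⟨((1 - q) / 2) ^ (1 - ν) * (1 - q)⁻¹, by positivity, fun n hn δ hδ => ?_⟩
    have hn0 : (0 : ℝ) < n := by exact_mod_cast (by omega : 0 < n)
    have hterm : ∀ K, (2 : ℝ) ^ K * ((n : ℝ) / 2 ^ K) ^ (ν / d) *
        (1 + (weight d ν n δ K : ℝ)) ^ (1 - ν) ≤
        ((1 - q) / 2) ^ (1 - ν) * ((n : ℝ) ^ (ν / d) * (1 + δ) ^ (1 - ν)) * q ^ K := by
      intro K
      have hqK : q ^ K ≤ 1 := pow_le_one₀ hq0.le hq1.le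
      have hqK0 : 0 < q ^ K := by positivity
      have hw : (weight d ν n δ K : ℝ) = (⌊(1 - q) * δ * q ^ K⌋₊ : ℝ) := by
        rw [weight, if_neg (not_lt.2 h.le), zeta, if_neg h.ne', hq, ← Real.rpow_natCast,
          ← Real.rpow_mul (by norm_num), mul_comm (K : ℝ)]
      have h1 : (1 - q) / 2 * (1 + δ) * q ^ K ≤ 1 + (weight d ν n δ K : ℝ) := by
        rw [hw]
        refine le_trans ?_ half_le_one_add_floor
        have : (1 - q) * q ^ K ≤ 1 := by nlinarith
        nlinarith
      have h2 := Real.rpow_le_rpow_of_nonpos (by positivity) h1 hν1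
      have e1 : ((2 : ℝ) ^ (1 - ν / d)) ^ K * (q ^ K) ^ (1 - ν) = q ^ K := by
        rw [hq, ← Real.rpow_natCast _ K, ← Real.rpow_natCast _ K]
        simp only [← Real.rpow_mul (zero_le_two : (0 : ℝ) ≤ 2)]
        rw [← Real.rpow_add (by norm_num)]
        congr 1
        field_simp
        ring
      calc (2 : ℝ) ^ K * ((n : ℝ) / 2 ^ K) ^ (ν / d) * (1 + (weight d ν n δ K : ℝ)) ^ (1 - ν)
          ≤ (2 : ℝ) ^ K * ((n : ℝ) / 2 ^ K) ^ (ν / d) *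
            ((1 - q) / 2 * (1 + δ) * q ^ K) ^ (1 - ν) := by gcongr
        _ = (n : ℝ) ^ (ν / d) * (((1 - q) / 2) ^ (1 - ν) * (1 + δ) ^ (1 - ν)) *
            (((2 : ℝ) ^ (1 - ν / d)) ^ K * (q ^ K) ^ (1 - ν)) := by
            rw [two_pow_mul_rpow, Real.mul_rpow (by positivity) hqK0.le,
              Real.mul_rpow (by positivity) (by positivity)]
            ring
        _ = _ := by rw [e1]; ring
    refine (sum_le_sum fun K _ => hterm K).trans ?_
    rw [← mul_sum, rate, if_neg (not_lt.2 h.le), if_neg h.ne']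
    have hgeom : ∑ K ∈ range (Nat.clog 2 n), q ^ K ≤ (1 - q)⁻¹ := by
      have h1 := mul_neg_geom_sum q (Nat.clog 2 n)
      have h2 : 0 ≤ q ^ Nat.clog 2 n := by positivity
      rw [← one_div, le_div_iff₀ hz]
      linarith
    calc ((1 - q) / 2) ^ (1 - ν) * ((n : ℝ) ^ (ν / d) * (1 + δ) ^ (1 - ν)) *
          ∑ K ∈ range (Nat.clog 2 n), q ^ K
        ≤ ((1 - q) / 2) ^ (1 - ν) * (max (n : ℝ) ((n : ℝ) ^ (ν / d) * (1 + δ) ^ (1 - ν))) *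
          (1 - q)⁻¹ := by
          gcongr
          exact le_max_right _ _
      _ = _ := by ring

end Sums

/-! ### The upper bound in dimension at least two -/

section Choice

variable {d : ℕ} {ν : ℝ}

lemma rpow_le_exp (p : ℝ) : ∃ C : ℝ, 0 < C ∧ ∀ y : ℝ, 1 ≤ y → y ^ p ≤ C * Real.exp y := by
  refine ⟨(⌈p⌉₊.factorial : ℝ), by positivity, fun y hy => ?_⟩
  have h1 : y ^ p ≤ y ^ (⌈p⌉₊ : ℝ) := Real.rpow_le_rpow_of_exponent_le hy (Nat.le_ceil p)
  rw [Real.rpow_natCast] at h1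
  have h2 := Real.pow_div_factorial_le_exp y (by linarith) ⌈p⌉₊
  rw [div_le_iff₀ (by positivity)] at h2
  linarith

/-- With `u = min (w + 1) ⌊x ^ a⌋` cells per side for about `x` nodes, all cells are hit up to a
negligible probability. -/
lemma pathBound_expectation_le (hd : 1 ≤ d) (hν : 1 < ν) {a : ℝ} (ha0 : 0 < a) (ha : a * d < 1) :
    ∃ C : ℝ, 0 < C ∧ ∀ (x y : ℝ) (w u : ℕ), 1 ≤ x → x ≤ y → u = min (w + 1) ⌊x ^ a⌋₊ →
      1 ≤ u ∧ 3 ^ ν * (u : ℝ) ^ (1 - ν) + (u : ℝ) ^ d * Real.exp (-((y - 1) / (u : ℝ) ^ d)) ≤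
        C * ((1 + (w : ℝ)) ^ (1 - ν) + x ^ (-(a * (ν - 1)))) := by
  have hν1 : 1 - ν ≤ 0 := by linarith
  set b := a * d with hb
  have hb0 : 0 < b := by have : (0 : ℝ) < d := by exact_mod_cast hd
                         positivity
  obtain ⟨C₀, hC₀, hC⟩ := rpow_le_exp ((b + a * (ν - 1)) / (1 - b))
  refine ⟨3 ^ ν * 2 ^ (ν - 1) + C₀ * Real.exp 1 + 3 ^ ν, by positivity, fun x y w u hx hxy hu => ?_⟩
  have hx0 : 0 < x := by linarith
  have hxa : 1 ≤ x ^ a := Real.one_le_rpow hx ha0.le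
  have hfl : 1 ≤ ⌊x ^ a⌋₊ := Nat.one_le_floor_iff _ |>.2 hxa
  have hu1 : 1 ≤ u := by rw [hu]; exact le_min (by omega) hfl
  have hu0 : (0 : ℝ) < u := by exact_mod_cast hu1
  refine ⟨hu1, ?_⟩
  have h1 : (u : ℝ) ^ (1 - ν) ≤ (1 + (w : ℝ)) ^ (1 - ν) + 2 ^ (ν - 1) * x ^ (-(a * (ν - 1))) := by
    have hA : 0 ≤ (1 + (w : ℝ)) ^ (1 - ν) := by positivity
    have hB : 0 ≤ 2 ^ (ν - 1) * x ^ (-(a * (ν - 1))) := by positivity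
    rcases le_total (w + 1) ⌊x ^ a⌋₊ with h | h
    · rw [hu, min_eq_left h]
      push_cast
      rw [add_comm (w : ℝ)]
      linarith
    · rw [hu, min_eq_right h]
      have h2 : x ^ a / 2 ≤ (⌊x ^ a⌋₊ : ℝ) := by
        have h3 := Nat.lt_floor_add_one (x ^ a)
        have h4 : (1 : ℝ) ≤ ⌊x ^ a⌋₊ := by exact_mod_cast hfl
        linarith
      have h5 := Real.rpow_le_rpow_of_nonpos (by positivity) h2 hν1
      have e : (x ^ a / 2) ^ (1 - ν) = 2 ^ (ν - 1) * x ^ (-(a * (ν - 1))) := by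
        rw [Real.div_rpow (by positivity) (by norm_num), ← Real.rpow_mul hx0.le,
          ← neg_sub ν 1, Real.rpow_neg (by norm_num : (0 : ℝ) ≤ 2), mul_neg]
        field_simp
      linarith
  have h2 : (u : ℝ) ^ d * Real.exp (-((y - 1) / (u : ℝ) ^ d)) ≤
      C₀ * Real.exp 1 * x ^ (-(a * (ν - 1))) := by
    have hud : (u : ℝ) ^ d ≤ x ^ b := by
      rw [hb, Real.rpow_mul hx0.le, Real.rpow_natCast]
      refine pow_le_pow_left₀ hu0.le ?_ d
      have : (u : ℝ) ≤ ⌊x ^ a⌋₊ := by rw [hu]; exact_mod_cast min_le_right _ _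
      exact this.trans (Nat.floor_le (by positivity))
    have hud0 : (0 : ℝ) < (u : ℝ) ^ d := by positivity
    have hxb : 0 < x ^ b := by positivity
    have h3 : x ^ (1 - b) - 1 ≤ (y - 1) / (u : ℝ) ^ d := by
      have e1 : x ^ (1 - b) = x / x ^ b := by rw [Real.rpow_sub hx0, Real.rpow_one]
      have h4 : (x - 1) / x ^ b ≤ (y - 1) / (u : ℝ) ^ d :=
        div_le_div₀ (by linarith) (by linarith) hud0 hud
      have h5 : 1 / x ^ b ≤ 1 := by
        rw [div_le_one hxb]; exact Real.one_le_rpow hx hb0.le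
      rw [sub_div] at h4
      rw [e1]
      linarith
    have h6 := hC (x ^ (1 - b)) (Real.one_le_rpow hx (by linarith))
    rw [← Real.rpow_mul hx0.le, mul_div_cancel₀ _ (by linarith : (1 - b) ≠ 0)] at h6
    calc (u : ℝ) ^ d * Real.exp (-((y - 1) / (u : ℝ) ^ d))
        ≤ x ^ b * Real.exp (1 - x ^ (1 - b)) := by
          gcongr
          linarith
      _ = x ^ (b + a * (ν - 1)) * x ^ (-(a * (ν - 1))) * (Real.exp 1 * Real.exp (-x ^ (1 - b))) := by
          rw [← Real.rpow_add hx0, ← Real.exp_add]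
          congr 2
          ring
      _ ≤ C₀ * Real.exp (x ^ (1 - b)) * x ^ (-(a * (ν - 1))) *
          (Real.exp 1 * Real.exp (-x ^ (1 - b))) := by gcongr
      _ = C₀ * Real.exp 1 * x ^ (-(a * (ν - 1))) *
          (Real.exp (x ^ (1 - b)) * Real.exp (-x ^ (1 - b))) := by ring
      _ = _ := by rw [← Real.exp_add]; simp
  have hA : 0 ≤ (1 + (w : ℝ)) ^ (1 - ν) := by positivity
  have hB : 0 ≤ x ^ (-(a * (ν - 1))) := by positivity
  have h3 := mul_le_mul_of_nonneg_left h1 (by positivity : (0 : ℝ) ≤ 3 ^ ν)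
  have p1 : 0 ≤ 3 ^ ν * 2 ^ (ν - 1) * (1 + (w : ℝ)) ^ (1 - ν) := by positivity
  have p2 : 0 ≤ C₀ * Real.exp 1 * (1 + (w : ℝ)) ^ (1 - ν) := by positivity
  have p3 : 0 ≤ 3 ^ ν * x ^ (-(a * (ν - 1))) := by positivity
  nlinarith

/-- Almost surely the energy of the aggregation policy, however the open choices are made, is at
most a measurable function of the locations whose expectation is `O(rate d ν n δ)`. -/
def HasEnergyBound (d : ℕ) (ν : ℝ) : Prop :=
  ∃ C : ℝ, 0 < C ∧ ∀ n : ℕ, 2 ≤ n → ∀ δ : ℝ, 0 ≤ δ →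
    ∃ G : (Fin n → EuclideanSpace ℝ (Fin d)) → ℝ≥0∞, Measurable G ∧
      ∫⁻ V, G V ∂locationLaw d n ≤ ENNReal.ofReal (C * rate d ν n δ) ∧
      ∀ᵐ V ∂locationLaw d n, ∀ (Y : Type) (ψ : Fin n → Y → ℝ) (r : Fin n)
        (out : List (ℕ × List (Fin n))), IsBisectionOutput ν V (weight d ν n δ) r out →
        ENNReal.ofReal ((aggPolicy ψ (weight d ν n δ) out).energy ν V) ≤ G V

theorem hasEnergyBound_of_two_le (hd : 2 ≤ d) (hν : 1 < ν) : HasEnergyBound d ν := by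
  have hd1 : 1 ≤ d := by omega
  have hd2 : (2 : ℝ) ≤ d := by exact_mod_cast hd
  have hd0 : (0 : ℝ) < d := by linarith
  have hν0 : 0 < ν - 1 := by linarith
  -- an exponent `a` for which both the cells are hit and the levels sum up geometrically
  obtain ⟨a, ha1, ha2⟩ : ∃ a : ℝ, max 0 ((ν / d - 1) / (ν - 1)) < a ∧ a < 1 / d := by
    refine exists_between (max_lt (by positivity) ?_)
    rw [div_lt_div_iff₀ hν0 hd0, sub_mul, div_mul_cancel₀ _ hd0.ne']
    linarith
  have ha0 : 0 < a := (le_max_left _ _).trans_lt ha1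
  have had : a * d < 1 := by rwa [lt_div_iff₀ hd0] at ha2
  have hθ : ν / d - a * (ν - 1) < 1 := by
    have := (le_max_right 0 ((ν / d - 1) / (ν - 1))).trans_lt ha1
    rw [div_lt_iff₀ hν0] at this
    linarith
  obtain ⟨C₁, hC₁, h1⟩ := pathBound_expectation_le hd1 hν ha0 had
  obtain ⟨C₂, hC₂, h2⟩ := sum_two_pow_mul_rpow_le hθ
  obtain ⟨C₃, hC₃, h3⟩ := sum_weight_energy_le hd1 hν
  set C₀ : ℝ := 2 ^ ν * Real.exp (20 * 2 ^ ν) * d ^ d * √d ^ ν with hC₀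
  have hC₀0 : 0 < C₀ := by have : 0 < √(d : ℝ) := Real.sqrt_pos.2 hd0
                           positivity
  refine ⟨C₀ * C₁ * (C₃ + C₂), by positivity, fun n hn δ hδ => ?_⟩
  have hn0 : 0 < n := by omega
  have hnr : (0 : ℝ) < n := by exact_mod_cast hn0
  set w := weight d ν n δ with hw
  set u : ℕ → ℕ := fun K => min (w K + 1) ⌊((n : ℝ) / 2 ^ K) ^ a⌋₊ with hu
  have hx : ∀ K ∈ range (Nat.clog 2 n), 1 ≤ (n : ℝ) / 2 ^ K := by
    intro K hK
    rw [one_le_div (by positivity)]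
    exact_mod_cast (two_pow_lt_of_lt_clog (mem_range.1 hK)).le
  have hxy : ∀ K, (n : ℝ) / 2 ^ K ≤ ((n : ℝ) + 1) / 2 ^ K := fun K => by gcongr; linarith
  have hmeas : ∀ K, Measurable fun V : Fin n → EuclideanSpace ℝ (Fin d) =>
      levelSum (pathBound ν (u K)) K univ (wholeBox d n) V :=
    fun K => measurable_of_prod (g := fun B V => levelSum (pathBound ν (u K)) K univ B V)
      (measurable_levelSum (measurable_pathBound ν (u K)) K univ) _
  refine ⟨fun V => ∑ K ∈ range (Nat.clog 2 n), levelSum (pathBound ν (u K)) K univ (wholeBox d n) V,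
    Finset.measurable_sum _ fun K _ => hmeas K, ?_, ?_⟩
  · rw [lintegral_finsetSum _ fun K _ => hmeas K]
    have hK : ∀ K ∈ range (Nat.clog 2 n),
        ∫⁻ V, levelSum (pathBound ν (u K)) K univ (wholeBox d n) V ∂locationLaw d n ≤
        ENNReal.ofReal (C₀ * C₁ * ((2 : ℝ) ^ K * ((n : ℝ) / 2 ^ K) ^ (ν / d) *
          (1 + (w K : ℝ)) ^ (1 - ν) + (2 : ℝ) ^ K * ((n : ℝ) / 2 ^ K) ^ (ν / d - a * (ν - 1)))) := by
      intro K hK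
      obtain ⟨hu1, hle⟩ := h1 ((n : ℝ) / 2 ^ K) (((n : ℝ) + 1) / 2 ^ K) (w K) (u K) (hx K hK) (hxy K) rfl
      refine (lintegral_levelSum_pathBound_le hd1 hn0 hν K hu1).trans (ENNReal.ofReal_le_ofReal ?_)
      have e : (n : ℝ) ^ (ν / d) * (2 * 2 ^ (-(ν / d))) ^ K = (2 : ℝ) ^ K * ((n : ℝ) / 2 ^ K) ^ (ν / d) := by
        rw [two_pow_mul_rpow]
        congr 2
        rw [sub_eq_add_neg, Real.rpow_add (by norm_num), Real.rpow_one]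
      have hx0 : (0 : ℝ) < (n : ℝ) / 2 ^ K := by positivity
      rw [← hC₀, e]
      calc C₀ * ((2 : ℝ) ^ K * ((n : ℝ) / 2 ^ K) ^ (ν / d) * _)
          ≤ C₀ * ((2 : ℝ) ^ K * ((n : ℝ) / 2 ^ K) ^ (ν / d) * (C₁ * ((1 + (w K : ℝ)) ^ (1 - ν) +
            ((n : ℝ) / 2 ^ K) ^ (-(a * (ν - 1)))))) := by gcongr
        _ = _ := by
            rw [sub_eq_add_neg (ν / d), Real.rpow_add hx0]
            ring
    refine (sum_le_sum hK).trans ?_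
    rw [← ENNReal.ofReal_sum_of_nonneg fun K _ => by positivity]
    refine ENNReal.ofReal_le_ofReal ?_
    rw [← mul_sum, sum_add_distrib, mul_assoc (C₀ * C₁)]
    refine mul_le_mul_of_nonneg_left ?_ (by positivity)
    have h4 := h3 n hn δ hδ
    have h5 := h2 n hn
    have h6 := mul_le_mul_of_nonneg_left (le_rate (d := d) (ν := ν) (δ := δ) n) hC₂.le
    rw [add_mul]
    linarith
  · filter_upwards [ae_mem_cube hd1 hn0, ae_coord_ne hd1 hn0] with V hV hV' Y ψ r out hout
    -- beyond the last iteration `u K` may be `0`, and `pathBound` is then no bound for a path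
    refine (hout.ofReal_energy_le ψ hV' hV (fun K => if K < Nat.clog 2 n then pathBound ν (u K) else
      fun _ _ _ => ⊤) ?_).trans (le_of_eq ?_)
    · intro K R B i j P hB hP
      by_cases hK : K < Nat.clog 2 n
      · simp only [hK, if_true]
        have hu1 := (h1 ((n : ℝ) / 2 ^ K) (((n : ℝ) + 1) / 2 ^ K) (w K) (u K)
          (hx K (mem_range.2 hK)) (hxy K) rfl).1
        exact hP.ofReal_pathEnergy_le (by linarith) hB.mem hB.extent_pos
          (hB.fits.extent_le hB.extent_pos) (hB.bound_pos hd1).le hu1 (min_le_left _ _)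
      · simp only [hK, if_false, le_top]
    · refine sum_congr rfl fun K hK => ?_
      simp only [mem_range.1 hK, if_true]

end Choice

/-! ### Paths on the line -/

section Line

variable {n : ℕ} {ν : ℝ} {V : Fin n → EuclideanSpace ℝ (Fin 1)} {w : ℕ → ℕ}

/-- On the line, `y` is the next node of `S` to the right of `x`. -/
def Adjacent (V : Fin n → EuclideanSpace ℝ (Fin 1)) (S : Finset (Fin n)) (x y : Fin n) : Prop :=
  V x 0 < V y 0 ∧ ∀ z ∈ S, V z 0 ≤ V x 0 ∨ V y 0 ≤ V z 0

open Classical in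
/-- The sum of the `ν`-th powers of the gaps between consecutive nodes of `S`. -/
noncomputable def gapSum (ν : ℝ) (V : Fin n → EuclideanSpace ℝ (Fin 1)) (S : Finset (Fin n)) : ℝ :=
  ∑ x ∈ S, ∑ y ∈ S, if Adjacent V S x y then (V y 0 - V x 0) ^ ν else 0

lemma dist_line (x y : EuclideanSpace ℝ (Fin 1)) : dist x y = |x 0 - y 0| := by
  rw [EuclideanSpace.dist_eq, Fin.sum_univ_one, Real.sqrt_sq dist_nonneg, Real.dist_eq]

open Classical in
lemma ite_adjacent_nonneg (S : Finset (Fin n)) (x y : Fin n) :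
    0 ≤ if Adjacent V S x y then (V y 0 - V x 0) ^ ν else 0 := by
  split_ifs with h
  · exact Real.rpow_nonneg (by linarith [h.1]) _
  · exact le_rfl

lemma gapSum_nonneg (S : Finset (Fin n)) : 0 ≤ gapSum ν V S :=
  sum_nonneg fun x _ => sum_nonneg fun y _ => ite_adjacent_nonneg S x y

lemma exists_sorted (hV : Function.Injective fun x => V x 0) {S : Finset (Fin n)}
    (hS : S.Nonempty) :
    ∃ z : ℕ → Fin n, (∀ k < #S, z k ∈ S) ∧ (∀ k l, k < l → l < #S → V (z k) 0 < V (z l) 0) ∧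
      ∀ x ∈ S, ∃ k < #S, z k = x := by
  classical
  obtain ⟨x₀, hx₀⟩ := hS
  set T := S.image fun x => V x 0 with hT
  have hc : #T = #S := card_image_of_injective S hV
  have hex : ∀ k : Fin #S, ∃ x ∈ S, V x 0 = T.orderEmbOfFin hc k := fun k =>
    mem_image.1 (T.orderEmbOfFin_mem hc k)
  choose y hyS hy using hex
  refine ⟨fun k => if h : k < #S then y ⟨k, h⟩ else x₀, fun k hk => ?_, fun k l hkl hl => ?_,
    fun x hx => ?_⟩
  · simp only [hk, dif_pos, hyS]
  · simp only [hl, hkl.trans hl, dif_pos, hy]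
    exact (T.orderEmbOfFin hc).strictMono hkl
  · have : V x 0 ∈ Set.range (T.orderEmbOfFin hc) := by
      rw [T.range_orderEmbOfFin hc]
      exact mem_image_of_mem _ hx
    obtain ⟨k, hk⟩ := this
    refine ⟨k, k.2, ?_⟩
    simp only [k.2, dif_pos]
    exact hV ((hy k).trans hk)

/-- A path with at most `w + 1` links can take every `s`-th node, as long as `#S - 1` is at most
`(w + 1) * s`. -/
lemma IsLeastEnergyPath.pathEnergy_le_gapSum (hν : 1 < ν) (hV : Function.Injective fun x => V x 0)
    {S : Finset (Fin n)} {w : ℕ} {j i : Fin n} {P : List (Fin n)}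
    (h : IsLeastEnergyPath ν V S w j i P) {s : ℕ} (hs : #S ≤ (w + 1) * s + 1) :
    pathEnergy ν V P ≤ (s : ℝ) ^ (ν - 1) * gapSum ν V S := by
  classical
  have hj : j ∈ S := h.1.2.2.2.1 j (List.mem_of_mem_head? h.1.2.1)
  have hi : i ∈ S := h.1.2.2.2.1 i (List.mem_of_getLast? h.1.2.2.1)
  obtain ⟨z, hzS, hz, hzex⟩ := exists_sorted hV ⟨j, hj⟩
  obtain ⟨a, ha, rfl⟩ := hzex i hi
  obtain ⟨b, hb, rfl⟩ := hzex j hj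
  set g : ℕ → ℝ := fun k => (V (z (k + 1)) 0 - V (z k) 0) with hg
  set H : ℕ → ℝ := fun p => ∑ k ∈ range p, g k ^ ν with hH
  have hg0 : ∀ k, k + 1 < #S → 0 ≤ g k := fun k hk => sub_nonneg.2 (hz k (k + 1) (by omega) hk).le
  have hHsub : ∀ p q, p ≤ q → H q - H p = ∑ k ∈ Ico p q, g k ^ ν := by
    intro p q hpq
    rw [sum_Ico_eq_sub _ hpq]
  have hHmono : ∀ p q, p ≤ q → q < #S → H p ≤ H q := by
    intro p q hpq hq
    rw [← sub_nonneg, hHsub p q hpq]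
    refine sum_nonneg fun k hk => Real.rpow_nonneg (hg0 k ?_) ν
    have := (mem_Ico.1 hk).2
    omega
  have hzinj : Set.InjOn z (range (#S - 1)) := by
    intro k hk l hl hkl
    have hk' := mem_range.1 (mem_coe.1 hk)
    have hl' := mem_range.1 (mem_coe.1 hl)
    rcases lt_trichotomy k l with h1 | h1 | h1
    · have := hz k l h1 (by omega)
      rw [hkl] at this
      exact absurd this (lt_irrefl _)
    · exact h1
    · have := hz l k h1 (by omega)
      rw [hkl] at this
      exact absurd this (lt_irrefl _)
  have hHle : ∀ p < #S, H p ≤ gapSum ν V S := by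
    intro p hp
    refine (hHmono p (#S - 1) (by omega) (by omega)).trans ?_
    have h1 : ∀ k ∈ range (#S - 1), g k ^ ν ≤
        ∑ y ∈ S, if Adjacent V S (z k) y then (V y 0 - V (z k) 0) ^ ν else 0 := by
      intro k hk
      have hk' : k + 1 < #S := by have := mem_range.1 hk; omega
      have hadj : Adjacent V S (z k) (z (k + 1)) := by
        refine ⟨hz k (k + 1) (by omega) hk', fun x hx => ?_⟩
        obtain ⟨l, hl, rfl⟩ := hzex x hx
        rcases lt_trichotomy l k with h1 | h1 | h1
        · exact Or.inl (hz l k h1 (by omega)).le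
        · exact Or.inl (by rw [h1])
        · rcases (show k + 1 ≤ l by omega).eq_or_lt with h2 | h2
          · exact Or.inr (by rw [h2])
          · exact Or.inr (hz _ _ h2 hl).le
      refine le_trans (le_of_eq ?_) (single_le_sum (fun y _ => ite_adjacent_nonneg S (z k) y)
        (hzS (k + 1) hk'))
      rw [if_pos hadj]
    refine (sum_le_sum h1).trans ?_
    rw [← sum_image (f := fun x => ∑ y ∈ S, if Adjacent V S x y then (V y 0 - V x 0) ^ ν else 0) hzinj]
    refine sum_le_sum_of_subset_of_nonneg (fun x hx => ?_)
      fun x _ _ => sum_nonneg fun y _ => ite_adjacent_nonneg S x y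
    obtain ⟨k, hk, rfl⟩ := mem_image.1 hx
    have := mem_range.1 hk
    exact hzS k (by omega)
  have hstep : ∀ p q, p ≤ q → q ≤ p + s → q < #S →
      |V (z q) 0 - V (z p) 0| ^ ν ≤ (s : ℝ) ^ (ν - 1) * (H q - H p) := by
    intro p q hpq hqs hq
    have e : V (z q) 0 - V (z p) 0 = ∑ k ∈ Ico p q, g k :=
      (sum_Ico_sub (fun k => V (z k) 0) hpq).symm
    have hnn : ∀ k ∈ Ico p q, 0 ≤ g k := fun k hk => hg0 k (by have := (mem_Ico.1 hk).2; omega)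
    rw [e, abs_of_nonneg (sum_nonneg hnn), hHsub p q hpq]
    refine (Real.rpow_sum_le_const_mul_sum_rpow_of_nonneg (s := Ico p q) hν.le hnn).trans ?_
    refine mul_le_mul_of_nonneg_right ?_ (sum_nonneg fun k hk => Real.rpow_nonneg (hnn k hk) ν)
    refine Real.rpow_le_rpow (Nat.cast_nonneg _) ?_ (by linarith)
    rw [Nat.card_Ico]
    exact_mod_cast (by omega : q - p ≤ s)
  have hc0 : (0 : ℝ) ≤ (s : ℝ) ^ (ν - 1) := by positivity
  have hsub : ∀ k, (k + 1) * s = k * s + s := fun k => by ring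
  -- the indices of the nodes on the way from `b` to `a`
  obtain ⟨idx, h0, hu, hlt, D, hD, hD0, hDu⟩ : ∃ idx : ℕ → ℕ, idx 0 = b ∧ idx (w + 1) = a ∧
      (∀ k, idx k < #S) ∧ ∃ D : ℕ → ℝ, (∀ k, dist (V (z (idx k))) (V (z (idx (k + 1)))) ^ ν ≤
        (s : ℝ) ^ (ν - 1) * (D k - D (k + 1))) ∧ D 0 ≤ H (#S - 1) ∧ 0 ≤ D (w + 1) := by
    rcases le_total a b with hab | hab
    · refine ⟨fun k => max (b - k * s) a, by simp [hab], by simp only; omega,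
        fun k => by simp only; omega, fun k => H (max (b - k * s) a), fun k => ?_, ?_, ?_⟩
      · have := hsub k
        rw [dist_line]
        exact hstep (max (b - (k + 1) * s) a) (max (b - k * s) a) (by omega) (by omega) (by omega)
      · exact hHmono _ _ (by omega) (by omega)
      · exact sum_nonneg fun k hk => Real.rpow_nonneg (hg0 k (by
          have := mem_range.1 hk; omega)) ν
    · refine ⟨fun k => min (b + k * s) a, by simp [hab], by simp only; omega,
        fun k => by simp only; omega, fun k => H (#S - 1) - H (min (b + k * s) a), fun k => ?_, ?_, ?_⟩
      · have := hsub k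
        rw [dist_line, abs_sub_comm, sub_sub_sub_cancel_left]
        exact hstep (min (b + k * s) a) (min (b + (k + 1) * s) a) (by omega) (by omega) (by omega)
      · simp only
        have : 0 ≤ H (min (b + 0 * s) a) := sum_nonneg fun k hk => Real.rpow_nonneg (hg0 k (by
          have := mem_range.1 hk; omega)) ν
        linarith
      · simp only
        exact sub_nonneg.2 (hHmono _ _ (by omega) (by omega))
  have hle := h.le_walk ν V (Q := (List.range (w + 1 + 1)).map fun k => z (idx k))
    (by rw [List.range_succ_eq_map]; simp [h0]) (by rw [List.range_succ]; simp [hu])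
    (by intro x hx; obtain ⟨k, -, rfl⟩ := List.mem_map.1 hx; exact hzS _ (hlt k)) (by simp)
  refine hle.trans ?_
  rw [pathEnergy_map_range]
  refine (sum_le_sum fun k _ => hD k).trans ?_
  rw [← mul_sum, sum_range_sub']
  refine mul_le_mul_of_nonneg_left ?_ hc0
  have := hHle (#S - 1) (by omega)
  linarith

lemma exists_eq_append_of_mem_pathLinks {x y : Fin n} : ∀ {P : List (Fin n)}, (x, y) ∈ pathLinks P →
    ∃ s t, P = s ++ x :: y :: t
  | [], h => by simp [pathLinks] at h
  | [a], h => by simp [pathLinks] at h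
  | a :: b :: l, h => by
    have h' : (x, y) = (a, b) ∨ (x, y) ∈ pathLinks (b :: l) := by simpa [pathLinks] using h
    rcases h' with h' | h'
    · obtain ⟨rfl, rfl⟩ := Prod.mk.inj h'
      exact ⟨[], l, rfl⟩
    · obtain ⟨s, t, hst⟩ := exists_eq_append_of_mem_pathLinks h'
      exact ⟨a :: s, t, by rw [hst]; rfl⟩

lemma pathEnergy_append_cons {d : ℕ} (V : Fin n → EuclideanSpace ℝ (Fin d)) (s t : List (Fin n))
    (x : Fin n) : pathEnergy ν V (s ++ x :: t) =
      pathEnergy ν V (s ++ [x]) + pathEnergy ν V (x :: t) := by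
  induction s with
  | nil => simp
  | cons a s ih =>
    cases s with
    | nil => simp [pathEnergy_cons_cons]
    | cons b s =>
      simp only [List.cons_append, pathEnergy_cons_cons] at ih ⊢
      rw [ih, add_assoc]

lemma add_rpow_lt {a b : ℝ} (hν : 1 < ν) (ha : 0 < a) (hb : 0 < b) :
    a ^ ν + b ^ ν < (a + b) ^ ν := by
  have e : ∀ {x : ℝ}, 0 < x → x ^ ν = x * x ^ (ν - 1) := fun {x} hx => by
    rw [Real.rpow_sub_one hx.ne', mul_div_cancel₀ _ hx.ne']
  have h1 : a ^ (ν - 1) < (a + b) ^ (ν - 1) :=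
    Real.rpow_lt_rpow ha.le (by linarith) (by linarith)
  have h2 : b ^ (ν - 1) < (a + b) ^ (ν - 1) :=
    Real.rpow_lt_rpow hb.le (by linarith) (by linarith)
  rw [e ha, e hb, e (add_pos ha hb), add_mul]
  nlinarith

/-- If the number of links is not restricted, a least-energy path on the line never skips a node. -/
lemma IsLeastEnergyPath.adjacent (hν : 1 < ν) (hV : Function.Injective fun x => V x 0)
    {S : Finset (Fin n)} {w : ℕ} {j i : Fin n} {P : List (Fin n)}
    (h : IsLeastEnergyPath ν V S w j i P) (hS : #S ≤ w + 2) {x y : Fin n}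
    (hxy : (x, y) ∈ pathLinks P) : Adjacent V S x y ∨ Adjacent V S y x := by
  obtain ⟨s, t, rfl⟩ := exists_eq_append_of_mem_pathLinks hxy
  have hne : x ≠ y := by
    have := h.1.1
    rw [List.nodup_append] at this
    have := (List.nodup_cons.1 this.2.1).1
    rintro rfl
    simp at this
  have key : ∀ z ∈ S, ¬ (0 < |V x 0 - V z 0| ∧ 0 < |V z 0 - V y 0| ∧
      |V x 0 - V y 0| = |V x 0 - V z 0| + |V z 0 - V y 0|) := by
    rintro z hz ⟨h1, h2, h3⟩
    obtain ⟨P', hP', hle⟩ := exists_isPath_of_walk ν V (S := S) (l := (s ++ x :: z :: y :: t).length)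
      (i := i) (s ++ x :: z :: y :: t) j
      (by have := h.1.2.1; cases s <;> simpa using this)
      (by have := h.1.2.2.1; simpa [List.getLast?_append, List.getLast?_cons_cons] using this)
      (by
        intro q hq
        have hmem := h.1.2.2.2.1
        simp only [List.mem_append, List.mem_cons] at hq hmem
        rcases hq with hq | rfl | rfl | rfl | hq
        · exact hmem q (Or.inl hq)
        · exact hmem q (by simp)
        · exact hz
        · exact hmem q (by simp)
        · exact hmem q (by simp [hq]))
      (by omega)
    have hlen : P'.length ≤ #S := by
      rw [← List.toFinset_card_of_nodup hP'.1]
      exact card_le_card fun q hq => hP'.2.2.2.1 q (List.mem_toFinset.1 hq)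
    have hopt := h.2 P' ⟨hP'.1, hP'.2.1, hP'.2.2.1, hP'.2.2.2.1, hlen.trans hS⟩
    rw [pathEnergy_append_cons, pathEnergy_cons_cons, dist_line] at hopt
    rw [pathEnergy_append_cons, pathEnergy_cons_cons, pathEnergy_cons_cons, dist_line,
      dist_line] at hle
    have := add_rpow_lt hν h1 h2
    rw [← h3] at this
    linarith
  have hVne : V x 0 ≠ V y 0 := fun h => hne (hV h)
  rcases lt_or_gt_of_ne hVne with hlt | hlt
  · refine Or.inl ⟨hlt, fun z hz => ?_⟩
    by_contra hcon
    push Not at hcon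
    refine key z hz ⟨abs_pos.2 (by linarith), abs_pos.2 (by linarith), ?_⟩
    rw [abs_of_neg (by linarith), abs_of_neg (by linarith), abs_of_neg (by linarith)]
    ring
  · refine Or.inr ⟨hlt, fun z hz => ?_⟩
    by_contra hcon
    push Not at hcon
    refine key z hz ⟨abs_pos.2 (by linarith), abs_pos.2 (by linarith), ?_⟩
    rw [abs_of_pos (by linarith), abs_of_pos (by linarith), abs_of_pos (by linarith)]
    ring

/-- On the line the halves of a region are intervals of it, so adjacency in a half is adjacency in the
region. -/
lemma Bisects.adjacent {R L U : Region 1 n} (hb : Bisects V R L U) {x y : Fin n} :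
    (x ∈ L.nodes → y ∈ L.nodes → Adjacent V L.nodes x y → Adjacent V R.nodes x y) ∧
      (x ∈ U.nodes → y ∈ U.nodes → Adjacent V U.nodes x y → Adjacent V R.nodes x y) := by
  obtain ⟨c, a, b, -, hLR, hU, -, hLU, -⟩ := hb
  obtain rfl : c = 0 := Subsingleton.elim _ _
  have hmem : ∀ z ∈ R.nodes, z ∈ L.nodes ∨ z ∈ U.nodes := by
    intro z hz
    rw [hU, mem_sdiff]
    tauto
  constructor
  · intro _ hy h
    refine ⟨h.1, fun z hz => ?_⟩
    rcases hmem z hz with hz | hz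
    · exact h.2 z hz
    · exact Or.inr (hLU y hy z hz)
  · intro hx _ h
    refine ⟨h.1, fun z hz => ?_⟩
    rcases hmem z hz with hz | hz
    · exact Or.inl (hLU z hz x hx)
    · exact h.2 z hz

/-- Bisecting a region removes the gap between its halves and creates no other. -/
lemma gapSum_add_le {R R₁ R₂ : Region 1 n} (hb : Bisects V R R₁ R₂ ∨ Bisects V R R₂ R₁) :
    gapSum ν V R₁.nodes + gapSum ν V R₂.nodes ≤ gapSum ν V R.nodes := by
  classical
  obtain ⟨h1, h2, -⟩ := Bisects.halves hb
  have hsub2 : R₂.nodes ⊆ R.nodes := by rw [h2]; exact sdiff_subset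
  have hadj₁ : ∀ x ∈ R₁.nodes, ∀ y ∈ R₁.nodes, Adjacent V R₁.nodes x y → Adjacent V R.nodes x y := by
    intro x hx y hy
    rcases hb with hb | hb
    exacts [hb.adjacent.1 hx hy, hb.adjacent.2 hx hy]
  have hadj₂ : ∀ x ∈ R₂.nodes, ∀ y ∈ R₂.nodes, Adjacent V R₂.nodes x y → Adjacent V R.nodes x y := by
    intro x hx y hy
    rcases hb with hb | hb
    exacts [hb.adjacent.2 hx hy, hb.adjacent.1 hx hy]
  have key : ∀ {T : Finset (Fin n)}, T ⊆ R.nodes →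
      (∀ x ∈ T, ∀ y ∈ T, Adjacent V T x y → Adjacent V R.nodes x y) → ∀ x ∈ T,
      (∑ y ∈ T, if Adjacent V T x y then (V y 0 - V x 0) ^ ν else 0) ≤
        ∑ y ∈ R.nodes, if Adjacent V R.nodes x y then (V y 0 - V x 0) ^ ν else 0 := by
    intro T hT hadj x hx
    refine (sum_le_sum fun y hy => ?_).trans (sum_le_sum_of_subset_of_nonneg hT
      fun y _ _ => ite_adjacent_nonneg R.nodes x y)
    split_ifs with p1 p2
    · exact le_rfl
    · exact absurd (hadj x hx y hy p1) p2
    · exact Real.rpow_nonneg (by linarith [(by assumption : Adjacent V R.nodes x y).1]) ν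
    · exact le_rfl
  calc gapSum ν V R₁.nodes + gapSum ν V R₂.nodes
      ≤ (∑ x ∈ R₁.nodes, ∑ y ∈ R.nodes,
          if Adjacent V R.nodes x y then (V y 0 - V x 0) ^ ν else 0) +
        ∑ x ∈ R₂.nodes, ∑ y ∈ R.nodes,
          if Adjacent V R.nodes x y then (V y 0 - V x 0) ^ ν else 0 :=
        add_le_add (sum_le_sum (key h1 hadj₁)) (sum_le_sum (key hsub2 hadj₂))
    _ = gapSum ν V R.nodes := by
        rw [gapSum, h2, add_comm, sum_sdiff h1]

/-- The path skips some node of the line. -/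
def Skips (V : Fin n → EuclideanSpace ℝ (Fin 1)) (P : List (Fin n)) : Prop :=
  ∃ e ∈ pathLinks P, ¬ (Adjacent V univ e.1 e.2 ∨ Adjacent V univ e.2 e.1)

open Classical in
/-- The energy of the paths of iteration `K` that skip nodes. -/
noncomputable def skipEnergy (ν : ℝ) (V : Fin n → EuclideanSpace ℝ (Fin 1)) (K : ℕ)
    (out : List (ℕ × List (Fin n))) : ℝ :=
  (out.map fun q => if q.1 = K ∧ Skips V q.2 then pathEnergy ν V q.2 else 0).sum

open Classical in
lemma skipEnergy_cons (K : ℕ) (q : ℕ × List (Fin n)) (out : List (ℕ × List (Fin n))) :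
    skipEnergy ν V K (q :: out) =
      (if q.1 = K ∧ Skips V q.2 then pathEnergy ν V q.2 else 0) + skipEnergy ν V K out := by
  simp [skipEnergy]

lemma skipEnergy_append (K : ℕ) (o₁ o₂ : List (ℕ × List (Fin n))) :
    skipEnergy ν V K (o₁ ++ o₂) = skipEnergy ν V K o₁ + skipEnergy ν V K o₂ := by
  simp [skipEnergy]

lemma skipEnergy_eq_zero {K : ℕ} {out : List (ℕ × List (Fin n))} (h : ∀ q ∈ out, q.1 ≠ K) :
    skipEnergy ν V K out = 0 := by
  induction out with
  | nil => simp [skipEnergy]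
  | cons q out ih =>
    rw [skipEnergy_cons, if_neg (fun h' => h q (by simp) h'.1),
      ih fun q' hq' => h q' (by simp [hq']), zero_add]

/-- In a region with at most `w + 2` nodes the weight restricts nothing, and all links of the path are
between adjacent nodes. So a path of iteration `K` that skips nodes lies in a region with more
nodes; taking every `s`-th node, with `s` of order `N / 2 ^ K / (1 + w K)`, bounds its energy by the
gap sum of the region, and the gap sums of disjoint regions add up. -/
lemma BisectionRun.skipEnergy_le (hν : 1 < ν) (hV : Function.Injective fun x => V x 0) {N : ℝ}
    {k : ℕ} {R : Region 1 n} {i : Fin n} {A : Finset (Fin n)} {out : List (ℕ × List (Fin n))}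
    (h : BisectionRun ν V w k R i A out) :
    ((#R.nodes : ℝ) - 1) * 2 ^ k ≤ N →
    (∀ x ∈ R.nodes, ∀ y ∈ R.nodes, Adjacent V R.nodes x y → Adjacent V univ x y) → ∀ K,
    skipEnergy ν V K out ≤ (2 * (N / 2 ^ K) / (1 + w K)) ^ (ν - 1) * gapSum ν V R.nodes := by
  classical
  have hfac : ∀ {k : ℕ} {R : Region 1 n}, 1 ≤ #R.nodes → ((#R.nodes : ℝ) - 1) * 2 ^ k ≤ N → ∀ K,
      0 ≤ (2 * (N / 2 ^ K) / (1 + (w K : ℝ))) ^ (ν - 1) := by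
    intro k R hR hN K
    have h1 : (1 : ℝ) ≤ #R.nodes := by exact_mod_cast hR
    have : 0 ≤ N := le_trans (mul_nonneg (by linarith) (by positivity)) hN
    positivity
  have hhalf : ∀ {k m l : ℕ}, 2 * l ≤ m + 1 → ((m : ℝ) - 1) * 2 ^ k ≤ N →
      ((l : ℝ) - 1) * 2 ^ (k + 1) ≤ N := by
    intro k m l h1 h2
    have h1' : 2 * (l : ℝ) ≤ m + 1 := by exact_mod_cast h1
    have h3 : (0 : ℝ) < 2 ^ k := by positivity
    rw [pow_succ]
    nlinarith
  have hadj : ∀ {R R₁ R₂ : Region 1 n}, (Bisects V R R₁ R₂ ∨ Bisects V R R₂ R₁) →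
      (∀ x ∈ R.nodes, ∀ y ∈ R.nodes, Adjacent V R.nodes x y → Adjacent V univ x y) →
      (∀ x ∈ R₁.nodes, ∀ y ∈ R₁.nodes, Adjacent V R₁.nodes x y → Adjacent V univ x y) ∧
      (∀ x ∈ R₂.nodes, ∀ y ∈ R₂.nodes, Adjacent V R₂.nodes x y → Adjacent V univ x y) := by
    intro R R₁ R₂ hb hR
    obtain ⟨h1, h2, -⟩ := Bisects.halves hb
    have hsub2 : R₂.nodes ⊆ R.nodes := by rw [h2]; exact sdiff_subset
    constructor
    · intro x hx y hy hxy
      refine hR x (h1 hx) y (h1 hy) ?_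
      rcases hb with hb | hb
      exacts [hb.adjacent.1 hx hy hxy, hb.adjacent.2 hx hy hxy]
    · intro x hx y hy hxy
      refine hR x (hsub2 hx) y (hsub2 hy) ?_
      rcases hb with hb | hb
      exacts [hb.adjacent.2 hx hy hxy, hb.adjacent.1 hx hy hxy]
  induction h with
  | halt k R i A hR =>
    intro hN _ K
    rcases R.nodes.eq_empty_or_nonempty with h | h
    · simp [skipEnergy, h, gapSum]
    · simpa [skipEnergy] using mul_nonneg (hfac h.card_pos hN K) (gapSum_nonneg R.nodes)
  | join k R R₁ R₂ i j A P o₁ o₂ hR hb hi hj hjA hP hr₁ hr₂ ih₁ ih₂ =>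
    intro hN hRadj K
    obtain ⟨-, -, -, hc1, -, hc2⟩ := Bisects.halves hb
    have hf := hfac (by omega : 1 ≤ #R.nodes) hN K
    have hsum := gapSum_add_le (ν := ν) hb
    have i1 := ih₁ (hhalf hc1 hN) (hadj hb hRadj).1 K
    have i2 := ih₂ (hhalf hc2 hN) (hadj hb hRadj).2 K
    rw [skipEnergy_cons, skipEnergy_append]
    by_cases hcase : k = K ∧ Skips V P
    · obtain ⟨rfl, e, he, hskip⟩ := hcase
      rw [if_pos ⟨rfl, e, he, hskip⟩]
      have z1 : skipEnergy ν V k o₁ = 0 := skipEnergy_eq_zero fun q hq => by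
        have := (hr₁.path_props q hq).1; omega
      have z2 : skipEnergy ν V k o₂ = 0 := skipEnergy_eq_zero fun q hq => by
        have := (hr₂.path_props q hq).1; omega
      rw [z1, z2, add_zero, add_zero]
      have hlarge : w k + 2 < #R.nodes := by
        by_contra hle
        refine hskip ?_
        have hmem := List.of_mem_zip he
        have hm := hP.1.2.2.2.1
        have m1 := hm _ hmem.1
        have m2 := hm _ (List.mem_of_mem_tail hmem.2)
        rcases hP.adjacent hν hV (not_lt.1 hle) he with ha | ha
        · exact Or.inl (hRadj _ m1 _ m2 ha)
        · exact Or.inr (hRadj _ m2 _ m1 ha)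
      -- every `s`-th node is visited
      set s := (#R.nodes - 1) / (w k + 1) + 1 with hs
      have hs1 : #R.nodes ≤ (w k + 1) * s + 1 := by
        have := Nat.lt_mul_div_succ (#R.nodes - 1) (Nat.succ_pos (w k))
        rw [hs]
        simp only [Nat.succ_eq_add_one] at this
        omega
      refine (hP.pathEnergy_le_gapSum hν hV hs1).trans ?_
      refine mul_le_mul_of_nonneg_right ?_ (gapSum_nonneg R.nodes)
      refine Real.rpow_le_rpow (Nat.cast_nonneg s) ?_ (by linarith)
      have hw0 : (0 : ℝ) < 1 + w k := by positivity
      rw [le_div_iff₀ hw0]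
      have hs2 : s * (1 + w k) ≤ 2 * (#R.nodes - 1) := by
        have := Nat.div_mul_le_self (#R.nodes - 1) (w k + 1)
        have e1 : s * (1 + w k) = (#R.nodes - 1) / (w k + 1) * (w k + 1) + (w k + 1) := by
          rw [hs]; ring
        omega
      have hs3 : (s : ℝ) * (1 + w k) ≤ 2 * ((#R.nodes : ℝ) - 1) := by
        have h1 : 1 ≤ #R.nodes := by omega
        have := (Nat.cast_le (α := ℝ)).2 hs2
        push_cast [Nat.cast_sub h1] at this
        exact this
      refine hs3.trans ?_
      have : (#R.nodes : ℝ) - 1 ≤ N / 2 ^ k := by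
        rw [le_div_iff₀ (by positivity)]; exact hN
      linarith
    · rw [if_neg hcase, zero_add]
      have := mul_le_mul_of_nonneg_left hsum hf
      linarith
  | skip k R R₁ R₂ i A o hR hb hi hsub hr ih =>
    intro hN hRadj K
    obtain ⟨-, -, -, hc1, -⟩ := Bisects.halves hb
    have hf := hfac (by omega : 1 ≤ #R.nodes) hN K
    have hsum := gapSum_add_le (ν := ν) hb
    have := gapSum_nonneg (ν := ν) (V := V) R₂.nodes
    refine (ih (hhalf hc1 hN) (hadj hb hRadj).1 K).trans (mul_le_mul_of_nonneg_left ?_ hf)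
    linarith

/-- The links between adjacent nodes are paid for only once. -/
lemma IsBisectionOutput.energy_le_gapSum {Y : Type} (ψ : Fin n → Y → ℝ) {r : Fin n} (hν : 1 < ν)
    (hV : Function.Injective fun x => V x 0) {out : List (ℕ × List (Fin n))}
    (h : IsBisectionOutput ν V w r out) :
    (aggPolicy ψ w out).energy ν V ≤ (2 + ∑ K ∈ range (Nat.clog 2 n),
      (2 * ((n : ℝ) / 2 ^ K) / (1 + w K)) ^ (ν - 1)) * gapSum ν V univ := by
  classical
  have hnn : ∀ e : Fin n × Fin n, 0 ≤ dist (V e.1) (V e.2) ^ ν := fun e => by positivity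
  set bad := out.filter fun q => Skips V q.2 with hbad
  set adj : Finset (Fin n × Fin n) :=
    univ.filter fun e => Adjacent V univ e.1 e.2 ∨ Adjacent V univ e.2 e.1 with hadj
  have hsub : (aggPolicy ψ w out).links ⊆ adj ∪ (bad.flatMap fun q => pathLinks q.2).toFinset := by
    intro e he
    obtain ⟨q, hq, heq⟩ := links_aggPolicy_subset ψ w out he
    by_cases hA : Adjacent V univ e.1 e.2 ∨ Adjacent V univ e.2 e.1
    · exact mem_union_left _ (mem_filter.2 ⟨mem_univ _, hA⟩)
    · refine mem_union_right _ (List.mem_toFinset.2 (List.mem_flatMap.2 ⟨q, ?_, heq⟩))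
      exact List.mem_filter.2 ⟨hq, decide_eq_true ⟨e, heq, hA⟩⟩
  have hA : ∑ e ∈ adj, dist (V e.1) (V e.2) ^ ν ≤ 2 * gapSum ν V univ := by
    rw [hadj, sum_filter, ← univ_product_univ, sum_product]
    have h1 : ∀ x y : Fin n, (if Adjacent V univ x y ∨ Adjacent V univ y x then
        dist (V x) (V y) ^ ν else 0) ≤
        (if Adjacent V univ x y then (V y 0 - V x 0) ^ ν else 0) +
          if Adjacent V univ y x then (V x 0 - V y 0) ^ ν else 0 := by
      intro x y
      have n1 := ite_adjacent_nonneg (ν := ν) (V := V) univ x y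
      have n2 := ite_adjacent_nonneg (ν := ν) (V := V) univ y x
      by_cases p1 : Adjacent V univ x y
      · rw [if_pos (Or.inl p1), if_pos p1, dist_line, abs_sub_comm, abs_of_pos (sub_pos.2 p1.1)]
        linarith
      · by_cases p2 : Adjacent V univ y x
        · rw [if_pos (Or.inr p2), if_pos p2, dist_line, abs_of_pos (sub_pos.2 p2.1)]
          linarith
        · rw [if_neg (by tauto)]
          linarith
    refine (sum_le_sum fun x _ => sum_le_sum fun y _ => h1 x y).trans (le_of_eq ?_)
    simp only [sum_add_distrib]
    rw [two_mul, gapSum]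
    congr 1
    rw [sum_comm]
  have hB : ∑ e ∈ (bad.flatMap fun q => pathLinks q.2).toFinset, dist (V e.1) (V e.2) ^ ν ≤
      ∑ K ∈ range (Nat.clog 2 n), skipEnergy ν V K out := by
    refine (sum_toFinset_le _ hnn _).trans ?_
    have hlt := h.goodPaths.lt_clog
    rw [hbad]
    clear hsub hA hadj hbad bad adj h
    induction out with
    | nil => simp [skipEnergy]
    | cons q out ih =>
      have ih' := ih fun q' hq' => hlt q' (by simp [hq'])
      have hq := hlt q (by simp)
      simp only [skipEnergy_cons]
      rw [sum_add_distrib]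
      by_cases hs : Skips V q.2
      · rw [List.filter_cons_of_pos (by simpa using hs), List.flatMap_cons, List.map_append,
          List.sum_append]
        refine add_le_add ?_ ih'
        simp only [hs, and_true]
        rw [sum_ite_eq, if_pos (mem_range.2 hq)]
        exact le_rfl
      · rw [List.filter_cons_of_neg (by simpa using hs)]
        simpa [hs] using ih'
  have hC : ∀ K ∈ range (Nat.clog 2 n), skipEnergy ν V K out ≤
      (2 * ((n : ℝ) / 2 ^ K) / (1 + w K)) ^ (ν - 1) * gapSum ν V univ := fun K _ =>
    BisectionRun.skipEnergy_le hν hV h (by simp [Region.whole]) (fun x _ y _ h => h) K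
  calc (aggPolicy ψ w out).energy ν V
      ≤ ∑ e ∈ adj ∪ (bad.flatMap fun q => pathLinks q.2).toFinset, dist (V e.1) (V e.2) ^ ν :=
        sum_le_sum_of_subset_of_nonneg hsub fun e _ _ => hnn e
    _ ≤ ∑ e ∈ adj, dist (V e.1) (V e.2) ^ ν +
        ∑ e ∈ (bad.flatMap fun q => pathLinks q.2).toFinset, dist (V e.1) (V e.2) ^ ν := by
        rw [← sum_union_inter]
        exact le_add_of_nonneg_right (sum_nonneg fun e _ => hnn e)
    _ ≤ 2 * gapSum ν V univ + ∑ K ∈ range (Nat.clog 2 n),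
        (2 * ((n : ℝ) / 2 ^ K) / (1 + w K)) ^ (ν - 1) * gapSum ν V univ :=
        add_le_add hA (hB.trans (sum_le_sum hC))
    _ = _ := by rw [add_mul, sum_mul]

end Line

/-! ### Expected gaps on the line -/

section LineExpectation

open ProbabilityTheory

variable {n : ℕ} {ν : ℝ}

/-- Node `x` lies in the unit interval starting at `a`, and no other node lies in the `s` following
unit intervals. -/
def EmptyAfter (x : Fin n) (a s : ℕ) (V : Fin n → EuclideanSpace ℝ (Fin 1)) : Prop :=
  V x ∈ box (fun _ : Fin 1 => (a : ℝ)) (fun _ => (a : ℝ) + 1) ∧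
    ∀ z, z ≠ x → V z ∉ box (fun _ : Fin 1 => (a : ℝ) + 1) (fun _ => (a : ℝ) + 1 + s)

lemma setOf_emptyAfter (x : Fin n) (a s : ℕ) : {V | EmptyAfter x a s V} =
    Set.univ.pi fun z => if z = x then box (fun _ : Fin 1 => (a : ℝ)) (fun _ => (a : ℝ) + 1)
      else (box (fun _ : Fin 1 => (a : ℝ) + 1) (fun _ => (a : ℝ) + 1 + s))ᶜ := by
  ext V
  rw [Set.mem_univ_pi]
  constructor
  · rintro ⟨h1, h2⟩ z
    by_cases hz : z = x
    · subst hz; simpa using h1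
    · simpa [hz] using h2 z hz
  · intro h
    refine ⟨by simpa using h x, fun z hz => ?_⟩
    simpa [hz] using h z

lemma measurableSet_emptyAfter (x : Fin n) (a s : ℕ) : MeasurableSet {V | EmptyAfter x a s V} := by
  rw [setOf_emptyAfter]
  refine MeasurableSet.univ_pi fun z => ?_
  split_ifs
  exacts [measurableSet_box _ _, (measurableSet_box _ _).compl]

/-- Each of the other `n - 1` nodes avoids an interval of length `s` with probability
`1 - s / n`, and `n - 1 ≥ n / 2`. -/
lemma locationLaw_emptyAfter_le (hn : 2 ≤ n) (x : Fin n) {a s : ℕ} (has : a + 1 + s ≤ n) :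
    locationLaw 1 n {V | EmptyAfter x a s V} ≤
      (n : ℝ≥0∞)⁻¹ * ENNReal.ofReal (Real.exp (-((s : ℝ) / 2))) := by
  have hn0 : 0 < n := by omega
  have hnr : (0 : ℝ) < n := by exact_mod_cast hn0
  have hpr := isProbabilityMeasure_cube (d := 1) le_rfl hn0
  have hside : side 1 n = n := by simp [side]
  set E : ℝ≥0∞ := ENNReal.ofReal (Real.exp (-((s : ℝ) / n))) with hE
  set b2 := box (fun _ : Fin 1 => (a : ℝ) + 1) (fun _ => (a : ℝ) + 1 + s) with hb2
  have h1 : cond volume (cube 1 n) (box (fun _ : Fin 1 => (a : ℝ)) (fun _ => (a : ℝ) + 1)) ≤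
      (n : ℝ≥0∞)⁻¹ := by
    refine (cond_cube_le le_rfl n _).trans ?_
    rw [volume_box]
    simp
  have h2 : cond volume (cube 1 n) b2ᶜ ≤ E := by
    rw [prob_compl_eq_one_sub (measurableSet_box _ _), cond_apply (by
      rw [cube_eq_box]; exact measurableSet_box _ _), volume_cube le_rfl]
    have hsub : cube 1 n ∩ b2 = b2 := by
      refine Set.inter_eq_right.2 fun v hv c => ?_
      have h := hv c
      have h3 : (a : ℝ) + 1 + s ≤ n := by exact_mod_cast has
      rw [hside]
      have h4 : (0 : ℝ) ≤ a := Nat.cast_nonneg a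
      exact ⟨by linarith [h.1], by linarith [h.2]⟩
    rw [hsub, hb2, volume_box]
    simp only [univ_unique, prod_singleton, add_sub_cancel_left]
    refine tsub_le_iff_right.2 ?_
    rw [← ENNReal.ofReal_natCast (n := n), ← ENNReal.ofReal_inv_of_pos hnr,
      ← ENNReal.ofReal_mul (by positivity), hE, ← ENNReal.ofReal_add (Real.exp_pos _).le (by positivity),
      ← ENNReal.ofReal_one]
    refine ENNReal.ofReal_le_ofReal ?_
    have := Real.add_one_le_exp (-((s : ℝ) / n))
    have e : (n : ℝ)⁻¹ * s = s / n := by field_simp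
    rw [e]
    linarith
  rw [setOf_emptyAfter, locationLaw, Measure.pi_pi, ← mul_prod_erase univ _ (mem_univ x), if_pos rfl]
  refine mul_le_mul' h1 ?_
  calc ∏ z ∈ univ.erase x, cond volume (cube 1 n)
        (if z = x then box (fun _ : Fin 1 => (a : ℝ)) (fun _ => (a : ℝ) + 1) else b2ᶜ)
      ≤ ∏ _z ∈ univ.erase x, E := by
        refine prod_le_prod' fun z hz => ?_
        rw [if_neg (mem_erase.1 hz).1]
        exact h2
    _ = E ^ (n - 1) := by
        rw [prod_const, card_erase_of_mem (mem_univ x), card_univ, Fintype.card_fin]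
    _ ≤ _ := by
        rw [hE, ← ENNReal.ofReal_pow (Real.exp_pos _).le, ← Real.exp_nat_mul]
        refine ENNReal.ofReal_le_ofReal (Real.exp_le_exp.2 ?_)
        have h3 : (1 : ℝ) / 2 ≤ ((n - 1 : ℕ) : ℝ) / n := by
          rw [Nat.cast_sub (by omega), div_le_div_iff₀ (by norm_num) hnr]
          have : (2 : ℝ) ≤ n := by exact_mod_cast hn
          push_cast
          linarith
        have h4 := mul_le_mul_of_nonneg_right h3 (Nat.cast_nonneg (α := ℝ) s)
        have e : ((n - 1 : ℕ) : ℝ) * -((s : ℝ) / n) = -(((n - 1 : ℕ) : ℝ) / n * s) := by ring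
        rw [e]
        linarith

lemma exists_sum_rpow_exp_le (ν : ℝ) (hν : 0 ≤ ν) : ∃ C : ℝ, 0 < C ∧ ∀ N : ℕ,
    ∑ s ∈ range N, ((s : ℝ) + 2) ^ ν * Real.exp (-((s : ℝ) / 2)) ≤ C := by
  obtain ⟨C₀, hC₀, h⟩ := rpow_le_exp ν
  set q := Real.exp (-(1 / 4)) with hq
  have hq0 : 0 < q := Real.exp_pos _
  have hq1 : q < 1 := Real.exp_lt_one_iff.2 (by norm_num)
  have hz : 0 < 1 - q := by linarith
  refine ⟨4 ^ ν * C₀ * Real.exp 1 * (1 - q)⁻¹, by positivity, fun N => ?_⟩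
  have hterm : ∀ s : ℕ, ((s : ℝ) + 2) ^ ν * Real.exp (-((s : ℝ) / 2)) ≤
      4 ^ ν * C₀ * Real.exp 1 * q ^ s := by
    intro s
    have hs : (0 : ℝ) ≤ s := Nat.cast_nonneg s
    have h1 : ((s : ℝ) + 2) ^ ν ≤ 4 ^ ν * (C₀ * Real.exp ((s + 4) / 4)) := by
      calc ((s : ℝ) + 2) ^ ν ≤ (4 * ((s + 4) / 4)) ^ ν :=
            Real.rpow_le_rpow (by positivity) (by linarith) hν
        _ = 4 ^ ν * ((s + 4) / 4 : ℝ) ^ ν := Real.mul_rpow (by norm_num) (by positivity)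
        _ ≤ _ := by gcongr; exact h _ (by linarith)
    have e : Real.exp ((s + 4 : ℝ) / 4) * Real.exp (-((s : ℝ) / 2)) = Real.exp 1 * q ^ s := by
      rw [hq, ← Real.exp_nat_mul, ← Real.exp_add, ← Real.exp_add]
      congr 1
      ring
    calc _ ≤ 4 ^ ν * (C₀ * Real.exp ((s + 4) / 4)) * Real.exp (-((s : ℝ) / 2)) := by gcongr
      _ = 4 ^ ν * C₀ * (Real.exp ((s + 4 : ℝ) / 4) * Real.exp (-((s : ℝ) / 2))) := by ring
      _ = _ := by rw [e]; ring
  refine (sum_le_sum fun s _ => hterm s).trans ?_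
  rw [← mul_sum]
  refine mul_le_mul_of_nonneg_left ?_ (by positivity)
  have h1 := mul_neg_geom_sum q N
  have h2 : 0 ≤ q ^ N := by positivity
  rw [← one_div, le_div_iff₀ hz]
  linarith

open Classical in
/-- The gap to the right of a node is large only if the unit intervals to the right are empty. -/
lemma sum_gap_le (hν : 1 < ν) {V : Fin n → EuclideanSpace ℝ (Fin 1)} (hV : ∀ x, V x ∈ cube 1 n)
    (hV' : Function.Injective fun x => V x 0) (x : Fin n) :
    ∑ y, (if Adjacent V univ x y then (V y 0 - V x 0) ^ ν else 0) ≤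
      1 + ∑ s ∈ range n, ((s : ℝ) + 2) ^ ν *
        ∑ a ∈ range n, if a + 1 + s ≤ n ∧ EmptyAfter x a s V then 1 else 0 := by
  have hnn : ∀ s ∈ range n, 0 ≤ ((s : ℝ) + 2) ^ ν *
      ∑ a ∈ range n, if a + 1 + s ≤ n ∧ EmptyAfter x a s V then (1 : ℝ) else 0 := fun s _ =>
    mul_nonneg (by positivity) (sum_nonneg fun a _ => by split_ifs <;> norm_num)
  by_cases hex : ∃ y, Adjacent V univ x y
  swap
  · rw [not_exists] at hex
    rw [sum_eq_zero fun y _ => if_neg (hex y)]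
    have := sum_nonneg hnn
    linarith
  obtain ⟨y, hy⟩ := hex
  have huniq : ∀ y', y' ≠ y → ¬ Adjacent V univ x y' := by
    intro y' hne hy'
    refine hne (hV' ?_)
    rcases hy.2 y' (mem_univ _) with h1 | h1
    · exact absurd hy'.1 (not_lt.2 h1)
    · rcases hy'.2 y (mem_univ _) with h2 | h2
      · exact absurd hy.1 (not_lt.2 h2)
      · exact le_antisymm h2 h1
  rw [sum_eq_single y (fun y' _ h => if_neg (huniq y' h)) (by simp), if_pos hy]
  set g := V y 0 - V x 0 with hg
  have hg0 : 0 < g := sub_pos.2 hy.1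
  have hside : side 1 n = n := by simp [side]
  have hx0 : 0 ≤ V x 0 := (hV x 0).1
  have hyn : V y 0 ≤ n := by have := (hV y 0).2; rwa [hside] at this
  rcases le_or_gt g 1 with h1 | h1
  · have h2 := Real.rpow_le_one hg0.le h1 (by linarith : 0 ≤ ν)
    have := sum_nonneg hnn
    linarith
  · -- the gap has length in `(s + 1, s + 2]`
    set s := ⌈g⌉₊ - 2 with hs
    have hc : 2 ≤ ⌈g⌉₊ := by
      by_contra hlt
      have := Nat.le_ceil g
      have h3 : (⌈g⌉₊ : ℝ) ≤ 1 := by exact_mod_cast (by omega : ⌈g⌉₊ ≤ 1)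
      linarith
    have hsc : (s : ℝ) + 2 = ⌈g⌉₊ := by
      rw [hs, Nat.cast_sub hc]; push_cast; ring
    have hle : g ≤ (s : ℝ) + 2 := by rw [hsc]; exact Nat.le_ceil g
    have hlt : (s : ℝ) + 1 < g := by
      have := Nat.ceil_lt_add_one hg0.le
      linarith
    set a := ⌊V x 0⌋₊ with ha
    have ha1 : (a : ℝ) ≤ V x 0 := Nat.floor_le hx0
    have ha2 : V x 0 < a + 1 := Nat.lt_floor_add_one _
    have has : a + 1 + s ≤ n := by
      have : (a : ℝ) + 1 + s ≤ n := by linarith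
      exact_mod_cast this
    have hempty : EmptyAfter x a s V := by
      refine ⟨fun c => ?_, fun z hz hzb => ?_⟩
      · rw [Subsingleton.elim c 0]; exact ⟨ha1, ha2.le⟩
      · have h3 := hzb 0
        rcases hy.2 z (mem_univ _) with h4 | h4
        · linarith [h3.1]
        · linarith [h3.2]
    have h3 : g ^ ν ≤ ((s : ℝ) + 2) ^ ν *
        ∑ a ∈ range n, if a + 1 + s ≤ n ∧ EmptyAfter x a s V then (1 : ℝ) else 0 := by
      have h4 : (1 : ℝ) ≤ ∑ a ∈ range n, if a + 1 + s ≤ n ∧ EmptyAfter x a s V then (1 : ℝ) else 0 := by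
        refine le_trans (le_of_eq ?_) (single_le_sum (fun a _ => by split_ifs <;> norm_num)
          (mem_range.2 (by omega : a < n)))
        rw [if_pos ⟨has, hempty⟩]
      calc g ^ ν ≤ ((s : ℝ) + 2) ^ ν * 1 := by
            rw [mul_one]; exact Real.rpow_le_rpow hg0.le hle (by linarith)
        _ ≤ _ := by gcongr
    have h5 := single_le_sum hnn (mem_range.2 (by omega : s < n))
    linarith

lemma measurable_gapSum (ν : ℝ) (S : Finset (Fin n)) :
    Measurable fun V : Fin n → EuclideanSpace ℝ (Fin 1) => gapSum ν V S := by
  classical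
  unfold gapSum Adjacent
  refine Finset.measurable_sum _ fun x _ => Finset.measurable_sum _ fun y _ =>
    Measurable.ite ?_ (Measurable.pow_const (by fun_prop) ν) measurable_const
  refine measurableSet_setOfPred.2 (Measurable.and ?_ (Measurable.forall fun z =>
    Measurable.forall fun _ => Measurable.or ?_ ?_))
  · exact measurableSet_setOfPred.1 (measurableSet_lt (by fun_prop) (by fun_prop))
  · exact measurableSet_setOfPred.1 (measurableSet_le (by fun_prop) (by fun_prop))
  · exact measurableSet_setOfPred.1 (measurableSet_le (by fun_prop) (by fun_prop))

/-- The gap after a node exceeds a length `s` with exponentially small probability, so each of the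
`n` gaps has a bounded moment of order `ν`. -/
lemma lintegral_gapSum_le (hν : 1 < ν) : ∃ C : ℝ, 0 < C ∧ ∀ n : ℕ, 2 ≤ n →
    ∫⁻ V, ENNReal.ofReal (gapSum ν V univ) ∂locationLaw 1 n ≤ ENNReal.ofReal (C * n) := by
  classical
  obtain ⟨C, hC, hsum⟩ := exists_sum_rpow_exp_le ν (by linarith)
  refine ⟨1 + C, by positivity, fun n hn => ?_⟩
  have hn0 : 0 < n := by omega
  have hnr : (0 : ℝ) < n := by exact_mod_cast hn0
  have hpr := isProbabilityMeasure_locationLaw (d := 1) le_rfl hn0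
  set A : Fin n → ℕ → ℕ → Set (Fin n → EuclideanSpace ℝ (Fin 1)) := fun x s a =>
    {V | a + 1 + s ≤ n ∧ EmptyAfter x a s V} with hA
  have hAm : ∀ x s a, MeasurableSet (A x s a) := fun x s a =>
    (MeasurableSet.const _).inter (measurableSet_emptyAfter x a s)
  have hAle : ∀ x s a, locationLaw 1 n (A x s a) ≤
      (n : ℝ≥0∞)⁻¹ * ENNReal.ofReal (Real.exp (-((s : ℝ) / 2))) := by
    intro x s a
    by_cases has : a + 1 + s ≤ n
    · exact (measure_mono fun V hV => hV.2).trans (locationLaw_emptyAfter_le hn x has)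
    · have : A x s a = ∅ := by ext V; simp [hA, has]
      rw [this, measure_empty]
      exact zero_le
  have hpt : ∀ᵐ V ∂locationLaw 1 n, ENNReal.ofReal (gapSum ν V univ) ≤
      ∑ x : Fin n, (1 + ∑ s ∈ range n, ENNReal.ofReal (((s : ℝ) + 2) ^ ν) *
        ∑ a ∈ range n, (A x s a).indicator (fun _ => 1) V) := by
    filter_upwards [ae_mem_cube le_rfl hn0, ae_coord_ne le_rfl hn0] with V hV hV'
    rw [gapSum, ENNReal.ofReal_sum_of_nonneg fun x _ => sum_nonneg fun y _ =>
      ite_adjacent_nonneg univ x y]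
    refine sum_le_sum fun x _ => ?_
    refine (ENNReal.ofReal_le_ofReal (sum_gap_le hν hV (hV' 0) x)).trans (le_of_eq ?_)
    have hin : ∀ s, (0 : ℝ) ≤ ∑ a ∈ range n, if a + 1 + s ≤ n ∧ EmptyAfter x a s V then (1 : ℝ) else 0 :=
      fun s => sum_nonneg fun a _ => by split_ifs <;> norm_num
    rw [ENNReal.ofReal_add zero_le_one (sum_nonneg fun s _ => mul_nonneg (by positivity) (hin s)),
      ENNReal.ofReal_one, ENNReal.ofReal_sum_of_nonneg fun s _ => mul_nonneg (by positivity) (hin s)]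
    congr 1
    refine sum_congr rfl fun s _ => ?_
    rw [ENNReal.ofReal_mul (by positivity), ENNReal.ofReal_sum_of_nonneg fun a _ => by
      split_ifs <;> norm_num]
    congr 1
    refine sum_congr rfl fun a _ => ?_
    by_cases h : a + 1 + s ≤ n ∧ EmptyAfter x a s V
    · rw [if_pos h, Set.indicator_of_mem (show V ∈ A x s a from h), ENNReal.ofReal_one]
    · rw [if_neg h, Set.indicator_of_notMem (show V ∉ A x s a from h), ENNReal.ofReal_zero]
  refine (lintegral_mono_ae hpt).trans ?_
  have hm1 : ∀ x s a, Measurable fun V => (A x s a).indicator (fun _ => (1 : ℝ≥0∞)) V :=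
    fun x s a => measurable_const.indicator (hAm x s a)
  have hm2 : ∀ (x : Fin n) (s : ℕ), Measurable fun V => ENNReal.ofReal (((s : ℝ) + 2) ^ ν) *
        ∑ a ∈ range n, (A x s a).indicator (fun _ => (1 : ℝ≥0∞)) V :=
      fun x s => (Finset.measurable_sum _ fun a _ => hm1 x s a).const_mul _
  rw [lintegral_finsetSum _ fun x _ => Measurable.const_add (Finset.measurable_sum _ fun s _ =>
    hm2 x s) _]
  have hx : ∀ x : Fin n, ∫⁻ V, (1 + ∑ s ∈ range n, ENNReal.ofReal (((s : ℝ) + 2) ^ ν) *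
        ∑ a ∈ range n, (A x s a).indicator (fun _ => (1 : ℝ≥0∞)) V) ∂locationLaw 1 n ≤
      ENNReal.ofReal (1 + C) := by
    intro x
    rw [lintegral_add_left measurable_const, lintegral_const, measure_univ, mul_one,
      lintegral_finsetSum _ fun s _ => hm2 x s, ENNReal.ofReal_add zero_le_one hC.le,
      ENNReal.ofReal_one]
    refine add_le_add le_rfl ?_
    have hs : ∀ s ∈ range n, ∫⁻ V, ENNReal.ofReal (((s : ℝ) + 2) ^ ν) *
        ∑ a ∈ range n, (A x s a).indicator (fun _ => (1 : ℝ≥0∞)) V ∂locationLaw 1 n ≤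
        ENNReal.ofReal (((s : ℝ) + 2) ^ ν * Real.exp (-((s : ℝ) / 2))) := by
      intro s _
      rw [lintegral_const_mul _ (Finset.measurable_sum _ fun a _ => hm1 x s a),
        lintegral_finsetSum _ fun a _ => hm1 x s a, ENNReal.ofReal_mul (by positivity)]
      refine mul_le_mul_right ?_ _
      have ha : ∀ a ∈ range n, ∫⁻ V, (A x s a).indicator (fun _ => (1 : ℝ≥0∞)) V ∂locationLaw 1 n ≤
          (n : ℝ≥0∞)⁻¹ * ENNReal.ofReal (Real.exp (-((s : ℝ) / 2))) := by
        intro a _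
        rw [lintegral_indicator_const (hAm x s a), one_mul]
        exact hAle x s a
      refine (sum_le_card_nsmul _ _ _ ha).trans (le_of_eq ?_)
      rw [card_range, nsmul_eq_mul, ← mul_assoc, ENNReal.mul_inv_cancel (by exact_mod_cast hn0.ne')
        (ENNReal.natCast_ne_top n), one_mul]
    refine (sum_le_sum hs).trans ?_
    rw [← ENNReal.ofReal_sum_of_nonneg fun s _ => by positivity]
    exact ENNReal.ofReal_le_ofReal (hsum n)
  refine (sum_le_sum fun x _ => hx x).trans (le_of_eq ?_)
  rw [sum_const, card_univ, Fintype.card_fin, nsmul_eq_mul, mul_comm (1 + C),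
    ENNReal.ofReal_mul hnr.le, ENNReal.ofReal_natCast]

theorem hasEnergyBound_one (hν : 1 < ν) : HasEnergyBound 1 ν := by
  obtain ⟨C₁, hC₁, h1⟩ := lintegral_gapSum_le hν
  obtain ⟨C₂, hC₂, h2⟩ := sum_weight_energy_le (d := 1) le_rfl hν
  refine ⟨C₁ * (2 + 2 ^ (ν - 1) * C₂), by positivity, fun n hn δ hδ => ?_⟩
  have hn0 : 0 < n := by omega
  have hnr : (0 : ℝ) < n := by exact_mod_cast hn0
  set w := weight 1 ν n δ with hw
  set c : ℝ := 2 + ∑ K ∈ range (Nat.clog 2 n), (2 * ((n : ℝ) / 2 ^ K) / (1 + w K)) ^ (ν - 1) with hc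
  have hc0 : 0 ≤ c := by positivity
  refine ⟨fun V => ENNReal.ofReal c * ENNReal.ofReal (gapSum ν V univ),
    (measurable_gapSum ν univ).ennreal_ofReal.const_mul _, ?_, ?_⟩
  · rw [lintegral_const_mul _ (measurable_gapSum ν univ).ennreal_ofReal]
    refine (mul_le_mul_right (h1 n hn) _).trans ?_
    rw [← ENNReal.ofReal_mul hc0]
    refine ENNReal.ofReal_le_ofReal ?_
    have e : ∀ K, (2 * ((n : ℝ) / 2 ^ K) / (1 + (w K : ℝ))) ^ (ν - 1) * n = 2 ^ (ν - 1) *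
        ((2 : ℝ) ^ K * ((n : ℝ) / 2 ^ K) ^ (ν / (1 : ℕ)) * (1 + (w K : ℝ)) ^ (1 - ν)) := by
      intro K
      have hx : (0 : ℝ) < (n : ℝ) / 2 ^ K := by positivity
      have hw0 : (0 : ℝ) < 1 + (w K : ℝ) := by positivity
      have e1 : (n : ℝ) = 2 ^ K * ((n : ℝ) / 2 ^ K) := by field_simp
      have e2 : ((n : ℝ) / 2 ^ K) ^ (ν / (1 : ℕ)) =
          ((n : ℝ) / 2 ^ K) ^ (ν - 1) * ((n : ℝ) / 2 ^ K) := by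
        rw [Nat.cast_one, div_one, Real.rpow_sub_one hx.ne', div_mul_cancel₀ _ hx.ne']
      rw [Real.div_rpow (by positivity) hw0.le, Real.mul_rpow (by norm_num) hx.le, e2,
        ← neg_sub ν 1, Real.rpow_neg hw0.le]
      nth_rw 2 [e1]
      field_simp
    have h3 := h2 n hn δ hδ
    have h4 : c * n ≤ (2 + 2 ^ (ν - 1) * C₂) * rate 1 ν n δ := by
      rw [hc, add_mul, sum_mul]
      simp only [e]
      rw [← mul_sum, add_mul, mul_assoc _ C₂]
      have h5 := le_rate (d := 1) (ν := ν) (δ := δ) n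
      have h6 := mul_le_mul_of_nonneg_left h3 (by positivity : (0 : ℝ) ≤ 2 ^ (ν - 1))
      linarith
    have := mul_le_mul_of_nonneg_left h4 hC₁.le
    linarith
  · filter_upwards [ae_coord_ne le_rfl hn0] with V hV Y ψ r out hout
    rw [← ENNReal.ofReal_mul hc0]
    exact ENNReal.ofReal_le_ofReal (hout.energy_le_gapSum ψ hν (hV 0))

end LineExpectation

/-! ### The two bounds combined -/

section Conclusion

variable {d : ℕ} {ν : ℝ}

theorem hasEnergyBound (hd : 1 ≤ d) (hν : 1 < ν) : HasEnergyBound d ν := by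
  rcases hd.eq_or_lt with rfl | h
  · exact hasEnergyBound_one hν
  · exact hasEnergyBound_of_two_le h hν

lemma latency_aggPolicy_le (hd : 1 ≤ d) {n : ℕ} {δ : ℝ} (hδ : 0 ≤ δ) {Y : Type} {r : Fin n}
    {ψ : Fin n → Y → ℝ} (hψ : ∀ i, ∃ a b, ψ i a ≠ ψ i b)
    {V : Fin n → EuclideanSpace ℝ (Fin d)} {out : List (ℕ × List (Fin n))}
    (h : IsBisectionOutput ν V (weight d ν n δ) r out) :
    ((aggPolicy ψ (weight d ν n δ) out).latency r (sumFunction ψ) : ℝ) ≤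
      minLatency r (sumFunction ψ) + δ := by
  rw [minLatency_eq hψ]
  have h1 := (Nat.cast_le (α := ℝ)).2 (h.goodPaths.latency_le ψ)
  have h2 := sum_weight_le (ν := ν) (n := n) hd hδ
  push_cast at h1
  rw [sum_add_distrib, sum_const, card_range, nsmul_eq_mul, mul_one] at h1
  linarith

/-- For `ν ≠ d` the rate is a lower bound: the linear term is always needed, and for `ν > d` the
nodes far from the root account for the other term. -/
lemma rate_le_integral_minEnergy (hd : 1 ≤ d) (hν : 1 < ν) : ∃ c : ℝ, 0 < c ∧
    ∀ {n : ℕ} {Y : Type} {δ : ℝ} {r : Fin n} {ψ : Fin n → Y → ℝ}, 4 ≤ n → 0 ≤ δ →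
    (∀ i, ∃ a b, ψ i a ≠ ψ i b) →
    Integrable (minEnergy ν δ r (sumFunction ψ)) (locationLaw d n) → ν ≠ d →
    c * rate d ν n δ ≤ ∫ V, minEnergy ν δ r (sumFunction ψ) V ∂locationLaw d n := by
  obtain ⟨c₁, hc₁, h1⟩ := linear_le_integral_minEnergy hd hν
  obtain ⟨c₂, hc₂, h2⟩ := far_le_integral_minEnergy hd hν
  refine ⟨min c₁ c₂, lt_min hc₁ hc₂, fun {n Y δ r ψ} hn hδ hψ hint hne => ?_⟩
  have l1 := h1 (by omega) hδ hψ hint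
  have l2 := h2 hn hδ hψ hint
  have b1 : min c₁ c₂ * n ≤ c₁ * n := by gcongr; exact min_le_left _ _
  unfold rate
  rw [if_neg hne]
  split_ifs
  · exact b1.trans l1
  · rw [mul_max_of_nonneg _ _ (lt_min hc₁ hc₂).le]
    refine max_le (b1.trans l1) (le_trans ?_ l2)
    gcongr
    exact min_le_right _ _

end Conclusion

end EnergyLatency

theorem theorem1 (d : ℕ) (hd : 1 ≤ d) (ν : ℝ) (hν : 1 < ν) :
    ∃ c C : ℝ, ∃ n₀ : ℕ, 0 < c ∧ 0 < C ∧
      ∀ n : ℕ, n₀ ≤ n → ∀ (r : Fin n) (δ : ℝ), 0 ≤ δ →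
      ∀ (Y : Type) (_ : Finite Y) (ψ : Fin n → Y → ℝ), (∀ i, ∃ a b, ψ i a ≠ ψ i b) →
        -- the expected minimum energy
        Integrable (EnergyLatency.minEnergy ν δ r (EnergyLatency.sumFunction ψ))
          (EnergyLatency.locationLaw d n) ∧
        (ν ≠ d → c * EnergyLatency.rate d ν n δ ≤
          ∫ V, EnergyLatency.minEnergy ν δ r (EnergyLatency.sumFunction ψ) V
            ∂(EnergyLatency.locationLaw d n)) ∧
        ∫ V, EnergyLatency.minEnergy ν δ r (EnergyLatency.sumFunction ψ) V
            ∂(EnergyLatency.locationLaw d n) ≤ C * EnergyLatency.rate d ν n δ ∧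
        -- the bisection policy can be run, is valid, and meets the latency constraint
        (∀ V : Fin n → EuclideanSpace ℝ (Fin d),
          (∃ out, EnergyLatency.IsBisectionOutput ν V (EnergyLatency.weight d ν n δ) r out) ∧
          ∀ out, EnergyLatency.IsBisectionOutput ν V (EnergyLatency.weight d ν n δ) r out →
            (EnergyLatency.aggPolicy ψ (EnergyLatency.weight d ν n δ) out).Valid r
              (EnergyLatency.sumFunction ψ) ∧
            ((EnergyLatency.aggPolicy ψ (EnergyLatency.weight d ν n δ) out).latency r
              (EnergyLatency.sumFunction ψ) : ℝ) ≤
              EnergyLatency.minLatency r (EnergyLatency.sumFunction ψ) + δ) ∧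
        -- its expected energy attains the upper bound, whatever choices the algorithm makes
        ∃ F : (Fin n → EuclideanSpace ℝ (Fin d)) → ℝ,
          Integrable F (EnergyLatency.locationLaw d n) ∧
          ∫ V, F V ∂(EnergyLatency.locationLaw d n) ≤ C * EnergyLatency.rate d ν n δ ∧
          ∀ᵐ V ∂(EnergyLatency.locationLaw d n), ∀ out,
            EnergyLatency.IsBisectionOutput ν V (EnergyLatency.weight d ν n δ) r out →
            (EnergyLatency.aggPolicy ψ (EnergyLatency.weight d ν n δ) out).energy ν V ≤ F V := by
  classical
  obtain ⟨c, hc, hlow⟩ := EnergyLatency.rate_le_integral_minEnergy hd hν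
  obtain ⟨C, hC, hup⟩ := EnergyLatency.hasEnergyBound hd hν
  refine ⟨c, C, 4, hc, hC, fun n hn r δ hδ Y _ ψ hψ => ?_⟩
  obtain ⟨G, hGm, hGle, hG⟩ := hup n (by omega) δ hδ
  have hrate : 0 ≤ C * EnergyLatency.rate d ν n δ :=
    mul_nonneg hC.le ((Nat.cast_nonneg n).trans (EnergyLatency.le_rate n))
  have hGtop : ∫⁻ V, G V ∂EnergyLatency.locationLaw d n ≠ ⊤ :=
    (hGle.trans_lt ENNReal.ofReal_lt_top).ne
  have hFint : Integrable (fun V => (G V).toReal) (EnergyLatency.locationLaw d n) :=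
    integrable_toReal_of_lintegral_ne_top hGm.aemeasurable hGtop
  have hGfin : ∀ᵐ V ∂EnergyLatency.locationLaw d n, G V < ⊤ := ae_lt_top hGm hGtop
  have hFle : ∫ V, (G V).toReal ∂EnergyLatency.locationLaw d n ≤
      C * EnergyLatency.rate d ν n δ := by
    rw [integral_toReal hGm.aemeasurable hGfin]
    exact ENNReal.toReal_le_of_le_ofReal hrate hGle
  have hF : ∀ᵐ V ∂EnergyLatency.locationLaw d n, ∀ out,
      EnergyLatency.IsBisectionOutput ν V (EnergyLatency.weight d ν n δ) r out →
      (EnergyLatency.aggPolicy ψ (EnergyLatency.weight d ν n δ) out).energy ν V ≤ (G V).toReal := by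
    filter_upwards [hG, hGfin] with V hV hVfin out hout
    exact (ENNReal.ofReal_le_iff_le_toReal hVfin.ne).1 (hV Y ψ r out hout)
  have hmin : ∀ᵐ V ∂EnergyLatency.locationLaw d n,
      EnergyLatency.minEnergy ν δ r (EnergyLatency.sumFunction ψ) V ≤ (G V).toReal := by
    filter_upwards [hF] with V hV
    obtain ⟨out, hout⟩ :=
      EnergyLatency.exists_isBisectionOutput hd ν V (EnergyLatency.weight d ν n δ) r
    exact (EnergyLatency.minEnergy_le (hout.goodPaths.valid ψ)
      (EnergyLatency.latency_aggPolicy_le hd hδ hψ hout)).trans (hV out hout)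
  have hint : Integrable (EnergyLatency.minEnergy ν δ r (EnergyLatency.sumFunction ψ))
      (EnergyLatency.locationLaw d n) := by
    refine hFint.mono' (EnergyLatency.measurable_minEnergy _).aestronglyMeasurable ?_
    filter_upwards [hmin] with V hV
    rwa [Real.norm_of_nonneg (EnergyLatency.minEnergy_nonneg _ V)]
  exact ⟨hint, fun hne => hlow hn hδ hψ hint hne, (integral_mono_ae hint hFint hmin).trans hFle,
    fun V => ⟨EnergyLatency.exists_isBisectionOutput hd ν V _ r, fun out hout =>
      ⟨hout.goodPaths.valid ψ, EnergyLatency.latency_aggPolicy_le hd hδ hψ hout⟩⟩,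
    fun V => (G V).toReal, hFint, hFle, hF⟩
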